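/- **Setting.** Let $\mathbb K$ be $\mathbb R$ or $\mathbb C$, let $M$ be a smooth manifold of dimension $m$ and let $A\to M$ be a smooth $\mathbb K$-vector bundle of rank $n$; functions, $TM$ and $\wedge^mT^*M$ are taken with coefficients in $\mathbb K$. Suppose that $A$ and $A^*$ carry Lie algebroid structures $([\cdot,\cdot],\rho)$ and $([\cdot,\cdot]_*,\rho_*)$, with differentials $d$ on $\Gamma(\wedge A^*)$ and $d_*$ on $\Gamma(\wedge A)$, and that $(A,A^*)$ is a *Lie bialgebroid*: with $[\cdot,\cdot]$ extended to the Schouten bracket on $\Gamma(\wedge A)$, $$d_*[u,v]=[d_*u,v]+(-1)^{k-1}[u,d_*v],\qquad u\in\Gamma(\wedge^kA),\ v\in\Gamma(\wedge A).$$ Let $s\in\Gamma(\wedge^mT^*M)$ and $\Omega\in\Gamma(\wedge^nA^*)$ be nowhere vanishing, and let $V\in\Gamma(\wedge^nA)$ be dual to $\Omega$, $\langle\Omega,V\rangle=1$. Let $X_0\in\Gamma(A)$ and $\xi_0\in\Gamma(A^*)$ be the modular cocycles, that is, the unique sections with $$L_\theta(\Omega\otimes s)=(L_\theta\Omega)\otimes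 s+\Omega\otimes L_{\rho_*(\theta)}s=\langle X_0,\theta\rangle\,\Omega\otimes s\quad\text{for all }\theta\in\Gamma(A^*),$$ $$L_u(s\otimes V)=(L_{\rho(u)}s)\otimes V+s\otimes L_uV=\langle\xi_0,u\rangle\,s\otimes V\quad\text{for all }u\in\Gamma(A).$$ **The operators.** Trivialise $\mathscr L=(\wedge^nA^*\otimes\wedge^mT^*M)^{1/2}$ by $(\Omega\otimes s)^{1/2}$ and $\mathscr L'=(\wedge^nA\otimes\wedge^mT^*M)^{1/2}$ by $(s\otimes V)^{1/2}$. Then $\theta\in\Gamma(A^*)$ acts on $\Gamma(\mathscr L)=C^\infty(M,\mathbb K)$ by $f\mapsto\rho_*(\theta)f+\tfrac12\langle X_0,\theta\rangle f$, and $u\in\Gamma(A)$ acts on $\Gamma(\mathscr L')=C^\infty(M,\mathbb K)$ by $f\mapsto\rho(u)f+\tfrac12\langle\xi_0,u\rangle f$. Let $\breve d_*$ on $\Gamma(\wedge A\otimes\mathscr L)=\Gamma(\wedge A)$ and $\breve d$ on $\Gamma(\wedge A^*\otimes\mathscr L')=\Gamma(\wedge A^*)$ be the Lie algebroid differentials of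 $A^*$ and $A$ with these coefficients. For $\alpha\in\Gamma(\wedge^kA^*)$ let $V^\sharp\alpha=\iota_\alpha V\in\Gamma(\wedge^{n-k}A)$, where $\langle\iota_\alpha V,\eta\rangle=\langle V,\alpha\wedge\eta\rangle$ for $\eta\in\Gamma(\wedge^{n-k}A^*)$; $V^\sharp$ is an isomorphism. Let $\breve\partial$ be the operator of degree $-1$ on $\Gamma(\wedge A)$ given by $$\breve\partial(V^\sharp\alpha)=(-1)^kV^\sharp(\breve d\alpha),\qquad\alpha\in\Gamma(\wedge^kA^*),$$ and let $Ð=\breve d_*+\breve\partial$ on $\Gamma(\wedge A)$. Let $Ð_*=\breve d+\breve\partial_*$ on $\Gamma(\wedge A^*)$ be the operator obtained in the same way by exchanging the roles of $(A,\Omega,\xi_0)$ and $(A^*,V,X_0)$. **Claim.** There is a function $\varphi\in C^\infty(M,\mathbb K)$ such that $Ð^2$ and $Ð_*^2$ are both multiplication by $\varphi$, and $\varphi$ is determined by either of two equalities: for every $f\in C^\infty(M,\mathbb K)$, 1. $L_{X_0}(\Omega\otimes s)=(L_{X_0}\Omega)\otimes s+\Omega\otimes L_{\rho(X_0)}s=4f\,(\Omega\otimes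 s)$ if and only if $f=\varphi$; 2. $L_{\xi_0}(s\otimes V)=(L_{\rho_*(\xi_0)}s)\otimes V+s\otimes L_{\xi_0}V=4f\,(s\otimes V)$ if and only if $f=\varphi$. -/

import Mathlib

open scoped TensorProduct Manifold ContDiff

noncomputable section

namespace LieBialgebroids

section Algebra

variable {R P Q N : Type*} [CommRing R] [Algebra ℝ R]
  [AddCommGroup P] [Module R P] [AddCommGroup Q] [Module R Q] [AddCommGroup N] [Module R N]

/-- A Lie algebroid structure on a (real or complex) vector bundle `A → M`. Here `R` is the ring of
smooth (real or complex valued) functions on `M` and `P` is the `R`-module of smooth sections of `A`.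
Bundle maps `A → TM` (or `A → TM ⊗ ℂ`) are the same as `R`-linear maps from `P` to the vector
fields, and vector fields are the derivations of `R`; over `ℂ`, the `ℝ`-linear derivations of the
algebra of complex valued functions are automatically `ℂ`-linear and are the sections of `TM ⊗ ℂ`.
Additivity and the Leibniz rule force the bracket to be bilinear over the scalars, since
derivations kill constants. -/
structure LieAlgebroid (R P : Type*) [CommRing R] [Algebra ℝ R] [AddCommGroup P] [Module R P] where
  bracket : P →+ P →+ P
  anchor : P →ₗ[R] Derivation ℝ R R
  bracket_self : ∀ X, bracket X X = 0
  jacobi : ∀ X Y Z,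
    bracket X (bracket Y Z) = bracket (bracket X Y) Z + bracket Y (bracket X Z)
  anchor_bracket : ∀ X Y, anchor (bracket X Y) = ⁅anchor X, anchor Y⁆
  leibniz : ∀ (X : P) (f : R) (Y : P),
    bracket X (f • Y) = anchor X f • Y + f • bracket X Y

/-- An additive operator on the sections of a vector bundle that satisfies the Leibniz rule over a
vector field, its symbol. Lie derivatives of sections are of this kind. -/
structure DerivativeEndo (R N : Type*) [CommRing R] [Algebra ℝ R] [AddCommGroup N]
    [Module R N] where
  symbol : Derivation ℝ R R
  op : N →+ N
  leibniz : ∀ (f : R) (Y : N), op (f • Y) = symbol f • Y + f • op Y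

namespace DerivativeEndo

/-- The Lie derivative of an alternating form on `N` induced by an operator `T` on `N`:
`(T·α)(X₁,…,X_k) = symbol(T)(α(X₁,…,X_k)) - ∑ᵢ α(X₁,…,T Xᵢ,…,X_k)`. -/
def lie {k : ℕ} (T : DerivativeEndo R N) (α : N [⋀^Fin k]→ₗ[R] R) : N [⋀^Fin k]→ₗ[R] R where
  toFun X := T.symbol (α X) - ∑ i, α (Function.update X i (T.op (X i)))
  map_update_add' := by
    intro inst X i x y
    obtain rfl : inst = instDecidableEqFin k := Subsingleton.elim _ _
    rw [← Finset.add_sum_erase _ _ (Finset.mem_univ i), ← Finset.add_sum_erase _ _ (Finset.mem_univ i),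
      ← Finset.add_sum_erase _ _ (Finset.mem_univ i)]
    have h : ∑ j ∈ Finset.univ.erase i, α (Function.update (Function.update X i (x + y)) j
          (T.op (Function.update X i (x + y) j))) =
        ∑ j ∈ Finset.univ.erase i, α (Function.update (Function.update X i x) j
          (T.op (Function.update X i x j))) +
        ∑ j ∈ Finset.univ.erase i, α (Function.update (Function.update X i y) j
          (T.op (Function.update X i y j))) := by
      rw [← Finset.sum_add_distrib]
      refine Finset.sum_congr rfl fun j hj => ?_
      have hji : j ≠ i := (Finset.mem_erase.1 hj).1
      simp only [Function.update_of_ne hji]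
      rw [Function.update_comm hji.symm, Function.update_comm hji.symm,
        Function.update_comm hji.symm, AlternatingMap.map_update_add]
    rw [h]
    simp only [Function.update_self, Function.update_idem, AlternatingMap.map_update_add, map_add]
    ring
  map_update_smul' := by
    intro inst X i f x
    obtain rfl : inst = instDecidableEqFin k := Subsingleton.elim _ _
    rw [← Finset.add_sum_erase _ _ (Finset.mem_univ i), ← Finset.add_sum_erase _ _ (Finset.mem_univ i)]
    have h : ∑ j ∈ Finset.univ.erase i, α (Function.update (Function.update X i (f • x)) j
          (T.op (Function.update X i (f • x) j))) =
        f * ∑ j ∈ Finset.univ.erase i, α (Function.update (Function.update X i x) j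
          (T.op (Function.update X i x j))) := by
      rw [Finset.mul_sum]
      refine Finset.sum_congr rfl fun j hj => ?_
      have hji : j ≠ i := (Finset.mem_erase.1 hj).1
      simp only [Function.update_of_ne hji]
      rw [Function.update_comm hji.symm, Function.update_comm hji.symm,
        AlternatingMap.map_update_smul, smul_eq_mul]
    rw [h]
    simp only [Function.update_self, Function.update_idem, T.leibniz,
      AlternatingMap.map_update_add, AlternatingMap.map_update_smul, smul_eq_mul,
      Derivation.leibniz]
    ring
  map_eq_zero_of_eq' := by
    intro X a b hab hne
    have h0 : α X = 0 := α.map_eq_zero_of_eq X hab hne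
    rw [Fintype.sum_eq_add a b hne]
    · have hs : Function.update X b (T.op (X b)) =
          Function.update X a (T.op (X a)) ∘ Equiv.swap a b := by
        funext j
        by_cases hj : j = a
        · subst hj; simp [hne, hab, Function.update_of_ne hne.symm]
        · by_cases hj' : j = b
          · subst hj'; simp [hab]
          · simp [hj, hj', Equiv.swap_apply_of_ne_of_ne hj hj']
      rw [hs, α.map_swap _ hne, h0]
      simp
    · intro j ⟨hja, hjb⟩
      refine α.map_eq_zero_of_eq _ (i := a) (j := b) ?_ hne
      rw [Function.update_of_ne hja.symm, Function.update_of_ne hjb.symm, hab]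

theorem lie_apply {k : ℕ} (T : DerivativeEndo R N) (α : N [⋀^Fin k]→ₗ[R] R) (X : Fin k → N) :
    T.lie α X = T.symbol (α X) - ∑ i, α (Function.update X i (T.op (X i))) := rfl

/-- The Lie derivative of vector fields along a vector field `D`, namely `E ↦ [D, E]`. -/
def ofVectorField (D : Derivation ℝ R R) : DerivativeEndo R (Derivation ℝ R R) where
  symbol := D
  op := { toFun := fun E => ⁅D, E⁆, map_zero' := lie_zero D, map_add' := lie_add D }
  leibniz f E := by
    ext g
    simp [Derivation.commutator_apply]
    ring

/-- The operator on the dual bundle induced by an operator `T`, through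
`⟨Y, T ξ⟩ = symbol(T)⟨Y, ξ⟩ - ⟨T Y, ξ⟩`. -/
def dual (p : P →ₗ[R] Q →ₗ[R] R) [p.IsPerfPair] (T : DerivativeEndo R P) : DerivativeEndo R Q where
  symbol := T.symbol
  op :=
    { toFun := fun ξ => p.flip.toPerfPair.symm
        { toFun := fun Y => T.symbol (p Y ξ) - p (T.op Y) ξ
          map_add' := fun Y Z => by simp; ring
          map_smul' := fun f Y => by simp [T.leibniz]; ring }
      map_zero' := by
        rw [LinearEquiv.symm_apply_eq]; ext Y; simp
      map_add' := fun ξ η => by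
        rw [LinearEquiv.symm_apply_eq]; ext Y
        simp
        ring }
  leibniz f ξ := by
    apply p.flip.toPerfPair.injective
    ext Y
    simp
    ring

end DerivativeEndo

namespace LieAlgebroid

/-- The Lie derivative `Y ↦ [X, Y]` of sections along a section `X` of the Lie algebroid. -/
def ad (L : LieAlgebroid R P) (X : P) : DerivativeEndo R P where
  symbol := L.anchor X
  op := L.bracket X
  leibniz := L.leibniz X

theorem bracket_skew (L : LieAlgebroid R P) (X Y : P) : L.bracket X Y = -L.bracket Y X := by
  have h := L.bracket_self (X + Y)
  simp only [map_add, AddMonoidHom.add_apply, L.bracket_self] at h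
  rw [eq_neg_iff_add_eq_zero]
  simpa [add_comm] using h

/-- The bracket part of the Koszul formula,
`∑_{i<j} (-1)^{i+j} α([Xᵢ,Xⱼ], X₀,…,X̂ᵢ,…,X̂ⱼ,…,X_k)`; the indices `i < j` of the formula are
`i.castSucc` and `j.succ` with `i ≤ j`. -/
def koszulBracket (L : LieAlgebroid R P) :
    {k : ℕ} → (P [⋀^Fin k]→ₗ[R] R) → (Fin (k + 1) → P) → R
  | 0, _, _ => 0
  | k + 1, α, X => ∑ i : Fin (k + 1), ∑ j ∈ Finset.Ici i,
      (-1) ^ ((i : ℕ) + (j + 1 : ℕ)) * α (Matrix.vecCons (L.bracket (X i.castSucc) (X j.succ))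
        (j.removeNth (i.castSucc.removeNth X)))

/-- The Koszul formula for the differential of a form with values in a trivialised line bundle, on which
a section `X` acts by `∇_X f = ρ(X) f + θ(X) f`:
`∑ᵢ (-1)^i ∇_{Xᵢ} α(X₀,…,X̂ᵢ,…,X_k) + ∑_{i<j} (-1)^{i+j} α([Xᵢ,Xⱼ],…,X̂ᵢ,…,X̂ⱼ,…)`. -/
def koszul (L : LieAlgebroid R P) (θ : Module.Dual R P) {k : ℕ} (α : P [⋀^Fin k]→ₗ[R] R)
    (X : Fin (k + 1) → P) : R :=
  (∑ i : Fin (k + 1), (-1) ^ (i : ℕ) *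
    (L.anchor (X i) (α (i.removeNth X)) + θ (X i) * α (i.removeNth X))) + L.koszulBracket α X

theorem two_mul_koszulBracket (L : LieAlgebroid R P) {k : ℕ} (α : P [⋀^Fin k]→ₗ[R] R)
    (X : Fin (k + 1) → P) :
    2 * L.koszulBracket α X = - ∑ i : Fin (k + 1), (-1) ^ (i : ℕ) *
      ∑ j, α (Function.update (i.removeNth X) j (L.bracket (X i) (i.removeNth X j))) := by
  cases k with
  | zero => simp [koszulBracket]
  | succ k =>
    simp only [koszulBracket, Finset.mul_sum]
    rw [Fin.sum_sum_eq_sum_triangle_add, ← Finset.sum_neg_distrib]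
    refine Fintype.sum_congr _ _ fun i => ?_
    rw [← Finset.sum_neg_distrib]
    refine Finset.sum_congr rfl fun j hj => ?_
    rw [Finset.mem_Ici] at hj
    simp only [← Fin.insertNth_removeNth, AlternatingMap.map_insertNth]
    have H₁ : i.castSucc.removeNth X j = X j.succ := by
      simp [Fin.removeNth_apply, Fin.succAbove_of_le_castSucc, hj]
    have H₂ : j.succ.removeNth X i = X i.castSucc := by
      simp [Fin.removeNth_apply, Fin.succAbove_of_castSucc_lt, hj]
    have H₃ : i.removeNth (j.succ.removeNth X) = j.removeNth (i.castSucc.removeNth X) := by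
      rw [Fin.removeNth_removeNth_eq_swap]
      simp [Fin.predAbove, hj, Fin.succAbove]
    rw [H₁, H₂, H₃, L.bracket_skew (X j.succ)]
    have : Matrix.vecCons (-L.bracket (X i.castSucc) (X j.succ))
        (j.removeNth (i.castSucc.removeNth X)) = Function.update
        (Matrix.vecCons (L.bracket (X i.castSucc) (X j.succ))
        (j.removeNth (i.castSucc.removeNth X))) 0 (-L.bracket (X i.castSucc) (X j.succ)) := by
      simp [Matrix.vecCons]
    rw [this, AlternatingMap.map_update_neg]
    simp [Matrix.vecCons]
    ring


/-- An `R`-multilinear alternating form, regarded as a `ℤ`-multilinear one. -/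
def toInt {k : ℕ} (α : P [⋀^Fin k]→ₗ[R] R) : P [⋀^Fin k]→ₗ[ℤ] R :=
  { α.toMultilinearMap.restrictScalars ℤ with
    map_eq_zero_of_eq' := α.map_eq_zero_of_eq' }

@[simp] theorem toInt_apply {k : ℕ} (α : P [⋀^Fin k]→ₗ[R] R) (X : Fin k → P) :
    toInt α X = α X := rfl

/-- Auxiliary: twice the Koszul expression as a `ℤ`-multilinear alternating map. -/
def koszulAux (L : LieAlgebroid R P) (θ : Module.Dual R P) {k : ℕ} (α : P [⋀^Fin k]→ₗ[R] R) :
    P [⋀^Fin (k + 1)]→ₗ[ℤ] R :=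
  AlternatingMap.alternatizeUncurryFin
    (AddMonoidHom.toIntLinearMap
      { toFun := fun X => toInt ((L.ad X).lie α) +
          ((L.anchor X : R →ₗ[ℝ] R).toAddMonoidHom.toIntLinearMap +
            (2 * θ X) • LinearMap.id).compAlternatingMap (toInt α)
        map_zero' := by
          ext v; simp [DerivativeEndo.lie_apply, ad]
        map_add' := fun X Y => by
          ext v
          simp [DerivativeEndo.lie_apply, ad, Finset.sum_add_distrib, AlternatingMap.map_update_add]
          ring })

theorem koszulAux_apply (L : LieAlgebroid R P) (θ : Module.Dual R P) {k : ℕ}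
    (α : P [⋀^Fin k]→ₗ[R] R) (X : Fin (k + 1) → P) :
    L.koszulAux θ α X = 2 * L.koszul θ α X := by
  rw [koszul, mul_add, two_mul_koszulBracket, koszulAux, AlternatingMap.alternatizeUncurryFin_apply,
    Finset.mul_sum, ← Finset.sum_neg_distrib, ← Finset.sum_add_distrib]
  refine Finset.sum_congr rfl fun i _ => ?_
  simp [DerivativeEndo.lie_apply, ad]
  ring

theorem koszulAux_cons_smul (L : LieAlgebroid R P) (θ : Module.Dual R P) {k : ℕ}
    (α : P [⋀^Fin k]→ₗ[R] R) (f : R) (x : P) (X : Fin k → P) :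
    L.koszulAux θ α (Fin.cons (f • x) X) = f * L.koszulAux θ α (Fin.cons x X) := by
  have hrem : ∀ (i : Fin k) (y : P), (i.succ).removeNth (Fin.cons y X : Fin (k + 1) → P) =
      Function.update (i.succ.removeNth (Fin.cons x X : Fin (k + 1) → P)) ⟨0, i.pos⟩ y := by
    intro i y
    cases k with
    | zero => exact i.elim0
    | succ k =>
      funext j
      refine Fin.cases ?_ (fun j => ?_) j
      · simp [Fin.removeNth_apply]
      · have : j.succ ≠ (⟨0, i.pos⟩ : Fin (k + 1)) := Fin.succ_ne_zero j
        simp [Fin.removeNth_apply]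
  have hmove : ∀ i : Fin k, α (Function.update X i x) =
      (-1) ^ (i : ℕ) * α (i.succ.removeNth (Fin.cons x X : Fin (k + 1) → P)) := by
    intro i
    cases k with
    | zero => exact i.elim0
    | succ k =>
      rw [← Fin.insertNth_removeNth, AlternatingMap.map_insertNth]
      have : Matrix.vecCons x (i.removeNth X) =
          i.succ.removeNth (Fin.cons x X : Fin (k + 1 + 1) → P) := by
        funext j
        refine Fin.cases ?_ (fun j => ?_) j <;> simp [Fin.removeNth_apply, Matrix.vecCons]
      rw [this]
      simp
  have hbr : ∀ Y, L.bracket (f • x) Y = f • L.bracket x Y + (-(L.anchor Y f)) • x := by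
    intro Y
    rw [L.bracket_skew, L.leibniz, L.bracket_skew x Y]
    module
  have hsm : ∀ (β : P [⋀^Fin k]→ₗ[R] R) (i : Fin k),
      β (i.succ.removeNth (Fin.cons (f • x) X : Fin (k + 1) → P)) =
        f * β (i.succ.removeNth (Fin.cons x X : Fin (k + 1) → P)) := by
    intro β i
    rw [hrem i (f • x), AlternatingMap.map_update_smul, ← hrem i x, smul_eq_mul]
  simp only [koszulAux, AlternatingMap.alternatizeUncurryFin_apply, Fin.sum_univ_succ,
    Fin.cons_zero, Fin.cons_succ, Fin.removeNth_zero, Fin.tail_cons]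
  simp [hsm, DerivativeEndo.lie_apply, ad, hbr, AlternatingMap.map_update_add,
    AlternatingMap.map_update_smul, AlternatingMap.map_update_neg, hmove, Finset.sum_add_distrib,
    mul_add, Finset.mul_sum, -map_neg]
  have key : ∑ i : Fin k, (-1) ^ ((i : ℕ) + 1) *
        (α (i.succ.removeNth (Fin.cons x X : Fin (k + 1) → P)) * L.anchor (X i) f) =
      -∑ i : Fin k, L.anchor (X i) f *
        ((-1) ^ (i : ℕ) * α (i.succ.removeNth (Fin.cons x X : Fin (k + 1) → P))) := by
    rw [← Finset.sum_neg_distrib]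
    exact Finset.sum_congr rfl fun i _ => by ring
  rw [key]
  simp only [fun a b : R => mul_left_comm a f b, ← Finset.mul_sum]
  ring

theorem koszulAux_update_smul (L : LieAlgebroid R P) (θ : Module.Dual R P) {k : ℕ}
    (α : P [⋀^Fin k]→ₗ[R] R) (X : Fin (k + 1) → P) (i : Fin (k + 1)) (f : R) (x : P) :
    L.koszulAux θ α (Function.update X i (f • x)) =
      f * L.koszulAux θ α (Function.update X i x) := by
  have h : ∀ y : P, L.koszulAux θ α (Function.update X i y) =
      Equiv.Perm.sign (Equiv.swap 0 i) •
        L.koszulAux θ α (Fin.cons y (Fin.tail (X ∘ Equiv.swap 0 i))) := by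
    intro y
    have : Function.update X i y =
        (Fin.cons y (Fin.tail (X ∘ Equiv.swap 0 i)) : Fin (k + 1) → P) ∘ Equiv.swap 0 i := by
      funext j
      by_cases hj : j = i
      · subst hj; simp
      · have h0 : Equiv.swap 0 i j ≠ 0 := by
          intro h
          rw [Equiv.swap_apply_eq_iff, Equiv.swap_apply_left] at h
          exact hj h
        obtain ⟨l, hl⟩ := Fin.exists_succ_eq.2 h0
        simp only [Function.comp_apply, Function.update_of_ne hj]
        rw [← hl, Fin.cons_succ, Fin.tail, hl]
        simp
    rw [this, AlternatingMap.map_perm]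
  rw [h, h, koszulAux_cons_smul]
  rcases Int.units_eq_one_or (Equiv.Perm.sign (Equiv.swap 0 i)) with h | h <;> simp [h]

theorem eq_of_two_mul_eq {a b : R} (h : 2 * a = 2 * b) : a = b := by
  have h2 : algebraMap ℝ R (1 / 2) * 2 = 1 := by
    rw [← map_ofNat (algebraMap ℝ R) 2, ← map_mul]; norm_num
  calc a = algebraMap ℝ R (1 / 2) * 2 * a := by rw [h2, one_mul]
    _ = algebraMap ℝ R (1 / 2) * 2 * b := by rw [mul_assoc, h, mul_assoc]
    _ = b := by rw [h2, one_mul]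

/-- The Lie algebroid differential `Γ(∧^k P*) → Γ(∧^{k+1} P*)` with coefficients in a trivialised line
bundle on which a section `X` acts by `∇_X f = ρ(X) f + θ(X) f`. For `θ = 0` it is the ordinary
Lie algebroid differential. -/
def diff (L : LieAlgebroid R P) (θ : Module.Dual R P) {k : ℕ} (α : P [⋀^Fin k]→ₗ[R] R) :
    P [⋀^Fin (k + 1)]→ₗ[R] R where
  toFun := L.koszul θ α
  map_update_add' := by
    intro inst X i x y
    obtain rfl : inst = instDecidableEqFin (k + 1) := Subsingleton.elim _ _
    apply eq_of_two_mul_eq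
    rw [mul_add, ← koszulAux_apply, ← koszulAux_apply, ← koszulAux_apply,
      AlternatingMap.map_update_add]
  map_update_smul' := by
    intro inst X i f x
    obtain rfl : inst = instDecidableEqFin (k + 1) := Subsingleton.elim _ _
    apply eq_of_two_mul_eq
    rw [← koszulAux_apply, koszulAux_update_smul, koszulAux_apply, smul_eq_mul]
    ring
  map_eq_zero_of_eq' := by
    intro X i j h hij
    apply eq_of_two_mul_eq
    rw [← koszulAux_apply, mul_zero]
    exact AlternatingMap.map_eq_zero_of_eq _ _ h hij

end LieAlgebroid

/-- The graded module of all forms: families `(u_k)` with `u_k` an alternating `R`-multilinear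
`k`-form on `P`. If `P` consists of the sections of `A` this is `Γ(∧A*)`, and if `P` consists of the
sections of `A*` this is `Γ(∧A)`. Forms of degree larger than the rank vanish. -/
abbrev Forms (R P : Type*) [CommRing R] [AddCommGroup P] [Module R P] :=
  ∀ k : ℕ, P [⋀^Fin k]→ₗ[R] R

/-- The wedge product of alternating forms (a sum over shuffles, without factorials). -/
def wedge {k l n : ℕ} (h : k + l = n) (α : P [⋀^Fin k]→ₗ[R] R) (β : P [⋀^Fin l]→ₗ[R] R) :
    P [⋀^Fin n]→ₗ[R] R :=
  ((LinearMap.mul' R R).compAlternatingMap (α.domCoprod β)).domDomCongr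
    (finSumFinEquiv.trans (finCongr h))

/-- The decomposable form `η₁ ∧ ⋯ ∧ η_l`, that is `(X₁,…,X_l) ↦ det ⟨Xᵢ, ηⱼ⟩`. -/
def wedgeAll (p : P →ₗ[R] Q →ₗ[R] R) {l : ℕ} (η : Fin l → Q) : P [⋀^Fin l]→ₗ[R] R :=
  Matrix.detRowAlternating.compLinearMap (LinearMap.pi fun j => p.flip (η j))

namespace Forms

/-- The wedge product on the graded module of all forms. -/
def mul (u v : Forms R P) : Forms R P := fun n =>
  ∑ ij : Finset.HasAntidiagonal.antidiagonal n,
    wedge (Finset.HasAntidiagonal.mem_antidiagonal.1 ij.2) (u ij.1.1) (v ij.1.2)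

/-- A form of degree `k`, regarded as an element of the graded module. -/
def single {k : ℕ} (α : P [⋀^Fin k]→ₗ[R] R) : Forms R P := Pi.single k α

/-- A function, regarded as a form of degree zero. -/
def ofFun (f : R) : Forms R P := single (AlternatingMap.constOfIsEmpty R P (Fin 0) f)

/-- A section of the dual bundle, regarded as a form of degree one. -/
def ofDual (ξ : Module.Dual R P) : Forms R P :=
  single (AlternatingMap.ofSubsingleton R P R (0 : Fin 1) ξ)

end Forms

/-- The differential with coefficients (see `LieAlgebroid.diff`) on the graded module of all
forms. -/
def LieAlgebroid.totalDiff (L : LieAlgebroid R P) (θ : Module.Dual R P) (u : Forms R P) :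
    Forms R P
  | 0 => 0
  | k + 1 => L.diff θ (u k)

/-- `B` is the Schouten bracket of the Lie algebroid `L` on `A` (with `P = Γ(A)` and `Q = Γ(A*)`, so
that `Forms R Q = Γ(∧A)`): the bracket which makes `(Γ(∧A), ∧, B)` a Gerstenhaber algebra and extends
both the bracket of sections and the action of sections on functions through the anchor. It exists
and is unique. Signs such as `(-1)^{(k-1)(l-1)}` are written with exponents of the same parity
in `ℕ`. -/
structure IsSchoutenBracket (p : P →ₗ[R] Q →ₗ[R] R) (L : LieAlgebroid R P)
    (B : Forms R Q →+ Forms R Q →+ Forms R Q) : Prop where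
  degree : ∀ {k l : ℕ} (u : Q [⋀^Fin k]→ₗ[R] R) (v : Q [⋀^Fin l]→ₗ[R] R) (j : ℕ),
    j + 1 ≠ k + l → B (.single u) (.single v) j = 0
  skew : ∀ {k l : ℕ} (u : Q [⋀^Fin k]→ₗ[R] R) (v : Q [⋀^Fin l]→ₗ[R] R),
    B (.single u) (.single v) =
      -((-1 : R) ^ ((k + 1) * (l + 1)) • B (.single v) (.single u))
  jacobi : ∀ {k l j : ℕ} (u : Q [⋀^Fin k]→ₗ[R] R) (v : Q [⋀^Fin l]→ₗ[R] R)
      (w : Q [⋀^Fin j]→ₗ[R] R),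
    B (.single u) (B (.single v) (.single w)) = B (B (.single u) (.single v)) (.single w) +
      (-1 : R) ^ ((k + 1) * (l + 1)) • B (.single v) (B (.single u) (.single w))
  leibniz : ∀ {k l j : ℕ} (u : Q [⋀^Fin k]→ₗ[R] R) (v : Q [⋀^Fin l]→ₗ[R] R)
      (w : Q [⋀^Fin j]→ₗ[R] R),
    B (.single u) (.mul (.single v) (.single w)) =
      .mul (B (.single u) (.single v)) (.single w) +
        (-1 : R) ^ ((k + 1) * l) • Forms.mul (.single v) (B (.single u) (.single w))
  section_section : ∀ X Y : P, B (.ofDual (p X)) (.ofDual (p Y)) = .ofDual (p (L.bracket X Y))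
  section_function : ∀ (X : P) (f : R), B (.ofDual (p X)) (.ofFun f) = .ofFun (L.anchor X f)

/-- The Lie algebroids `L` on `A` and `Ls` on `A*` form a Lie bialgebroid: the differential `d_*` of
`Ls` is a derivation of the Gerstenhaber algebra `(Γ(∧A), ∧, [·,·])`, that is,
`d_*[u,v] = [d_*u,v] + (-1)^{k-1} [u,d_*v]` for `u ∈ Γ(∧^k A)` and `v ∈ Γ(∧^l A)`. (Every Lie
algebroid differential is a derivation of the wedge product.) -/
def IsLieBialgebroid (p : P →ₗ[R] Q →ₗ[R] R) (L : LieAlgebroid R P) (Ls : LieAlgebroid R Q) :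
    Prop :=
  ∃ B : Forms R Q →+ Forms R Q →+ Forms R Q, IsSchoutenBracket p L B ∧
    ∀ {k l : ℕ} (u : Q [⋀^Fin k]→ₗ[R] R) (v : Q [⋀^Fin l]→ₗ[R] R),
      Ls.totalDiff 0 (B (.single u) (.single v)) =
        B (Ls.totalDiff 0 (.single u)) (.single v) +
          (-1 : R) ^ (k + 1) • B (.single u) (Ls.totalDiff 0 (.single v))

/-- `⟨Ω, V⟩ = 1` for top degree forms `Ω ∈ Γ(∧^n A*)` and `V ∈ Γ(∧^n A)`, where `∧^n A*` and `∧^n A` are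
paired by `⟨ξ₁ ∧ ⋯ ∧ ξ_n, X₁ ∧ ⋯ ∧ X_n⟩ = det ⟨Xᵢ, ξⱼ⟩`. -/
def AreDual (p : P →ₗ[R] Q →ₗ[R] R) {n : ℕ} (Ω : P [⋀^Fin n]→ₗ[R] R)
    (V : Q [⋀^Fin n]→ₗ[R] R) : Prop :=
  ∀ (X : Fin n → P) (ξ : Fin n → Q), Ω X * V ξ = (Matrix.of fun i j => p (X i) (ξ j)).det

/-- The contraction `V^♯ α = ι_α V ∈ Γ(∧^l A)` of `α ∈ Γ(∧^k A*)`, `k + l = n`, with the element `V` of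
`Γ(∧^n A)` dual to the nowhere vanishing `Ω ∈ Γ(∧^n A*)`, with the convention
`ι_{α ∧ η} = ι_η ι_α`. Since `(ι_α V)(η₁,…,η_l) = ⟨α ∧ η₁ ∧ ⋯ ∧ η_l, V⟩`, it is the unique element
with `α ∧ η₁ ∧ ⋯ ∧ η_l = (ι_α V)(η₁,…,η_l) Ω` for all sections `ηⱼ` of `A*`. -/
def sharp (p : P →ₗ[R] Q →ₗ[R] R) {k l n : ℕ} (h : k + l = n) (Ω : P [⋀^Fin n]→ₗ[R] R)
    (α : P [⋀^Fin k]→ₗ[R] R) : Q [⋀^Fin l]→ₗ[R] R :=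
  Classical.epsilon fun β => ∀ η : Fin l → Q, wedge h α (wedgeAll p η) = β η • Ω

/-- The operator `∂̆ : Γ(∧^{l+1} A ⊗ 𝓛) → Γ(∧^l A ⊗ 𝓛)`: the differential of `A` with coefficients in
the line bundle `(∧^n A ⊗ ∧^m T*M)^{1/2}`, transported by the isomorphisms
`∧^k A* ⊗ (∧^n A ⊗ ∧^m T*M)^{1/2} ≅ ∧^{n-k} A ⊗ 𝓛` given by `V^♯`. With `α` of degree `k = n - (l + 1)`
it reads `∂̆ (V^♯ α) = (-1)^k V^♯ (d̆ α)`. Here `θ` is the connection form of the action of `A` on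
`(∧^n A ⊗ ∧^m T*M)^{1/2}`. -/
def bdel (p : P →ₗ[R] Q →ₗ[R] R) (L : LieAlgebroid R P) (θ : Module.Dual R P) {n : ℕ}
    (Ω : P [⋀^Fin n]→ₗ[R] R) {l : ℕ} (β : Q [⋀^Fin (l + 1)]→ₗ[R] R) : Q [⋀^Fin l]→ₗ[R] R :=
  if h : l + 1 ≤ n then
    (-1 : R) ^ (n - (l + 1)) •
      sharp p (k := n - (l + 1) + 1) (by omega) Ω
        (L.diff θ (Function.invFun (sharp p (k := n - (l + 1)) (by omega) Ω) β))
  else 0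

/-- The operator `D̆ = d̆_* + ∂̆` on `Γ(∧A ⊗ 𝓛)`, where `𝓛 = (∧^n A* ⊗ ∧^m T*M)^{1/2}` is trivialised by
the section `(Ω ⊗ s)^{1/2}`, so that `Γ(∧A ⊗ 𝓛)` is identified with `Γ(∧A)`. A section `η` of `A*`
acts on `𝓛` by half of its action on `∧^n A* ⊗ ∧^m T*M`; since `L_η (Ω ⊗ s) = ⟨X₀, η⟩ Ω ⊗ s`, this
action is `f ↦ ρ_*(η) f + ½ ⟨X₀, η⟩ f` in the trivialisation, and `d̆_*` is the differential of `A*`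
with these coefficients. Likewise a section `u` of `A` acts on `(∧^n A ⊗ ∧^m T*M)^{1/2}`, trivialised by
`(s ⊗ V)^{1/2}`, by `f ↦ ρ(u) f + ½ ⟨ξ₀, u⟩ f`. -/
def dirac (p : P →ₗ[R] Q →ₗ[R] R) (L : LieAlgebroid R P) (Ls : LieAlgebroid R Q) {n : ℕ}
    (Ω : P [⋀^Fin n]→ₗ[R] R) (X₀ : P) (ξ₀ : Q) (u : Forms R Q) : Forms R Q := fun k =>
  Ls.totalDiff ((1 / 2 : ℝ) • p X₀) u k + bdel p L ((1 / 2 : ℝ) • p.flip ξ₀) Ω (u (k + 1))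

/-- The Lie derivative `L(a ⊗ b) = (L a) ⊗ b + a ⊗ (L b)` of a tensor product of two forms. -/
def lieTensor {N' : Type*} [AddCommGroup N'] [Module R N'] {k l : ℕ} (T : DerivativeEndo R N)
    (T' : DerivativeEndo R N') (a : N [⋀^Fin k]→ₗ[R] R) (b : N' [⋀^Fin l]→ₗ[R] R) :
    (N [⋀^Fin k]→ₗ[R] R) ⊗[R] (N' [⋀^Fin l]→ₗ[R] R) :=
  T.lie a ⊗ₜ[R] b + a ⊗ₜ[R] T'.lie b

end Algebra

section Bundle

open Bundle

/-- The ring of smooth `𝕜`-valued functions on an `m`-dimensional manifold `M`, where `𝕜` is `ℝ` or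
`ℂ`. -/
abbrev SmoothFn (𝕜 : Type*) [RCLike 𝕜] (m : ℕ) (M : Type*) [TopologicalSpace M]
    [ChartedSpace (EuclideanSpace ℝ (Fin m)) M] : Type _ :=
  C^∞⟮𝓡 m, M; 𝓘(ℝ, 𝕜), 𝕜⟯

/-- The smooth sections `Γ(A)` of a smooth `𝕜`-vector bundle `A → M` of rank `n`, where `𝕜` is `ℝ` or
`ℂ`. -/
abbrev Sections (𝕜 : Type*) [RCLike 𝕜] (m n : ℕ) {M : Type*} [TopologicalSpace M]
    [ChartedSpace (EuclideanSpace ℝ (Fin m)) M] (A : M → Type*)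
    [TopologicalSpace (TotalSpace (Fin n → 𝕜) A)] [∀ x, TopologicalSpace (A x)]
    [FiberBundle (Fin n → 𝕜) A] : Type _ :=
  Cₛ^∞⟮𝓡 m; Fin n → 𝕜, A⟯

variable {𝕜 : Type*} [RCLike 𝕜] {m n : ℕ} {M : Type*} [TopologicalSpace M]
  [ChartedSpace (EuclideanSpace ℝ (Fin m)) M]

instance : ContMDiffRing 𝓘(ℝ, 𝕜) ∞ 𝕜 :=
  { instNormedSpaceLieAddGroup with
    contMDiff_mul := by
      rw [contMDiff_iff]
      refine ⟨continuous_mul, fun x y => ?_⟩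
      simp only [mfld_simps, chartAt_self_eq]
      rw [contDiffOn_univ]
      exact contDiff_mul }

theorem add_fn_apply (f g : SmoothFn 𝕜 m M) (x : M) : (f + g) x = f x + g x := rfl

theorem mul_fn_apply (f g : SmoothFn 𝕜 m M) (x : M) : (f * g) x = f x * g x := rfl

/-- Evaluation at a point. -/
def evalAt (x : M) : SmoothFn 𝕜 m M →+* 𝕜 where
  toFun f := f x
  map_one' := rfl
  map_mul' _ _ := rfl
  map_zero' := rfl
  map_add' _ _ := rfl

theorem sum_fn_apply {ι : Type*} (t : Finset ι) (f : ι → SmoothFn 𝕜 m M) (x : M) :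
    (∑ i ∈ t, f i) x = ∑ i ∈ t, f i x := map_sum (evalAt x) f t

variable {A : M → Type*}
  [TopologicalSpace (TotalSpace (Fin n → 𝕜) A)] [∀ x, AddCommGroup (A x)]
  [∀ x, Module 𝕜 (A x)] [∀ x, TopologicalSpace (A x)] [FiberBundle (Fin n → 𝕜) A]
  [VectorBundle 𝕜 (Fin n → 𝕜) A]

theorem contMDiff_smul_section {f : M → 𝕜} {σ : ∀ x, A x}
    (hf : ContMDiff (𝓡 m) 𝓘(ℝ, 𝕜) ∞ f)
    (hσ : ContMDiff (𝓡 m) ((𝓡 m).prod 𝓘(ℝ, Fin n → 𝕜)) ∞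
      fun x => TotalSpace.mk' (Fin n → 𝕜) x (σ x)) :
    ContMDiff (𝓡 m) ((𝓡 m).prod 𝓘(ℝ, Fin n → 𝕜)) ∞
      fun x => TotalSpace.mk' (Fin n → 𝕜) x (f x • σ x) := by
  intro x₀
  have h1 := hf x₀
  have h2 := hσ x₀
  rw [contMDiffAt_section] at h2 ⊢
  have h3 : ContMDiffAt (𝓡 m) 𝓘(ℝ, Fin n → 𝕜) ∞ (fun x => f x •
      (trivializationAt (Fin n → 𝕜) A x₀ ⟨x, σ x⟩).2) x₀ := by
    have hs : ContDiff ℝ ∞ (fun q : 𝕜 × (Fin n → 𝕜) => q.1 • q.2) := contDiff_fst.smul contDiff_snd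
    exact hs.contMDiff.contMDiffAt.comp x₀ (h1.prodMk_space h2)
  refine h3.congr_of_eventuallyEq ?_
  filter_upwards [(trivializationAt (Fin n → 𝕜) A x₀).open_baseSet.mem_nhds
    (mem_baseSet_trivializationAt (Fin n → 𝕜) A x₀)] with x hx
  exact ((trivializationAt (Fin n → 𝕜) A x₀).linear 𝕜 hx).2 (f x) (σ x)

instance : SMul (SmoothFn 𝕜 m M) (Sections 𝕜 m n A) where
  smul f σ := ⟨fun x => f x • σ x, contMDiff_smul_section f.contMDiff σ.contMDiff⟩

@[simp] theorem smul_section_apply (f : SmoothFn 𝕜 m M) (σ : Sections 𝕜 m n A) (x : M) :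
    (f • σ) x = f x • σ x := rfl

variable [∀ x, Module ℝ (A x)] [∀ x, IsScalarTower ℝ 𝕜 (A x)] [VectorBundle ℝ (Fin n → 𝕜) A]

instance : Module (SmoothFn 𝕜 m M) (Sections 𝕜 m n A) where
  one_smul σ := by ext x; simp
  mul_smul f g σ := by ext x; simp [mul_smul]
  smul_zero f := by ext x; simp
  smul_add f σ τ := by ext x; simp
  add_smul f g σ := by ext x; simp [add_smul]
  zero_smul σ := by ext x; simp

theorem sum_section_apply {ι : Type*} (t : Finset ι) (σ : ι → Sections 𝕜 m n A) (x : M) :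
    (∑ i ∈ t, σ i) x = ∑ i ∈ t, σ i x := by
  classical
  induction t using Finset.induction_on with
  | empty => simp
  | insert a t ha ih => simp [Finset.sum_insert ha, ih]

/-- Around every point there are a frame and a dual frame that are cut off by a bump function. -/
theorem exists_local_frame [IsManifold (𝓡 m) ∞ M] [T2Space M]
    [ContMDiffVectorBundle ∞ (Fin n → 𝕜) A (𝓡 m)] (x₀ : M) :
    ∃ (σ : Fin n → Sections 𝕜 m n A)
      (lam : Fin n → Module.Dual (SmoothFn 𝕜 m M) (Sections 𝕜 m n A)) (χ : SmoothFn 𝕜 m M),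
      (∀ᶠ x in nhds x₀, χ x = 1) ∧ (∀ τ, ∑ i, lam i τ • σ i = χ • τ) ∧
      ∀ i τ τ' x, τ x = τ' x → lam i τ x = lam i τ' x := by
  set e := trivializationAt (Fin n → 𝕜) A x₀ with he
  have hx₀ : x₀ ∈ e.baseSet := mem_baseSet_trivializationAt (Fin n → 𝕜) A x₀
  obtain ⟨ψ, -, hψ⟩ := (SmoothBumpFunction.nhds_basis_tsupport (I := 𝓡 m) x₀).mem_iff.1
    (e.open_baseSet.mem_nhds hx₀)
  have hψ0 : ∀ x, x ∉ e.baseSet → ψ x = 0 := fun x hx =>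
    image_eq_zero_of_notMem_tsupport fun h => hx (hψ h)
  -- the cut-off frame
  have hσ : ∀ i : Fin n, ContMDiff (𝓡 m) ((𝓡 m).prod 𝓘(ℝ, Fin n → 𝕜)) ∞
      fun x => TotalSpace.mk' (Fin n → 𝕜) x (ψ x • e.symm x (Pi.single i 1)) := by
    intro i
    refine ContMDiffOn.smul_section_of_tsupport (u := e.baseSet)
      (s := fun x => e.symm x (Pi.single i 1)) ψ.contMDiff.contMDiffOn e.open_baseSet hψ ?_
    rw [e.contMDiffOn_section_baseSet_iff]
    refine (contMDiffOn_const (c := (Pi.single i 1 : Fin n → 𝕜))).congr fun y hy => ?_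
    rw [e.apply_mk_symm hy]
  -- the cut-off dual frame
  have hlam : ∀ (i : Fin n) (τ : Sections 𝕜 m n A), ContMDiff (𝓡 m) 𝓘(ℝ, 𝕜) ∞
      fun x => ψ x • (e ⟨x, τ x⟩).2 i := by
    intro i τ
    refine contMDiff_of_tsupport fun x hx => ?_
    have hx' : x ∈ e.baseSet := hψ (closure_mono (fun y hy => by
      intro h; apply hy; simp [h]) hx)
    have h1 := (e.contMDiffAt_section_iff hx').1 (τ.contMDiff x)
    have h2 : ContMDiffAt (𝓡 m) 𝓘(ℝ, 𝕜) ∞ (fun x => (e ⟨x, τ x⟩).2 i) x := by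
      rw [contMDiffAt_pi_space] at h1
      exact h1 i
    exact ContMDiffAt.smul ψ.contMDiffAt h2
  refine ⟨fun i => ⟨_, hσ i⟩, fun i =>
    { toFun := fun τ => ⟨_, hlam i τ⟩
      map_add' := fun τ τ' => ?_
      map_smul' := fun f τ => ?_ },
    ⟨fun x => ((ψ x * ψ x : ℝ) : 𝕜), ?_⟩, ?_, fun τ => ?_, fun i τ τ' x h => ?_⟩
  · ext x
    change ψ x • (e ⟨x, τ x + τ' x⟩).2 i = ψ x • (e ⟨x, τ x⟩).2 i + ψ x • (e ⟨x, τ' x⟩).2 i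
    by_cases hx : x ∈ e.baseSet
    · have := (e.linear 𝕜 hx).1 (τ x) (τ' x)
      simp [this]
    · simp [hψ0 x hx]
  · ext x
    change ψ x • (e ⟨x, f x • τ x⟩).2 i = f x * (ψ x • (e ⟨x, τ x⟩).2 i)
    by_cases hx : x ∈ e.baseSet
    · have := (e.linear 𝕜 hx).2 (f x) (τ x)
      simp [this]
    · simp [hψ0 x hx]
  · exact (RCLike.ofRealCLM (K := 𝕜)).contDiff.contMDiff.comp (ψ.contMDiff.mul ψ.contMDiff)
  · filter_upwards [ψ.eventuallyEq_one] with x hx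
    simp [hx]
  · ext x
    rw [sum_section_apply]
    by_cases hx : x ∈ e.baseSet
    · have h1 : ∑ i, (e ⟨x, τ x⟩).2 i • e.symm x (Pi.single i 1) = τ x := by
        have h2 : e.symm x (∑ i, (e ⟨x, τ x⟩).2 i • Pi.single i 1) = τ x := by
          have : ∑ i, (e ⟨x, τ x⟩).2 i • (Pi.single i 1 : Fin n → 𝕜) = (e ⟨x, τ x⟩).2 := by
            funext j
            simp [Finset.sum_apply, Pi.single_apply]
          rw [this, e.symm_apply_apply_mk hx]
        refine Eq.trans ?_ h2
        have h4 : ∀ v, e.symm x v = e.symmₗ 𝕜 x v := fun v => (congrFun (e.coe_symmₗ (R := 𝕜) hx) v).symm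
        simp only [h4, map_sum, map_smul]
      have h3 : ∀ i, ((ψ x • (e ⟨x, τ x⟩).2 i : 𝕜)) • (ψ x • e.symm x (Pi.single i 1)) =
          ((ψ x * ψ x : ℝ) : 𝕜) • ((e ⟨x, τ x⟩).2 i • e.symm x (Pi.single i 1)) := by
        intro i
        rw [← algebraMap_smul 𝕜 (ψ x) (e.symm x (Pi.single i 1)), smul_smul, smul_smul]
        congr 1
        rw [Algebra.smul_def]
        simp
        ring
      calc _ = ∑ i, ((ψ x • (e ⟨x, τ x⟩).2 i : 𝕜)) • (ψ x • e.symm x (Pi.single i 1)) := rfl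
        _ = ((ψ x * ψ x : ℝ) : 𝕜) • τ x := by
          rw [Finset.sum_congr rfl fun i _ => h3 i, ← Finset.smul_sum, h1]
        _ = _ := rfl
    · have h0 := hψ0 x hx
      calc _ = ∑ i, ((ψ x • (e ⟨x, τ x⟩).2 i : 𝕜)) • (ψ x • e.symm x (Pi.single i 1)) := rfl
        _ = ((ψ x * ψ x : ℝ) : 𝕜) • τ x := by simp [h0]
        _ = _ := rfl
  · change ψ x • (e ⟨x, τ x⟩).2 i = ψ x • (e ⟨x, τ' x⟩).2 i
    rw [h]

/-- The module of smooth sections of a vector bundle is reflexive. -/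
instance [IsManifold (𝓡 m) ∞ M] [T2Space M] [ContMDiffVectorBundle ∞ (Fin n → 𝕜) A (𝓡 m)] :
    Module.IsReflexive (SmoothFn 𝕜 m M) (Sections 𝕜 m n A) where
  bijective_dual_eval' := by
    choose σ lam χ hχ hfr hpt using exists_local_frame (𝕜 := 𝕜) (m := m) (n := n) (A := A)
    have hχ1 : ∀ x, χ x x = 1 := fun x => (hχ x).self_of_nhds
    -- a dual element, and the value of a section at a point, are determined by the frame
    have hdual : ∀ (x : M) (μ : Module.Dual (SmoothFn 𝕜 m M) (Sections 𝕜 m n A)),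
        ∑ i, μ (σ x i) • lam x i = χ x • μ := by
      intro x μ
      ext1 τ
      have := congrArg μ (hfr x τ)
      rw [map_sum] at this
      simp only [map_smul, smul_eq_mul] at this
      simp [LinearMap.sum_apply, ← this, mul_comm]
    have hsec : ∀ (x y : M) (τ : Sections 𝕜 m n A), χ x y = 1 →
        τ y = ∑ i, lam x i τ y • σ x i y := by
      intro x y τ hy
      have := congrArg (fun s => s y) (hfr x τ)
      simp only [sum_section_apply, smul_section_apply, hy, one_smul] at this
      exact this.symm
    have hinj : ∀ (y : M) (τ τ' : Sections 𝕜 m n A),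
        (∀ μ : Module.Dual (SmoothFn 𝕜 m M) (Sections 𝕜 m n A), μ τ y = μ τ' y) → τ y = τ' y := by
      intro y τ τ' h
      rw [hsec y y τ (hχ1 y), hsec y y τ' (hχ1 y)]
      simp [h]
    have hloc : ∀ (y : M) (τ τ' : Sections 𝕜 m n A) (μ : Module.Dual (SmoothFn 𝕜 m M)
        (Sections 𝕜 m n A)), τ y = τ' y → μ τ y = μ τ' y := by
      intro y τ τ' μ h
      have key : ∀ τ, μ τ y = ∑ i, μ (σ y i) y * lam y i τ y := by
        intro τ
        have := congrArg (fun g => g τ y) (hdual y μ)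
        simp only [LinearMap.sum_apply, LinearMap.smul_apply, smul_eq_mul, sum_fn_apply,
          mul_fn_apply, hχ1, one_mul] at this
        exact this.symm
      rw [key τ, key τ']
      exact Finset.sum_congr rfl fun i _ => by rw [hpt y i τ τ' y h]
    constructor
    · intro τ τ' h
      ext y
      refine hinj y τ τ' fun μ => ?_
      exact congrArg (fun g => g μ y) h
    · intro Φ
      -- the local candidates
      let Y : M → Sections 𝕜 m n A := fun x => ∑ i, Φ (lam x i) • σ x i
      have hY : ∀ (x y : M), χ x y = 1 → ∀ μ, μ (Y x) y = Φ μ y := by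
        intro x y hy μ
        have := congrArg (fun g => Φ g y) (hdual x μ)
        simp only [map_sum, map_smul, smul_eq_mul, sum_fn_apply, mul_fn_apply, hy, one_mul] at this
        rw [← this]
        simp only [Y, map_sum, map_smul, smul_eq_mul, sum_fn_apply, mul_fn_apply]
        exact Finset.sum_congr rfl fun i _ => mul_comm _ _
      have hYloc : ∀ x, ∀ᶠ y in nhds x, Y y y = Y x y := by
        intro x
        filter_upwards [hχ x] with y hy
        exact hinj y _ _ fun μ => by rw [hY y y (hχ1 y), hY x y hy]
      refine ⟨⟨fun y => Y y y, fun x => ?_⟩, ?_⟩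
      · refine ((Y x).contMDiff x).congr_of_eventuallyEq ?_
        filter_upwards [hYloc x] with y hy
        rw [hy]
      · ext μ y
        rw [Module.Dual.eval_apply, ← hY y y (hχ1 y)]
        exact hloc y _ _ μ rfl


variable (𝕜 m n A) in
/-- The smooth sections `Γ(A*)` of the dual bundle, as `C^∞(M)`-linear functionals on `Γ(A)`. -/
abbrev DualSections : Type _ := Module.Dual (SmoothFn 𝕜 m M) (Sections 𝕜 m n A)

variable (𝕜 m n A) in
/-- The pairing of `Γ(A)` with `Γ(A*)`. -/
abbrev pairing : Sections 𝕜 m n A →ₗ[SmoothFn 𝕜 m M] DualSections 𝕜 m n A →ₗ[SmoothFn 𝕜 m M]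
    SmoothFn 𝕜 m M :=
  Module.Dual.eval (SmoothFn 𝕜 m M) (Sections 𝕜 m n A)

variable (𝕜 m M) in
/-- The vector fields `Γ(TM)` (for `𝕜 = ℝ`) or `Γ(TM ⊗ ℂ)` (for `𝕜 = ℂ`), as derivations of the ring
of smooth functions. -/
abbrev VectorFields : Type _ := Derivation ℝ (SmoothFn 𝕜 m M) (SmoothFn 𝕜 m M)

/-- A form (with values in the functions on `M`) is nowhere vanishing if, at every point, it takes
a nonzero value on some tuple of sections. -/
def NowhereVanishing {N : Type*} [AddCommGroup N] [Module (SmoothFn 𝕜 m M) N] {k : ℕ}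
    (α : N [⋀^Fin k]→ₗ[SmoothFn 𝕜 m M] SmoothFn 𝕜 m M) : Prop :=
  ∀ x : M, ∃ X : Fin k → N, α X x ≠ 0

end Bundle

end LieBialgebroids

end

open LieBialgebroids

/-! Write `e(X)` for exterior multiplication by a section `X` of `A`, and put `Δ = d̆_* ∂̆ + ∂̆
d̆_*`. Comparing the modular equations for `X₀` and `ξ₀` shows that `div_s ρ(X) = div_Ω X + ⟨ξ₀, X⟩`
and `div_s ρ_*(ξ) = div_V ξ + ⟨X₀, ξ⟩` (`ModularIdentities.of_density`). Divergence is a cocycle on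
vector fields, so `ξ₀` and `X₀` are closed, both `d̆_*` and `∂̆` square to zero, and `Ð² = Δ`. The
content of the theorem is that `Δ`, which could have been a differential operator of second order,
has order zero and is scalar.

There are three steps. First, the commutator of `Δ` with a function `f` is `L_{df} + L_{d_*f}` plus
a scalar. In a Lie bialgebroid the two Lie derivatives cancel. The scalar vanishes because `ρ(d_*f)
+ ρ_*(df) = 0` has divergence zero and `div_Ω(d_*f) = div_V(df)`; this is where the factor one half
in the coefficients is needed (`laplacian_smul`, `ModularIdentities.twistedDiv_grad`). Secondly,
`W_X = [Δ, e(X)]` anticommutes with every `e(Y)`, which is the compatibility `d_*[X,Y] = L_X d_*Y -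
L_Y d_*X` in disguise (`laplacianCommutator_exterior`), so `W_X` is determined by `W_X(1)`. Thirdly,
`W_X(1) = 0`: in a local frame, twice its components are obtained by combining the trace of the
compatibility of the structure functions with the divergence of the commutator of the two anchors
(`LocalFrame.germ_laplacianCommutator_eq_zero`).

Thus `Δ` is linear over functions and commutes with all `e(Y)`, so it is multiplication by `φ = Δ(1)
= ∂̆(X₀/2) = ½(div_Ω X₀ + ½⟨ξ₀, X₀⟩)`. Hence `4φ = div_Ω X₀ + div_s ρ(X₀)`, the coefficient in
`L_{X₀}(Ω ⊗ s)`. The isomorphism `V^♯` carries `Ð_*²` to `Ð²` (`sharpTotal_square`), so the function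
is the same on the dual side, and evaluating `Ð_*²` on `1` gives the second formula.

Identities between operators on forms are proved by contraction: `Forms.eq_of_interior` reduces them
to degree zero and to commutation relations with contractions. Frames are only local, so they are
cut off to global sections and computations take place modulo functions vanishing near a point. -/

set_option linter.unusedSectionVars false

noncomputable section

namespace LieBialgebroids

/-! ### Contractions, exterior multiplication and the grading on forms. -/

section FormOperators

variable {R N : Type*} [CommRing R] [AddCommGroup N] [Module R N]

namespace Forms

/-- The contraction of forms with `x`, in the first argument. -/
def interior : N →ₗ[R] Forms R N →ₗ[R] Forms R N :=
  LinearMap.mk₂ R (fun x u k => (u (k + 1)).curryLeft x)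
    (fun x y u => by ext k v; simp)
    (fun c x u => by ext k v; simp)
    (fun x u v => by ext k w; simp)
    (fun c x u => by ext k w; simp)

theorem interior_apply (x : N) (u : Forms R N) (k : ℕ) (v : Fin k → N) :
    interior x u k v = u (k + 1) (Fin.cons x v) := rfl

/-- The exterior product of forms with a one-form, from the left. -/
def exterior : Module.Dual R N →ₗ[R] Forms R N →ₗ[R] Forms R N :=
  LinearMap.mk₂ R (fun θ u k => match k with
      | 0 => 0
      | k + 1 => AlternatingMap.alternatizeUncurryFin (θ.smulRight (u k)))
    (fun θ η u => by
      ext k v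
      cases k <;> simp [AlternatingMap.alternatizeUncurryFin_apply, Finset.sum_add_distrib,
        add_mul])
    (fun c θ u => by
      ext k v
      cases k <;> simp [AlternatingMap.alternatizeUncurryFin_apply, Finset.mul_sum]
      exact Finset.sum_congr rfl fun i _ => by ring)
    (fun θ u v => by
      ext k w
      cases k <;> simp [AlternatingMap.alternatizeUncurryFin_apply, Finset.sum_add_distrib])
    (fun c θ u => by
      ext k w
      cases k <;> simp [AlternatingMap.alternatizeUncurryFin_apply, Finset.mul_sum]
      exact Finset.sum_congr rfl fun i _ => by ring)

@[simp] theorem exterior_apply_zero (θ : Module.Dual R N) (u : Forms R N) :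
    exterior θ u 0 = 0 := rfl

theorem exterior_apply_succ (θ : Module.Dual R N) (u : Forms R N) (k : ℕ) (v : Fin (k + 1) → N) :
    exterior θ u (k + 1) v =
      ∑ i : Fin (k + 1), (-1) ^ (i : ℕ) * (θ (v i) * u k (i.removeNth v)) := by
  change AlternatingMap.alternatizeUncurryFin (θ.smulRight (u k)) v = _
  simp [AlternatingMap.alternatizeUncurryFin_apply]

/-- The parity operator, `(-1)^k` in degree `k`. -/
def parity : Forms R N →ₗ[R] Forms R N where
  toFun u k := (-1 : R) ^ k • u k
  map_add' u v := by ext k w; simp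
  map_smul' c u := by ext k w; simp; ring

theorem parity_apply (u : Forms R N) (k : ℕ) : parity u k = (-1 : R) ^ k • u k := rfl

/-- The degree operator, `k` in degree `k`. -/
def degree : Forms R N →ₗ[R] Forms R N where
  toFun u k := (k : R) • u k
  map_add' u v := by ext k w; simp
  map_smul' c u := by ext k w; simp; ring

theorem degree_apply (u : Forms R N) (k : ℕ) : degree u k = (k : R) • u k := rfl

@[simp] theorem parity_parity (u : Forms R N) : parity (parity u) = u := by
  ext k v
  simp [parity_apply, ← mul_assoc, ← mul_pow]

@[simp] theorem parity_apply_zero (u : Forms R N) : parity u 0 = u 0 := by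
  simp [parity_apply]

theorem cons_removeNth_succ {α : Type*} {k : ℕ} (x : α) (v : Fin (k + 1) → α) (i : Fin (k + 1)) :
    (i.succ).removeNth (Fin.cons x v : Fin (k + 2) → α) = Fin.cons x (i.removeNth v) := by
  funext j
  refine Fin.cases ?_ (fun j => ?_) j <;> simp [Fin.removeNth_apply]

theorem ext_of_interior {u v : Forms R N} (h0 : u 0 = v 0)
    (h : ∀ x, interior x u = interior x v) : u = v := by
  funext k
  cases k with
  | zero => exact h0
  | succ k =>
    ext w
    have := congrArg (fun z => z k (Fin.tail w)) (h (w 0))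
    simpa [interior_apply] using this

/-- Families of forms which agree in degree zero and whose differences are stable under
contractions agree. -/
theorem eq_of_interior {X : Type*} (T T' : X → Forms R N) (h0 : ∀ u, T u 0 = T' u 0)
    (h : ∀ x u, ∃ v, interior x (T u) - interior x (T' u) = T v - T' v) (u : X) : T u = T' u := by
  -- The induction is on the degree, for all arguments at once: in degree `k + 1` the difference is
  -- evaluated through its contraction, which is the difference for another argument `v` in degree
  -- `k`.
  have key : ∀ k u, T u k = T' u k := by
    intro k
    induction k with
    | zero => exact h0
    | succ k ih =>
      intro u
      ext w
      obtain ⟨v, hv⟩ := h (w 0) u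
      have := congrArg (fun z => z k (Fin.tail w)) hv
      simp [interior_apply, ih] at this
      exact sub_eq_zero.1 this
  funext k
  exact key k u

theorem interior_interior (x y : N) (u : Forms R N) :
    interior x (interior y u) = -interior y (interior x u) := by
  ext k v
  simp only [interior_apply, Pi.neg_apply, AlternatingMap.neg_apply]
  have : (Fin.cons y (Fin.cons x v : Fin (k + 1) → N) : Fin (k + 2) → N) =
      (Fin.cons x (Fin.cons y v : Fin (k + 1) → N) : Fin (k + 2) → N) ∘ Equiv.swap 0 1 := by
    funext j
    refine Fin.cases ?_ (fun j => ?_) j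
    · simp
    · refine Fin.cases ?_ (fun j => ?_) j
      · simp
      · simp [Equiv.swap_apply_of_ne_of_ne, Fin.ext_iff]
  rw [this, AlternatingMap.map_swap _ _ (by simp)]

/-- The term `i = 0` of the alternating sum gives `θ x • u`, and the shift of the index in the
others gives the minus sign. With the anticommutation of contractions among themselves and of
exterior products among themselves, these are the Clifford relations on which later computations
rest. -/
theorem interior_exterior (x : N) (θ : Module.Dual R N) (u : Forms R N) :
    interior x (exterior θ u) = θ x • u - exterior θ (interior x u) := by
  ext k v
  rw [interior_apply, exterior_apply_succ, Fin.sum_univ_succ]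
  cases k with
  | zero => simp
  | succ k =>
    simp only [Pi.sub_apply, AlternatingMap.sub_apply, exterior_apply_succ, interior_apply,
      Fin.cons_zero, Fin.cons_succ, cons_removeNth_succ, Fin.removeNth_zero, Fin.tail_cons]
    simp [sub_eq_add_neg, ← Finset.sum_neg_distrib, pow_succ]

theorem exterior_exterior (θ η : Module.Dual R N) (u : Forms R N) :
    exterior θ (exterior η u) = -exterior η (exterior θ u) := by
  refine eq_of_interior (fun u => exterior θ (exterior η u)) (fun u => -exterior η (exterior θ u))
    (fun u => by simp) (fun x u => ⟨interior x u, ?_⟩) u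
  simp only [interior_exterior, map_neg, map_sub, map_smul]
  abel

theorem interior_parity (x : N) (u : Forms R N) :
    interior x (parity u) = -parity (interior x u) := by
  ext k v
  simp [interior_apply, parity_apply, pow_succ]

theorem exterior_parity (θ : Module.Dual R N) (u : Forms R N) :
    exterior θ (parity u) = -parity (exterior θ u) := by
  ext k v
  cases k with
  | zero => simp
  | succ k =>
    simp only [exterior_apply_succ, parity_apply, Pi.neg_apply, AlternatingMap.neg_apply,
      AlternatingMap.smul_apply, smul_eq_mul, Finset.mul_sum, ← Finset.sum_neg_distrib]
    exact Finset.sum_congr rfl fun i _ => by ring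

theorem interior_degree (x : N) (u : Forms R N) :
    interior x (degree u) = degree (interior x u) + interior x u := by
  ext k v
  simp [interior_apply, degree_apply]
  ring

theorem ofFun_apply_zero (f : R) :
    (ofFun f : Forms R N) 0 = AlternatingMap.constOfIsEmpty R N (Fin 0) f :=
  by simp [ofFun, single]

@[simp] theorem ofFun_apply_zero_apply (f : R) (v : Fin 0 → N) : (ofFun f : Forms R N) 0 v = f := by
  simp [ofFun_apply_zero]

@[simp] theorem ofFun_apply_succ (f : R) (k : ℕ) : (ofFun f : Forms R N) (k + 1) = 0 := by
  simp [ofFun, single]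

theorem ofFun_smul (f g : R) : (f • ofFun g : Forms R N) = ofFun (f * g) := by
  ext k v
  cases k <;> simp

@[simp] theorem interior_ofFun (x : N) (f : R) : interior x (ofFun f : Forms R N) = 0 := by
  ext k v
  simp [interior_apply]

@[simp] theorem parity_ofFun (f : R) : parity (ofFun f : Forms R N) = ofFun f := by
  ext k v
  cases k <;> simp [parity_apply]

@[simp] theorem ofDual_apply_zero (θ : Module.Dual R N) : (ofDual θ : Forms R N) 0 = 0 := by
  simp [ofDual, single]

theorem interior_ofDual (x : N) (θ : Module.Dual R N) : interior x (ofDual θ) = ofFun (θ x) := by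
  ext k v
  rw [interior_apply]
  cases k with
  | zero => simp [ofDual, single]
  | succ k => simp [ofDual, single]

theorem exterior_ofFun (θ : Module.Dual R N) (f : R) : exterior θ (ofFun f) = ofDual (f • θ) := by
  refine ext_of_interior (by simp) fun x => ?_
  rw [interior_exterior, interior_ofDual]
  simp [ofFun_smul, mul_comm]

theorem ofFun_injective {f g : R} (h : (ofFun f : Forms R N) = ofFun g) : f = g := by
  have := congrArg (fun z => z 0 Fin.elim0) h
  simpa using this

theorem ofDual_injective {θ η : Module.Dual R N} (h : (ofDual θ : Forms R N) = ofDual η) :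
    θ = η := by
  ext x
  have := congrArg (interior x) h
  rw [interior_ofDual, interior_ofDual] at this
  exact ofFun_injective this

end Forms

end FormOperators

/-! ### Lie derivatives and Lie algebroid differentials on all forms. -/

section LieOperators

variable {R N : Type*} [CommRing R] [Algebra ℝ R] [AddCommGroup N] [Module R N]

open Forms

namespace DerivativeEndo

/-- The Lie derivative on the graded module of all forms. -/
def lieTotal (T : DerivativeEndo R N) : Forms R N →+ Forms R N where
  toFun u k := T.lie (u k)
  map_zero' := by ext k v; simp [lie_apply]
  map_add' u v := by
    ext k w
    simp [lie_apply, Finset.sum_add_distrib]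
    ring

theorem lieTotal_apply (T : DerivativeEndo R N) (u : Forms R N) (k : ℕ) :
    T.lieTotal u k = T.lie (u k) := rfl

theorem lieTotal_smul (T : DerivativeEndo R N) (f : R) (u : Forms R N) :
    T.lieTotal (f • u) = T.symbol f • u + f • T.lieTotal u := by
  ext k v
  simp [lieTotal_apply, lie_apply, mul_sub, Finset.mul_sum]
  ring

theorem lieTotal_ofFun (T : DerivativeEndo R N) (f : R) :
    T.lieTotal (ofFun f) = ofFun (T.symbol f) := by
  ext k v
  cases k with
  | zero => simp [lieTotal_apply, lie_apply]
  | succ k => simp [lieTotal_apply, lie_apply]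

theorem lieTotal_parity (T : DerivativeEndo R N) (u : Forms R N) :
    T.lieTotal (parity u) = parity (T.lieTotal u) := by
  ext k v
  rcases neg_one_pow_eq_or R k with h | h
  · simp [lieTotal_apply, lie_apply, parity_apply, h]
  · simp [lieTotal_apply, lie_apply, parity_apply, h]
    ring

theorem interior_lieTotal (T : DerivativeEndo R N) (x : N) (u : Forms R N) :
    interior x (T.lieTotal u) = T.lieTotal (interior x u) - interior (T.op x) u := by
  ext k v
  simp only [interior_apply, lieTotal_apply, lie_apply, Fin.sum_univ_succ, Pi.sub_apply,
    AlternatingMap.sub_apply, Fin.cons_zero, Fin.cons_succ, Fin.update_cons_zero,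
    ← Fin.cons_update]
  ring

/-- The operator on the dual module induced by `T`. -/
def transpose (T : DerivativeEndo R N) (θ : Module.Dual R N) : Module.Dual R N where
  toFun x := T.symbol (θ x) - θ (T.op x)
  map_add' x y := by simp; ring
  map_smul' f x := by simp [T.leibniz]; ring

theorem transpose_apply (T : DerivativeEndo R N) (θ : Module.Dual R N) (x : N) :
    T.transpose θ x = T.symbol (θ x) - θ (T.op x) := rfl

theorem lieTotal_exterior (T : DerivativeEndo R N) (θ : Module.Dual R N) (u : Forms R N) :
    T.lieTotal (exterior θ u) = exterior θ (T.lieTotal u) + exterior (T.transpose θ) u := by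
  refine eq_of_interior (fun u => T.lieTotal (exterior θ u))
    (fun u => exterior θ (T.lieTotal u) + exterior (T.transpose θ) u)
    (fun u => ?_) (fun x u => ⟨-interior x u, ?_⟩) u
  · ext v; simp [lieTotal_apply, lie_apply]
  · simp only [interior_lieTotal, interior_exterior, map_neg, map_sub, map_add, lieTotal_smul,
      transpose_apply]
    module

theorem lieTotal_ofDual (T : DerivativeEndo R N) (θ : Module.Dual R N) :
    T.lieTotal (ofDual θ) = ofDual (T.transpose θ) := by
  have h := T.lieTotal_exterior θ (ofFun 1)
  have h0 : (ofDual 0 : Forms R N) = 0 := by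
    rw [← zero_smul R (0 : Module.Dual R N), ← exterior_ofFun, map_zero, LinearMap.zero_apply]
  simpa [exterior_ofFun, lieTotal_ofFun, h0] using h

/-- The commutator is any `T''` with the right symbol and operator, so that the same statement
serves `ad` of a bracket, by the Jacobi identity, and commutators of vector fields. -/
theorem lieTotal_lieTotal (T T' T'' : DerivativeEndo R N)
    (hs : ∀ f, T''.symbol f = T.symbol (T'.symbol f) - T'.symbol (T.symbol f))
    (ho : ∀ x, T''.op x = T.op (T'.op x) - T'.op (T.op x)) (u : Forms R N) :
    T''.lieTotal u = T.lieTotal (T'.lieTotal u) - T'.lieTotal (T.lieTotal u) := by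
  refine eq_of_interior (fun u => T''.lieTotal u)
    (fun u => T.lieTotal (T'.lieTotal u) - T'.lieTotal (T.lieTotal u))
    (fun u => ?_) (fun x u => ⟨interior x u, ?_⟩) u
  · ext v; simp [lieTotal_apply, lie_apply, hs]
  · simp only [interior_lieTotal, map_sub, ho, LinearMap.sub_apply]
    abel

/-- The Lie derivative on forms depends additively on the operator. -/
theorem lieTotal_eq_neg (T T' : DerivativeEndo R N) (hs : T'.symbol = -T.symbol)
    (ho : ∀ x, T'.op x = -T.op x) (u : Forms R N) : T'.lieTotal u = -T.lieTotal u := by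
  ext k v
  simp [lieTotal_apply, lie_apply, hs, ho]
  ring

end DerivativeEndo

namespace LieAlgebroid

/-- After doubling, each pair `i < j` of the Koszul formula can be counted once from each of its
indices. The bracket terms then complete Lie derivatives, and no ordering of indices remains. -/
theorem diff_apply_eq (L : LieAlgebroid R N) (θ : Module.Dual R N) {k : ℕ}
    (α : N [⋀^Fin k]→ₗ[R] R) (X : Fin (k + 1) → N) :
    2 * L.diff θ α X = ∑ i : Fin (k + 1), (-1) ^ (i : ℕ) *
      ((L.ad (X i)).lie α (i.removeNth X) + L.anchor (X i) (α (i.removeNth X)) +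
        2 * (θ (X i) * α (i.removeNth X))) := by
  change 2 * L.koszul θ α X = _
  rw [koszul, mul_add, two_mul_koszulBracket, Finset.mul_sum, ← Finset.sum_neg_distrib,
    ← Finset.sum_add_distrib]
  refine Finset.sum_congr rfl fun i _ => ?_
  simp [DerivativeEndo.lie_apply, ad]
  ring

/-- The differential with coefficients, as an additive operator on all forms. -/
def totalDiffHom (L : LieAlgebroid R N) (θ : Module.Dual R N) : Forms R N →+ Forms R N where
  toFun := L.totalDiff θ
  map_zero' := by
    funext k
    cases k with
    | zero => rfl
    | succ k =>
      ext v
      apply eq_of_two_mul_eq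
      change 2 * L.diff θ 0 v = _
      rw [diff_apply_eq]
      simp [DerivativeEndo.lie_apply]
  map_add' u w := by
    funext k
    cases k with
    | zero => simp [totalDiff]
    | succ k =>
      ext v
      apply eq_of_two_mul_eq
      rw [Pi.add_apply, AlternatingMap.add_apply, mul_add]
      change 2 * L.diff θ (u k + w k) v = 2 * L.diff θ (u k) v + 2 * L.diff θ (w k) v
      rw [diff_apply_eq, diff_apply_eq, diff_apply_eq, ← Finset.sum_add_distrib]
      refine Finset.sum_congr rfl fun i _ => ?_
      simp [DerivativeEndo.lie_apply, Finset.sum_add_distrib]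
      ring

@[simp] theorem totalDiffHom_apply_zero (L : LieAlgebroid R N) (θ : Module.Dual R N)
    (u : Forms R N) : L.totalDiffHom θ u 0 = 0 := rfl

theorem totalDiffHom_apply_succ (L : LieAlgebroid R N) (θ : Module.Dual R N)
    (u : Forms R N) (k : ℕ) : L.totalDiffHom θ u (k + 1) = L.diff θ (u k) := rfl

/-- Cartan's formula for the differential with coefficients. -/
theorem interior_totalDiffHom (L : LieAlgebroid R N) (θ : Module.Dual R N) (x : N)
    (u : Forms R N) :
    interior x (L.totalDiffHom θ u) =
      (L.ad x).lieTotal u + θ x • u - L.totalDiffHom θ (interior x u) := by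
  ext k Y
  apply eq_of_two_mul_eq
  rw [interior_apply, totalDiffHom_apply_succ, diff_apply_eq, Fin.sum_univ_succ]
  cases k with
  | zero =>
    simp [DerivativeEndo.lieTotal_apply, DerivativeEndo.lie_apply, ad]
    have : Fin.tail (Fin.cons x Y : Fin 1 → N) = Y := Subsingleton.elim _ _
    ring
  | succ k =>
    have h1 : ∀ j : Fin (k + 1), (L.ad (Y j)).lie (u (k + 1)) (Fin.cons x (j.removeNth Y)) =
        (L.ad (Y j)).lie (interior x u k) (j.removeNth Y) +
          u (k + 1) (Fin.cons (L.bracket x (Y j)) (j.removeNth Y)) := by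
      intro j
      have := congrArg (fun z => z k (j.removeNth Y)) ((L.ad (Y j)).interior_lieTotal x u)
      have h2 : (L.ad (Y j)).op x = -L.bracket x (Y j) := L.bracket_skew _ _
      rw [h2] at this
      simpa [interior_apply, DerivativeEndo.lieTotal_apply] using this
    have h3 : ∀ j : Fin (k + 1), u (k + 1) (Function.update Y j (L.bracket x (Y j))) =
        (-1) ^ (j : ℕ) * u (k + 1) (Fin.cons (L.bracket x (Y j)) (j.removeNth Y)) := by
      intro j
      rw [← Fin.insertNth_removeNth, AlternatingMap.map_insertNth]
      simp [Matrix.vecCons]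
    -- The terms with brackets `[x, Y j]`, produced in `h1` by the summands of positive index, are
    -- the bracket part of `L_x u`. Together with the summand of index zero they make `2 L_x u`.
    have h4 : (L.ad x).lieTotal u (k + 1) Y = L.anchor x (u (k + 1) Y) -
        ∑ j : Fin (k + 1), (-1) ^ (j : ℕ) *
          u (k + 1) (Fin.cons (L.bracket x (Y j)) (j.removeNth Y)) := by
      rw [DerivativeEndo.lieTotal_apply, DerivativeEndo.lie_apply]
      congr 1
      exact Finset.sum_congr rfl fun j _ => h3 j
    have h5 : 2 * L.totalDiffHom θ (interior x u) (k + 1) Y = _ :=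
      L.diff_apply_eq θ (interior x u k) Y
    have h6 : (L.ad x).lie (u (k + 1)) Y = (L.ad x).lieTotal u (k + 1) Y := rfl
    simp only [Fin.cons_zero, Fin.cons_succ, cons_removeNth_succ, Fin.removeNth_zero,
      Fin.tail_cons, h1, Pi.sub_apply, Pi.add_apply, Pi.smul_apply, AlternatingMap.sub_apply,
      AlternatingMap.add_apply, AlternatingMap.smul_apply, smul_eq_mul, mul_sub, mul_add, h5, h6,
      h4, Fin.val_zero, Fin.val_succ, pow_succ, pow_zero, one_mul, interior_apply,
      Finset.sum_add_distrib, mul_neg, neg_mul, mul_one, Finset.sum_neg_distrib]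
    ring

theorem lieTotal_ad_bracket (L : LieAlgebroid R N) (x y : N) (u : Forms R N) :
    (L.ad (L.bracket x y)).lieTotal u =
      (L.ad x).lieTotal ((L.ad y).lieTotal u) - (L.ad y).lieTotal ((L.ad x).lieTotal u) := by
  refine DerivativeEndo.lieTotal_lieTotal _ _ _ (fun f => ?_) (fun z => ?_) u
  · simp [ad, L.anchor_bracket, Derivation.commutator_apply]
  · simp only [ad, L.jacobi x y z]
    abel

/-- A one-form `θ` is closed if `X ↦ ρ(X) + θ(X)` is a representation. -/
def IsClosed (L : LieAlgebroid R N) (θ : Module.Dual R N) : Prop :=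
  ∀ x y, θ (L.bracket x y) = L.anchor x (θ y) - L.anchor y (θ x)

variable {L : LieAlgebroid R N} {θ : Module.Dual R N}

/-- Contraction with `y` and Cartan's formula leave `L_{[x,y]} = [L_x, L_y]` and the same relation
for the connection terms, which is closedness of `θ`. One more contraction then yields that the
differential squares to zero. -/
theorem totalDiffHom_ad (hθ : L.IsClosed θ) (x : N) (u : Forms R N) :
    L.totalDiffHom θ ((L.ad x).lieTotal u + θ x • u) =
      (L.ad x).lieTotal (L.totalDiffHom θ u) + θ x • L.totalDiffHom θ u := by
  refine eq_of_interior (fun u => L.totalDiffHom θ ((L.ad x).lieTotal u + θ x • u))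
    (fun u => (L.ad x).lieTotal (L.totalDiffHom θ u) + θ x • L.totalDiffHom θ u)
    (fun u => ?_) (fun y u => ⟨-interior y u, ?_⟩) u
  · ext v; simp [DerivativeEndo.lieTotal_apply, DerivativeEndo.lie_apply]
  · have h1 := L.lieTotal_ad_bracket x y u
    have h2 : (L.ad x).op y = L.bracket x y := rfl
    have h3 : (L.ad x).symbol = L.anchor x := rfl
    have h4 : (L.ad y).symbol = L.anchor y := rfl
    have h5 := hθ x y
    simp only [interior_totalDiffHom, DerivativeEndo.interior_lieTotal, map_add, map_sub, map_neg,
      map_smul, DerivativeEndo.lieTotal_smul, h1, h2, h3, h4, h5, smul_add, smul_sub, smul_neg]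
    module

theorem totalDiffHom_totalDiffHom (hθ : L.IsClosed θ) (u : Forms R N) :
    L.totalDiffHom θ (L.totalDiffHom θ u) = 0 := by
  refine eq_of_interior (fun u => L.totalDiffHom θ (L.totalDiffHom θ u)) (fun _ => 0)
    (fun u => by simp) (fun y u => ⟨interior y u, ?_⟩) u
  simp only [interior_totalDiffHom, map_sub, totalDiffHom_ad hθ, map_zero]
  abel

/-- The differential of a function. -/
def differential (L : LieAlgebroid R N) (f : R) : Module.Dual R N where
  toFun x := L.anchor x f
  map_add' x y := by simp
  map_smul' c x := by simp

@[simp] theorem differential_apply (L : LieAlgebroid R N) (f : R) (x : N) :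
    L.differential f x = L.anchor x f := rfl

theorem totalDiffHom_smul (L : LieAlgebroid R N) (θ : Module.Dual R N) (f : R) (u : Forms R N) :
    L.totalDiffHom θ (f • u) = f • L.totalDiffHom θ u + exterior (L.differential f) u := by
  refine eq_of_interior (fun u => L.totalDiffHom θ (f • u))
    (fun u => f • L.totalDiffHom θ u + exterior (L.differential f) u)
    (fun u => by simp) (fun y u => ⟨-interior y u, ?_⟩) u
  simp only [interior_totalDiffHom, map_add, map_smul, smul_neg, map_neg, interior_exterior,
    DerivativeEndo.lieTotal_smul, differential_apply]
  have h4 : (L.ad y).symbol = L.anchor y := rfl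
  rw [h4]
  module

theorem totalDiffHom_ofFun (L : LieAlgebroid R N) (θ : Module.Dual R N) (f : R) :
    L.totalDiffHom θ (ofFun f) = ofDual (L.differential f + f • θ) := by
  refine ext_of_interior (by simp) fun x => ?_
  rw [interior_totalDiffHom, interior_ofFun, interior_ofDual, DerivativeEndo.lieTotal_ofFun,
    ofFun_smul, map_zero, sub_zero]
  ext k v
  cases k <;> simp [ad, mul_comm]

theorem totalDiffHom_eq (L : LieAlgebroid R N) (θ : Module.Dual R N) (u : Forms R N) :
    L.totalDiffHom θ u = L.totalDiffHom 0 u + exterior θ u := by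
  refine eq_of_interior (fun u => L.totalDiffHom θ u)
    (fun u => L.totalDiffHom 0 u + exterior θ u)
    (fun u => by simp) (fun y u => ⟨-interior y u, ?_⟩) u
  simp only [interior_totalDiffHom, map_add, map_neg, interior_exterior, LinearMap.zero_apply,
    zero_smul]
  abel

theorem totalDiffHom_parity (L : LieAlgebroid R N) (θ : Module.Dual R N) (u : Forms R N) :
    L.totalDiffHom θ (parity u) = -parity (L.totalDiffHom θ u) := by
  refine eq_of_interior (fun u => L.totalDiffHom θ (parity u))
    (fun u => -parity (L.totalDiffHom θ u))
    (fun u => by simp) (fun y u => ⟨interior y u, ?_⟩) u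
  simp only [interior_totalDiffHom, interior_parity, map_add, map_neg, map_sub, map_smul,
    DerivativeEndo.lieTotal_parity]
  abel

end LieAlgebroid

end LieOperators

/-! ### The wedge product and its behaviour under contraction. -/

section Wedge

variable {R N : Type*} [CommRing R] [Algebra ℝ R] [AddCommGroup N] [Module R N]

open Forms

/-- The inclusion of the first `k` of `n = k + l` indices. -/
def finLeft {k l n : ℕ} (h : k + l = n) (i : Fin k) : Fin n := finCongr h (Fin.castAdd l i)

/-- The inclusion of the last `l` of `n = k + l` indices. -/
def finRight {k l n : ℕ} (h : k + l = n) (i : Fin l) : Fin n := finCongr h (Fin.natAdd k i)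

@[simp] theorem finLeft_val {k l n : ℕ} (h : k + l = n) (i : Fin k) :
    (finLeft h i : ℕ) = i := by simp [finLeft]

@[simp] theorem finRight_val {k l n : ℕ} (h : k + l = n) (i : Fin l) :
    (finRight h i : ℕ) = k + i := by simp [finRight]

theorem sum_fin_split {M : Type*} [AddCommMonoid M] {k l n : ℕ} (h : k + l = n) (g : Fin n → M) :
    ∑ i, g i = ∑ a : Fin k, g (finLeft h a) + ∑ b : Fin l, g (finRight h b) := by
  subst h
  rw [Fin.sum_univ_add]
  rfl

theorem insertNth_finLeft_comp_finLeft {k l n : ℕ} (h : k + 1 + l = n + 1) (h' : k + l = n)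
    (a : Fin (k + 1)) (x : N) (Z : Fin n → N) :
    (fun j => (finLeft h a).insertNth (α := fun _ => N) x Z (finLeft h j)) =
      a.insertNth (α := fun _ => N) x (fun j => Z (finLeft h' j)) := by
  funext j
  rcases Fin.eq_self_or_eq_succAbove a j with rfl | ⟨j, rfl⟩
  · simp
  · have : finLeft h (a.succAbove j) = (finLeft h a).succAbove (finLeft h' j) := by
      ext
      simp [Fin.succAbove, Fin.lt_def]
      split_ifs <;> simp
    rw [this]
    simp

theorem insertNth_finLeft_comp_finRight {k l n : ℕ} (h : k + 1 + l = n + 1) (h' : k + l = n)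
    (a : Fin (k + 1)) (x : N) (Z : Fin n → N) :
    (fun j => (finLeft h a).insertNth (α := fun _ => N) x Z (finRight h j)) =
      (fun j => Z (finRight h' j)) := by
  funext j
  have : finRight h j = (finLeft h a).succAbove (finRight h' j) := by
    ext
    have := a.2
    simp [Fin.succAbove, Fin.lt_def]
    split_ifs <;> simp <;> omega
  rw [this]
  simp

theorem insertNth_finRight_comp_finLeft {k l n : ℕ} (h : k + (l + 1) = n + 1) (h' : k + l = n)
    (b : Fin (l + 1)) (x : N) (Z : Fin n → N) :
    (fun j => (finRight h b).insertNth (α := fun _ => N) x Z (finLeft h j)) =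
      (fun j => Z (finLeft h' j)) := by
  funext j
  have : finLeft h j = (finRight h b).succAbove (finLeft h' j) := by
    ext
    have := j.2
    simp [Fin.succAbove, Fin.lt_def]
    split_ifs <;> simp <;> omega
  rw [this]
  simp

theorem insertNth_finRight_comp_finRight {k l n : ℕ} (h : k + (l + 1) = n + 1) (h' : k + l = n)
    (b : Fin (l + 1)) (x : N) (Z : Fin n → N) :
    (fun j => (finRight h b).insertNth (α := fun _ => N) x Z (finRight h j)) =
      b.insertNth (α := fun _ => N) x (fun j => Z (finRight h' j)) := by
  funext j
  rcases Fin.eq_self_or_eq_succAbove b j with rfl | ⟨j, rfl⟩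
  · simp
  · have : finRight h (b.succAbove j) = (finRight h b).succAbove (finRight h' j) := by
      ext
      simp [Fin.succAbove, Fin.lt_def]
      split_ifs <;> simp <;> omega
    rw [this]
    simp

/-- A permutation amounts to the position `i` that it sends to `0`, where `x` is inserted, and a
permutation `e` of the remaining entries. The cycle that brings position `i` to the front has sign
`(-1)^i`. -/
theorem sum_perm_cons {n : ℕ} (m : (Fin (n + 1) → N) → R) (x : N) (Y : Fin n → N) :
    ∑ σ : Equiv.Perm (Fin (n + 1)), Equiv.Perm.sign σ • m ((Fin.cons x Y : Fin (n + 1) → N) ∘ σ) =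
      ∑ i : Fin (n + 1), (-1 : R) ^ (i : ℕ) * ∑ e : Equiv.Perm (Fin n),
        Equiv.Perm.sign e • m (i.insertNth x (Y ∘ e)) := by
  let g : Fin (n + 1) × Equiv.Perm (Fin n) → Equiv.Perm (Fin (n + 1)) := fun q =>
    Equiv.Perm.decomposeFin.symm (0, q.2) * q.1.cycleRange
  have hg : Function.Bijective g := by
    rw [Fintype.bijective_iff_injective_and_card]
    constructor
    · rintro ⟨i, e⟩ ⟨i', e'⟩ h
      have h0 : ∀ q : Fin (n + 1) × Equiv.Perm (Fin n), (g q).symm 0 = q.1 := by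
        intro q
        rw [Equiv.symm_apply_eq]
        simp [g]
      have hi : i = i' := by
        have := h0 (i, e)
        rw [h, h0 (i', e')] at this
        exact this.symm
      subst hi
      have he := mul_right_cancel h
      have := Equiv.Perm.decomposeFin.symm.injective he
      simp at this
      rw [this]
    · simp [Fintype.card_perm, Nat.factorial_succ]
  rw [← Fintype.sum_bijective g hg _ _ (fun q => rfl), Fintype.sum_prod_type]
  refine Finset.sum_congr rfl fun i _ => ?_
  rw [Finset.mul_sum]
  refine Finset.sum_congr rfl fun e _ => ?_
  have h1 : (Fin.cons x Y : Fin (n + 1) → N) ∘ (g (i, e)) = i.insertNth x (Y ∘ e) := by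
    rw [← Fin.cons_comp_cycleRange]
    funext j
    simp only [g, Function.comp_apply, Equiv.Perm.mul_apply]
    generalize i.cycleRange j = t
    refine Fin.cases ?_ (fun t => ?_) t
    · simp
    · simp
  rw [h1]
  simp only [g, map_mul, Fin.sign_cycleRange, Equiv.Perm.decomposeFin.symm_sign, if_true, one_mul]
  rcases neg_one_pow_eq_or ℤˣ (i : ℕ) with h | h
  · have h' : (-1 : R) ^ (i : ℕ) = 1 := by
      have := congrArg (fun z : ℤˣ => ((z : ℤ) : R)) h
      simpa using this
    rw [h, h']; simp
  · have h' : (-1 : R) ^ (i : ℕ) = -1 := by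
      have := congrArg (fun z : ℤˣ => ((z : ℤ) : R)) h
      simpa using this
    rw [h, h']; simp

/-- Each shuffle is a class of `k! l!` permutations with equal contributions. Summing over all
permutations replaces the quotient by a sum that can be split by the position of an argument; the
factorials are cancelled afterwards over `ℝ`. -/
theorem factorial_mul_wedge {k l n : ℕ} (h : k + l = n) (α : N [⋀^Fin k]→ₗ[R] R)
    (β : N [⋀^Fin l]→ₗ[R] R) (Y : Fin n → N) :
    ((k.factorial * l.factorial : ℕ) : R) * wedge h α β Y =
      ∑ σ : Equiv.Perm (Fin n), Equiv.Perm.sign σ •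
        (α (fun i => (Y ∘ σ) (finLeft h i)) * β (fun i => (Y ∘ σ) (finRight h i))) := by
  subst h
  have h1 := congrArg (fun z => LinearMap.mul' R R (z (fun i => Y (finSumFinEquiv i))))
    (MultilinearMap.domCoprod_alternization_eq α β)
  simp only [MultilinearMap.alternatization_apply, AlternatingMap.smul_apply, map_sum,
    Fintype.card_fin] at h1
  rw [map_nsmul] at h1
  have h2 : wedge rfl α β Y = LinearMap.mul' R R (α.domCoprod β (fun i => Y (finSumFinEquiv i))) :=
    rfl
  rw [h2, ← nsmul_eq_mul, ← h1]
  rw [← Equiv.sum_comp (finSumFinEquiv (m := k) (n := l)).permCongr]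
  refine Finset.sum_congr rfl fun σ _ => ?_
  rw [Equiv.Perm.sign_permCongr, Units.smul_def, Units.smul_def, map_zsmul]
  congr 1
  simp [MultilinearMap.domDomCongr_apply, finLeft, finRight,
    Equiv.permCongr_apply]

theorem nat_mul_cancel {c : ℕ} (hc : c ≠ 0) {a b : R} (h : (c : R) * a = c * b) : a = b := by
  have h2 : algebraMap ℝ R (1 / c) * (c : R) = 1 := by
    rw [← map_natCast (algebraMap ℝ R) c, ← map_mul]
    have : (1 / (c : ℝ)) * c = 1 := by field_simp
    rw [this, map_one]
  calc a = algebraMap ℝ R (1 / c) * (c : R) * a := by rw [h2, one_mul]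
    _ = algebraMap ℝ R (1 / c) * (c : R) * b := by rw [mul_assoc, h, mul_assoc]
    _ = b := by rw [h2, one_mul]

/-- Moving `x` to the first slot of `α` costs `(-1)^a`, which cancels the sign of its position. In
the right block the position has sign `(-1)^(k+b)` and only `(-1)^b` cancels, whence the factor
`(-1)^k` of the next statement. -/
theorem sum_perm_finLeft {k l n : ℕ} (h : k + 1 + l = n + 1) (h' : k + l = n)
    (α : N [⋀^Fin (k + 1)]→ₗ[R] R) (β : N [⋀^Fin l]→ₗ[R] R) (x : N) (Y : Fin n → N)
    (a : Fin (k + 1)) :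
    (-1 : R) ^ (finLeft h a : ℕ) * ∑ e : Equiv.Perm (Fin n), Equiv.Perm.sign e •
        (α (fun i => (finLeft h a).insertNth (α := fun _ => N) x (Y ∘ e) (finLeft h i)) *
          β (fun i => (finLeft h a).insertNth (α := fun _ => N) x (Y ∘ e) (finRight h i))) =
      ((k.factorial * l.factorial : ℕ) : R) * wedge h' (α.curryLeft x) β Y := by
  rw [factorial_mul_wedge, Finset.mul_sum]
  refine Finset.sum_congr rfl fun e _ => ?_
  rw [insertNth_finLeft_comp_finLeft h h', insertNth_finLeft_comp_finRight h h',
    AlternatingMap.map_insertNth, finLeft_val]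
  have : (-1 : R) ^ (a : ℕ) * (-1 : R) ^ (a : ℕ) = 1 := by rw [← mul_pow]; simp
  simp only [AlternatingMap.curryLeft_apply_apply, zsmul_eq_mul, Int.cast_pow, Int.cast_neg,
    Int.cast_one, Units.smul_def]
  linear_combination ((Equiv.Perm.sign e : ℤ) : R) *
    (α (Matrix.vecCons x fun i => (Y ∘ e) (finLeft h' i)) *
    β fun i => (Y ∘ e) (finRight h' i)) * this

theorem sum_perm_finRight {k l n : ℕ} (h : k + (l + 1) = n + 1) (h' : k + l = n)
    (α : N [⋀^Fin k]→ₗ[R] R) (β : N [⋀^Fin (l + 1)]→ₗ[R] R) (x : N) (Y : Fin n → N)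
    (b : Fin (l + 1)) :
    (-1 : R) ^ (finRight h b : ℕ) * ∑ e : Equiv.Perm (Fin n), Equiv.Perm.sign e •
        (α (fun i => (finRight h b).insertNth (α := fun _ => N) x (Y ∘ e) (finLeft h i)) *
          β (fun i => (finRight h b).insertNth (α := fun _ => N) x (Y ∘ e) (finRight h i))) =
      (-1) ^ k * (((k.factorial * l.factorial : ℕ) : R) * wedge h' α (β.curryLeft x) Y) := by
  rw [factorial_mul_wedge, Finset.mul_sum, Finset.mul_sum]
  refine Finset.sum_congr rfl fun e _ => ?_
  rw [insertNth_finRight_comp_finLeft h h', insertNth_finRight_comp_finRight h h',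
    AlternatingMap.map_insertNth, finRight_val]
  have : (-1 : R) ^ (b : ℕ) * (-1 : R) ^ (b : ℕ) = 1 := by rw [← mul_pow]; simp
  simp only [AlternatingMap.curryLeft_apply_apply, zsmul_eq_mul, Int.cast_pow, Int.cast_neg,
    Int.cast_one, pow_add, Units.smul_def]
  linear_combination ((Equiv.Perm.sign e : ℤ) : R) *
    ((-1) ^ k * α (fun i => (Y ∘ e) (finLeft h' i)) *
    β (Matrix.vecCons x fun i => (Y ∘ e) (finRight h' i))) * this

theorem factorial_mul_wedge_cons {k l n : ℕ} (h : k + l = n + 1)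
    (α : N [⋀^Fin k]→ₗ[R] R) (β : N [⋀^Fin l]→ₗ[R] R) (x : N) (Y : Fin n → N) :
    ((k.factorial * l.factorial : ℕ) : R) * wedge h α β (Fin.cons x Y) =
      (∑ a : Fin k, (-1 : R) ^ (finLeft h a : ℕ) * ∑ e : Equiv.Perm (Fin n), Equiv.Perm.sign e •
        (α (fun i => (finLeft h a).insertNth (α := fun _ => N) x (Y ∘ e) (finLeft h i)) *
          β (fun i => (finLeft h a).insertNth (α := fun _ => N) x (Y ∘ e) (finRight h i)))) +
      ∑ b : Fin l, (-1 : R) ^ (finRight h b : ℕ) * ∑ e : Equiv.Perm (Fin n), Equiv.Perm.sign e •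
        (α (fun i => (finRight h b).insertNth (α := fun _ => N) x (Y ∘ e) (finLeft h i)) *
          β (fun i => (finRight h b).insertNth (α := fun _ => N) x (Y ∘ e) (finRight h i))) := by
  rw [factorial_mul_wedge, sum_perm_cons (fun Z => α (fun i => Z (finLeft h i)) *
    β (fun i => Z (finRight h i))), sum_fin_split h]

/-- The contraction is an antiderivation of the wedge product. -/
theorem wedge_cons {k l n : ℕ} (h : k + 1 + (l + 1) = n + 1) (h₁ : k + (l + 1) = n)
    (h₂ : k + 1 + l = n) (α : N [⋀^Fin (k + 1)]→ₗ[R] R) (β : N [⋀^Fin (l + 1)]→ₗ[R] R) (x : N)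
    (Y : Fin n → N) :
    wedge h α β (Fin.cons x Y) = wedge h₁ (α.curryLeft x) β Y +
      (-1) ^ (k + 1) * wedge h₂ α (β.curryLeft x) Y := by
  apply nat_mul_cancel (c := (k + 1).factorial * (l + 1).factorial)
    (mul_ne_zero (Nat.factorial_ne_zero _) (Nat.factorial_ne_zero _))
  rw [factorial_mul_wedge_cons]
  -- All `k + 1` positions on the left contribute equally, as do all `l + 1` on the right. These
  -- multiplicities complete the factorials of the contracted products.
  simp only [sum_perm_finLeft h h₁, sum_perm_finRight h h₂, Finset.sum_const, Finset.card_univ,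
    Fintype.card_fin, nsmul_eq_mul, Nat.factorial_succ]
  push_cast
  ring

theorem wedge_cons_zero_right {k n : ℕ} (h : k + 1 + 0 = n + 1) (h₁ : k + 0 = n)
    (α : N [⋀^Fin (k + 1)]→ₗ[R] R) (β : N [⋀^Fin 0]→ₗ[R] R) (x : N) (Y : Fin n → N) :
    wedge h α β (Fin.cons x Y) = wedge h₁ (α.curryLeft x) β Y := by
  apply nat_mul_cancel (c := (k + 1).factorial * (0).factorial)
    (mul_ne_zero (Nat.factorial_ne_zero _) (Nat.factorial_ne_zero _))
  rw [factorial_mul_wedge_cons]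
  simp only [sum_perm_finLeft h h₁, Finset.sum_const, Finset.card_univ,
    Fintype.card_fin, nsmul_eq_mul, Nat.factorial_succ, Finset.univ_eq_empty, Finset.sum_empty]
  push_cast
  ring

theorem wedge_cons_zero_left {l n : ℕ} (h : 0 + (l + 1) = n + 1) (h₁ : 0 + l = n)
    (α : N [⋀^Fin 0]→ₗ[R] R) (β : N [⋀^Fin (l + 1)]→ₗ[R] R) (x : N) (Y : Fin n → N) :
    wedge h α β (Fin.cons x Y) = wedge h₁ α (β.curryLeft x) Y := by
  apply nat_mul_cancel (c := (0).factorial * (l + 1).factorial)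
    (mul_ne_zero (Nat.factorial_ne_zero _) (Nat.factorial_ne_zero _))
  rw [factorial_mul_wedge_cons]
  simp only [sum_perm_finRight h h₁, Finset.sum_const, Finset.card_univ,
    Fintype.card_fin, nsmul_eq_mul, Nat.factorial_succ, Finset.univ_eq_empty, Finset.sum_empty]
  push_cast
  ring

theorem wedge_zero_zero (h : 0 + 0 = 0) (α β : N [⋀^Fin 0]→ₗ[R] R) (Y : Fin 0 → N) :
    wedge h α β Y = α Y * β Y := by
  have := factorial_mul_wedge h α β Y
  simp at this
  rw [this]
  exact congrArg₂ (· * ·) (congrArg α (Subsingleton.elim _ _)) (congrArg β (Subsingleton.elim _ _))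

namespace Forms

theorem mul_apply_apply (u v : Forms R N) (n : ℕ) (Y : Fin n → N) :
    mul u v n Y = ∑ q ∈ Finset.HasAntidiagonal.antidiagonal n,
      if h : q.1 + q.2 = n then wedge h (u q.1) (v q.2) Y else 0 := by
  have hs : ∀ {ι : Type} (t : Finset ι) (g : ι → N [⋀^Fin n]→ₗ[R] R),
      (∑ i ∈ t, g i) Y = ∑ i ∈ t, g i Y := fun t g =>
    map_sum ({ toFun := fun z => z Y, map_zero' := rfl, map_add' := fun _ _ => rfl } :
      (N [⋀^Fin n]→ₗ[R] R) →+ R) g t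
  rw [mul, hs, ← Finset.sum_coe_sort (Finset.HasAntidiagonal.antidiagonal n)]
  refine Finset.sum_congr rfl fun q _ => ?_
  rw [dif_pos (Finset.HasAntidiagonal.mem_antidiagonal.1 q.2)]

theorem mul_apply_zero (u v : Forms R N) (Y : Fin 0 → N) : mul u v 0 Y = u 0 Y * v 0 Y := by
  rw [mul_apply_apply]
  simp [wedge_zero_zero]

theorem interior_mul (x : N) (u v : Forms R N) :
    interior x (mul u v) = mul (interior x u) v + mul (parity u) (interior x v) := by
  ext n Y
  rw [interior_apply, mul_apply_apply, Pi.add_apply, AlternatingMap.add_apply, mul_apply_apply,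
    mul_apply_apply]
  -- `A` and `B` are the contributions in which the left or the right factor is contracted, set to
  -- zero where that factor has degree zero. This boundary value lets each sum over the antidiagonal
  -- of `n + 1` drop to the antidiagonal of `n`.
  let A : ℕ × ℕ → R := fun q => match q with
    | (0, _) => 0
    | (i + 1, j) => if h : i + j = n then wedge h (interior x u i) (v j) Y else 0
  let B : ℕ × ℕ → R := fun q => match q with
    | (_, 0) => 0
    | (i, j + 1) => if h : i + j = n then wedge h (parity u i) (interior x v j) Y else 0
  have hp : ∀ (i j : ℕ) (h : i + j = n) (β : N [⋀^Fin j]→ₗ[R] R),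
      wedge h (parity u i) β Y = (-1) ^ i * wedge h (u i) β Y := by
    intro i j h β
    apply nat_mul_cancel (c := i.factorial * j.factorial)
      (mul_ne_zero (Nat.factorial_ne_zero _) (Nat.factorial_ne_zero _))
    rw [mul_left_comm, factorial_mul_wedge, factorial_mul_wedge, Finset.mul_sum]
    refine Finset.sum_congr rfl fun σ _ => ?_
    rw [parity_apply, AlternatingMap.smul_apply, mul_smul_comm, smul_eq_mul, mul_assoc]
  have hq : ∀ q ∈ Finset.HasAntidiagonal.antidiagonal (n + 1),
      (if h : q.1 + q.2 = n + 1 then wedge h (u q.1) (v q.2) (Fin.cons x Y) else 0) =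
        A q + B q := by
    rintro ⟨i, j⟩ hq
    have h : i + j = n + 1 := Finset.HasAntidiagonal.mem_antidiagonal.1 hq
    simp only
    rw [dif_pos h]
    rcases i with _ | i <;> rcases j with _ | j
    · omega
    · simp only [A, B]
      have h' : 0 + j = n := by omega
      have e1 : wedge h (u 0) (v (j + 1)) (Fin.cons x Y) = wedge h' (u 0) (interior x v j) Y :=
        wedge_cons_zero_left h h' _ _ x Y
      have e2 := hp 0 j h' (interior x v j)
      rw [dif_pos h']
      linear_combination e1 - e2
    · simp only [A, B]
      have h' : i + 0 = n := by omega
      have e1 : wedge h (u (i + 1)) (v 0) (Fin.cons x Y) = wedge h' (interior x u i) (v 0) Y :=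
        wedge_cons_zero_right h h' _ _ x Y
      rw [dif_pos h']
      linear_combination e1
    · simp only [A, B]
      rw [dif_pos (by omega), dif_pos (by omega), wedge_cons h (by omega) (by omega), hp]
      rfl
  rw [Finset.sum_congr rfl hq, Finset.sum_add_distrib, Finset.Nat.sum_antidiagonal_succ,
    Finset.Nat.sum_antidiagonal_succ' (f := B)]
  simp [A, B]

theorem wedge_add_left {k l n : ℕ} (h : k + l = n) (α α' : N [⋀^Fin k]→ₗ[R] R)
    (β : N [⋀^Fin l]→ₗ[R] R) : wedge h (α + α') β = wedge h α β + wedge h α' β := by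
  ext v
  simp [wedge, ← AlternatingMap.domCoprod'_apply, TensorProduct.add_tmul]

theorem wedge_add_right {k l n : ℕ} (h : k + l = n) (α : N [⋀^Fin k]→ₗ[R] R)
    (β β' : N [⋀^Fin l]→ₗ[R] R) : wedge h α (β + β') = wedge h α β + wedge h α β' := by
  ext v
  simp [wedge, ← AlternatingMap.domCoprod'_apply, TensorProduct.tmul_add]

theorem wedge_smul_left {k l n : ℕ} (h : k + l = n) (c : R) (α : N [⋀^Fin k]→ₗ[R] R)
    (β : N [⋀^Fin l]→ₗ[R] R) : wedge h (c • α) β = c • wedge h α β := by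
  ext v
  simp only [wedge, ← AlternatingMap.domCoprod'_apply, ← TensorProduct.smul_tmul', map_smul]
  simp

theorem wedge_smul_right {k l n : ℕ} (h : k + l = n) (c : R) (α : N [⋀^Fin k]→ₗ[R] R)
    (β : N [⋀^Fin l]→ₗ[R] R) : wedge h α (c • β) = c • wedge h α β := by
  ext v
  simp only [wedge, ← AlternatingMap.domCoprod'_apply, TensorProduct.tmul_smul, map_smul]
  simp

/-- The wedge product of forms as a bilinear map. -/
def mulHom : Forms R N →ₗ[R] Forms R N →ₗ[R] Forms R N :=
  LinearMap.mk₂ R mul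
    (fun u u' v => by
      funext n
      simp only [mul, Pi.add_apply, wedge_add_left, Finset.sum_add_distrib])
    (fun c u v => by
      funext n
      simp only [mul, Pi.smul_apply, wedge_smul_left, Finset.smul_sum])
    (fun u v v' => by
      funext n
      simp only [mul, Pi.add_apply, wedge_add_right, Finset.sum_add_distrib])
    (fun c u v => by
      funext n
      simp only [mul, Pi.smul_apply, wedge_smul_right, Finset.smul_sum])

theorem mulHom_apply (u v : Forms R N) : mulHom u v = mul u v := rfl

theorem interior_mulHom (x : N) (u v : Forms R N) :
    interior x (mulHom u v) = mulHom (interior x u) v + mulHom (parity u) (interior x v) :=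
  interior_mul x u v

theorem mulHom_ofFun (f : R) (u : Forms R N) : mulHom (ofFun f) u = f • u := by
  refine eq_of_interior (fun u => mulHom (ofFun f) u) (fun u => f • u)
    (fun u => ?_) (fun x u => ⟨interior x u, ?_⟩) u
  · ext v; simp [mulHom_apply, mul_apply_zero]
  · simp [interior_mulHom]

theorem parity_ofDual (θ : Module.Dual R N) : parity (ofDual θ) = -ofDual θ := by
  have := exterior_parity θ (ofFun (1 : R))
  rw [parity_ofFun, exterior_ofFun, one_smul] at this
  rw [eq_neg_iff_add_eq_zero, add_comm, ← eq_neg_iff_add_eq_zero]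
  exact this

theorem mulHom_ofDual (θ : Module.Dual R N) (u : Forms R N) :
    mulHom (ofDual θ) u = exterior θ u := by
  refine eq_of_interior (fun u => mulHom (ofDual θ) u) (fun u => exterior θ u)
    (fun u => ?_) (fun x u => ⟨-interior x u, ?_⟩) u
  · ext v; simp [mulHom_apply, mul_apply_zero]
  · simp only [interior_mulHom, interior_ofDual, mulHom_ofFun, parity_ofDual, interior_exterior,
      map_neg, LinearMap.neg_apply]
    abel

/-- This is the only case of associativity that is needed. Contraction alters either factor, so the
induction on the degree runs over both factors at once instead of through `eq_of_interior`. -/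
theorem mulHom_exterior (θ : Module.Dual R N) (u v : Forms R N) :
    mulHom u (exterior θ v) = mulHom (exterior θ (parity u)) v := by
  have key : ∀ k u v, mulHom u (exterior θ v) k = -mulHom (parity (exterior θ u)) v k := by
    intro k
    induction k with
    | zero => intro u v; ext Y; simp [mulHom_apply, mul_apply_zero]
    | succ k ih =>
      intro u v
      ext w
      have h1 := congrArg (fun z => z k (Fin.tail w))
        (interior_mulHom (w 0) u (exterior θ v))
      have h2 := congrArg (fun z => z k (Fin.tail w))
        (interior_mulHom (w 0) (parity (exterior θ u)) v)
      have i1 := ih (interior (w 0) u) v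
      have i2 := ih (parity u) (interior (w 0) v)
      simp only [parity_parity, exterior_parity, map_neg, LinearMap.neg_apply, Pi.neg_apply,
        neg_neg] at i2
      simp only [interior_apply, Fin.cons_self_tail, interior_exterior, interior_parity,
        parity_parity, map_sub, map_neg, map_smul, LinearMap.sub_apply,
        LinearMap.neg_apply, LinearMap.smul_apply, Pi.add_apply, Pi.sub_apply, Pi.neg_apply,
        Pi.smul_apply, i1, i2] at h1 h2
      rw [h1, AlternatingMap.neg_apply, h2]
      simp only [AlternatingMap.add_apply, AlternatingMap.sub_apply, AlternatingMap.neg_apply]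
      abel
  funext k
  rw [key k u v, exterior_parity, map_neg]
  rfl

theorem mulHom_single_single {k l n : ℕ} (h : k + l = n) (α : N [⋀^Fin k]→ₗ[R] R)
    (β : N [⋀^Fin l]→ₗ[R] R) : mulHom (single α) (single β) n = wedge h α β := by
  ext Y
  rw [mulHom_apply, mul_apply_apply, Finset.sum_eq_single (k, l)]
  · simp [h, single]
  · rintro ⟨i, j⟩ hij hne
    by_cases hi : i = k
    · have hj : j ≠ l := fun hj => hne (by rw [hi, hj])
      have : ∀ h : i + j = n, wedge h (single α i) (0 : N [⋀^Fin j]→ₗ[R] R) Y = 0 := by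
        intro h
        have := wedge_smul_right h (0 : R) (single α i) (0 : N [⋀^Fin j]→ₗ[R] R)
        rw [zero_smul, zero_smul] at this
        rw [this]; rfl
      simp only [single, Pi.single_eq_of_ne hj]
      simp only [single] at this
      simp [this]
    · have : ∀ (h : i + j = n) (β' : N [⋀^Fin j]→ₗ[R] R),
          wedge h (0 : N [⋀^Fin i]→ₗ[R] R) β' Y = 0 := by
        intro h β'
        have := wedge_smul_left h (0 : R) (0 : N [⋀^Fin i]→ₗ[R] R) β'
        rw [zero_smul, zero_smul] at this
        rw [this]; rfl
      simp [single, Pi.single_eq_of_ne hi, this]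
  · intro h'
    exact absurd (Finset.HasAntidiagonal.mem_antidiagonal.2 h) h'

end Forms
end Wedge

theorem Forms.mulHom_ofFun_one_right {R N : Type*} [CommRing R] [Algebra ℝ R] [AddCommGroup N]
    [Module R N] (u : Forms R N) : Forms.mulHom u (Forms.ofFun 1) = u := by
  refine Forms.eq_of_interior (fun u => Forms.mulHom u (Forms.ofFun 1)) (fun u => u)
    (fun u => ?_) (fun x u => ⟨Forms.interior x u, ?_⟩) u
  · ext v; simp [Forms.mulHom_apply, Forms.mul_apply_zero]
  · simp [Forms.interior_mulHom]

theorem Forms.single_apply_self {R N : Type*} [CommRing R] [AddCommGroup N]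
    [Module R N] {k : ℕ} (α : N [⋀^Fin k]→ₗ[R] R) : Forms.single α k = α := by
  simp [Forms.single]

/-- A volume form is a basis of the forms of top degree. -/
structure IsVolume {R N : Type*} [CommRing R] [AddCommGroup N] [Module R N] {n : ℕ}
    (Ω : N [⋀^Fin n]→ₗ[R] R) : Prop where
  eq_zero : ∀ r : R, r • Ω = 0 → r = 0
  exists_smul : ∀ α : N [⋀^Fin n]→ₗ[R] R, ∃ g : R, α = g • Ω
  vanish : ∀ {k : ℕ}, n < k → ∀ α : N [⋀^Fin k]→ₗ[R] R, α = 0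

namespace IsVolume

variable {R N : Type*} [CommRing R] [AddCommGroup N] [Module R N] {n : ℕ}
  {Ω : N [⋀^Fin n]→ₗ[R] R} (hΩ : IsVolume Ω)

include hΩ in
theorem smul_injective {r s : R} (h : r • Ω = s • Ω) : r = s :=
  sub_eq_zero.1 (hΩ.eq_zero _ (by
    have : (r - s) • Ω = r • Ω - s • Ω := by ext v; simp [sub_mul]
    rw [this, h, sub_self]))

/-- The coefficient of a form of top degree. -/
def coeff (hΩ : IsVolume Ω) (α : N [⋀^Fin n]→ₗ[R] R) : R := (hΩ.exists_smul α).choose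

theorem coeff_smul (α : N [⋀^Fin n]→ₗ[R] R) : hΩ.coeff α • Ω = α :=
  (hΩ.exists_smul α).choose_spec.symm

theorem coeff_eq {α : N [⋀^Fin n]→ₗ[R] R} {r : R} (h : α = r • Ω) : hΩ.coeff α = r :=
  hΩ.smul_injective ((hΩ.coeff_smul α).trans h)

theorem coeff_add (α β : N [⋀^Fin n]→ₗ[R] R) :
    hΩ.coeff (α + β) = hΩ.coeff α + hΩ.coeff β :=
  hΩ.coeff_eq (by rw [add_smul, coeff_smul, coeff_smul])

theorem coeff_smul' (c : R) (α : N [⋀^Fin n]→ₗ[R] R) :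
    hΩ.coeff (c • α) = c * hΩ.coeff α :=
  hΩ.coeff_eq (by rw [mul_smul, coeff_smul])

end IsVolume

/-! ### The isomorphism `V^♯` and the operators that it exchanges. -/

section Sharp

variable {R P Q : Type*} [CommRing R] [Algebra ℝ R]
  [AddCommGroup P] [Module R P] [AddCommGroup Q] [Module R Q]

open Forms

theorem wedgeAll_apply (p : P →ₗ[R] Q →ₗ[R] R) {l : ℕ} (η : Fin l → Q) (X : Fin l → P) :
    wedgeAll p η X = (Matrix.of fun i j => p (X i) (η j)).det := rfl

theorem wedgeAll_flip (p : P →ₗ[R] Q →ₗ[R] R) {l : ℕ} (η : Fin l → Q) (X : Fin l → P) :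
    wedgeAll p η X = wedgeAll p.flip X η := by
  rw [wedgeAll_apply, wedgeAll_apply, ← Matrix.det_transpose]
  rfl

/-- Laplace expansion of the determinant along its first column. -/
theorem single_wedgeAll_cons (p : P →ₗ[R] Q →ₗ[R] R) {l : ℕ} (ξ : Q) (η : Fin l → Q) :
    single (wedgeAll p (Fin.cons ξ η : Fin (l + 1) → Q)) =
      exterior (p.flip ξ) (single (wedgeAll p η)) := by
  funext k
  rcases k with _ | k
  · simp [single]
  · by_cases hk : k = l
    · subst hk
      ext X
      rw [single_apply_self, exterior_apply_succ, single_apply_self, wedgeAll_apply,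
        Matrix.det_succ_column_zero]
      refine Finset.sum_congr rfl fun i _ => ?_
      rw [mul_assoc]
      congr 2
    · ext X
      rw [exterior_apply_succ]
      simp [single, Pi.single_eq_of_ne hk, Pi.single_eq_of_ne (show k + 1 ≠ l + 1 by omega)]

/-- Associativity moves `ξ` from the decomposable factor to the left one, and parity records the
sign of passing it in front of `u`. Filling a slot of `V^♯ u` with `ξ` thereby becomes exterior
multiplication. -/
theorem wedge_wedgeAll_cons (p : P →ₗ[R] Q →ₗ[R] R) {k l n : ℕ} (h : k + (l + 1) = n)
    (h' : k + 1 + l = n) (u : Forms R P) (ξ : Q) (η : Fin l → Q) :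
    wedge h (u k) (wedgeAll p (Fin.cons ξ η : Fin (l + 1) → Q)) =
      wedge h' (exterior (p.flip ξ) (parity u) (k + 1)) (wedgeAll p η) := by
  have h2 : exterior (p.flip ξ) (parity (single (u k))) =
      single (exterior (p.flip ξ) (parity u) (k + 1)) := by
    funext j
    rcases j with _ | j
    · simp [single]
    · by_cases hj : j = k
      · subst hj
        ext X
        simp only [single_apply_self, exterior_apply_succ, parity_apply]
      · ext X
        rw [exterior_apply_succ]
        simp [single, parity_apply, Pi.single_eq_of_ne hj,
          Pi.single_eq_of_ne (show j + 1 ≠ k + 1 by omega)]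
  rw [← mulHom_single_single h, ← mulHom_single_single h', ← h2, single_wedgeAll_cons,
    mulHom_exterior]

variable {p : P →ₗ[R] Q →ₗ[R] R} {n : ℕ} {Ω : P [⋀^Fin n]→ₗ[R] R} {V : Q [⋀^Fin n]→ₗ[R] R}

theorem exists_sharp (hΩ : IsVolume Ω) {k l : ℕ} (h : k + l = n) (α : P [⋀^Fin k]→ₗ[R] R) :
    ∃ β : Q [⋀^Fin l]→ₗ[R] R, ∀ η : Fin l → Q, wedge h α (wedgeAll p η) = β η • Ω := by
  refine ⟨{ toFun := fun η => hΩ.coeff (wedge h α (wedgeAll p η))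
            map_update_add' := ?_
            map_update_smul' := ?_
            map_eq_zero_of_eq' := ?_ }, fun η => (hΩ.coeff_smul _).symm⟩
  · intro inst X i x y
    obtain rfl : inst = instDecidableEqFin l := Subsingleton.elim _ _
    rw [← hΩ.coeff_add, ← wedge_add_right]
    congr 2
    ext Y
    simp [wedgeAll_flip p]
  · intro inst X i c x
    obtain rfl : inst = instDecidableEqFin l := Subsingleton.elim _ _
    rw [smul_eq_mul, ← hΩ.coeff_smul', ← wedge_smul_right]
    congr 2
    ext Y
    simp [wedgeAll_flip p]
  · intro X i j hij hne
    have : wedgeAll p X = (0 : R) • wedgeAll p X := by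
      ext Y
      rw [wedgeAll_flip p, AlternatingMap.map_eq_zero_of_eq _ _ hij hne]
      simp
    rw [this, wedge_smul_right, hΩ.coeff_smul', zero_mul]

theorem sharp_spec (hΩ : IsVolume Ω) {k l : ℕ} (h : k + l = n) (α : P [⋀^Fin k]→ₗ[R] R)
    (η : Fin l → Q) : wedge h α (wedgeAll p η) = sharp p h Ω α η • Ω :=
  Classical.epsilon_spec (p := fun β : Q [⋀^Fin l]→ₗ[R] R =>
    ∀ η : Fin l → Q, wedge h α (wedgeAll p η) = β η • Ω) (exists_sharp hΩ h α) η

/-- The operator `V^♯` on the graded module of all forms. -/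
def sharpTotal (p : P →ₗ[R] Q →ₗ[R] R) (hΩ : IsVolume Ω) : Forms R P →ₗ[R] Forms R Q where
  toFun u l := if h : l ≤ n then sharp p (Nat.sub_add_cancel h) Ω (u (n - l)) else 0
  map_add' u v := by
    ext l η
    by_cases h : l ≤ n
    · simp only [h, dif_pos, Pi.add_apply, AlternatingMap.add_apply]
      apply hΩ.smul_injective
      rw [add_smul, ← sharp_spec hΩ, ← sharp_spec hΩ, ← sharp_spec hΩ, wedge_add_left]
    · simp [h]
  map_smul' c u := by
    ext l η
    by_cases h : l ≤ n
    · simp only [h, dif_pos, Pi.smul_apply, AlternatingMap.smul_apply, RingHom.id_apply]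
      apply hΩ.smul_injective
      rw [smul_assoc, ← sharp_spec hΩ, ← sharp_spec hΩ, wedge_smul_left]
    · simp [h]

theorem sharpTotal_apply (hΩ : IsVolume Ω) {k l : ℕ} (h : k + l = n) (u : Forms R P) :
    sharpTotal p hΩ u l = sharp p h Ω (u k) := by
  obtain rfl : k = n - l := by omega
  have hl : l ≤ n := by omega
  change (if h : l ≤ n then sharp p (Nat.sub_add_cancel h) Ω (u (n - l)) else 0) = _
  rw [dif_pos hl]

theorem sharpTotal_apply_of_lt (hΩ : IsVolume Ω) {l : ℕ} (h : n < l) (u : Forms R P) :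
    sharpTotal p hΩ u l = 0 := by
  change (if h : l ≤ n then sharp p (Nat.sub_add_cancel h) Ω (u (n - l)) else 0) = _
  rw [dif_neg (by omega)]

theorem sharpTotal_apply_smul (hΩ : IsVolume Ω) {k l : ℕ} (h : k + l = n) (u : Forms R P)
    (η : Fin l → Q) : sharpTotal p hΩ u l η • Ω = wedge h (u k) (wedgeAll p η) := by
  rw [sharpTotal_apply hΩ h, sharp_spec hΩ]

theorem sharpTotal_apply_zero (hΩ : IsVolume Ω) (u : Forms R P) (η : Fin 0 → Q) :
    sharpTotal p hΩ u 0 η = hΩ.coeff (u n) := by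
  symm
  apply hΩ.coeff_eq
  rw [sharpTotal_apply_smul hΩ (add_zero n), ← mulHom_single_single]
  have : (single (wedgeAll p η) : Forms R P) = ofFun 1 := by
    rw [ofFun]
    congr 1
    ext X
    simp [wedgeAll_apply]
  rw [this, mulHom_ofFun_one_right, single_apply_self]

theorem sharpTotal_apply_top (hΩ : IsVolume Ω) (hV : AreDual p Ω V) (u : Forms R P)
    (η : Fin n → Q) : sharpTotal p hΩ u n η = u 0 Fin.elim0 * V η := by
  apply hΩ.smul_injective
  rw [sharpTotal_apply_smul hΩ (zero_add n), ← mulHom_single_single]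
  have : (single (u 0) : Forms R P) = ofFun (u 0 Fin.elim0) := by
    rw [ofFun]
    congr 1
    ext X
    rw [Subsingleton.elim X Fin.elim0]
    simp
  rw [this, mulHom_ofFun, Pi.smul_apply, single_apply_self]
  ext X
  simp only [AlternatingMap.smul_apply, smul_eq_mul]
  rw [wedgeAll_apply, ← hV X η]
  ring

/-- The convention `ι_ξ ι_α V = ι_{α∧ξ} V`, with `α ∧ ξ = (-1)^k ξ ∧ α`. -/
theorem interior_sharpTotal (hΩ : IsVolume Ω) (ξ : Q) (u : Forms R P) :
    interior ξ (sharpTotal p hΩ u) = sharpTotal p hΩ (exterior (p.flip ξ) (parity u)) := by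
  ext l η
  rw [interior_apply]
  rcases lt_trichotomy l n with h | h | h
  · obtain ⟨k, hk⟩ := Nat.exists_eq_add_of_lt h
    apply hΩ.smul_injective
    rw [sharpTotal_apply_smul hΩ (show k + (l + 1) = n by omega),
      sharpTotal_apply_smul hΩ (show k + 1 + l = n by omega)]
    exact wedge_wedgeAll_cons p _ _ u ξ η
  · rw [sharpTotal_apply_of_lt hΩ (by omega)]
    subst h
    apply hΩ.smul_injective
    rw [sharpTotal_apply_smul hΩ (zero_add l), exterior_apply_zero]
    have := wedge_smul_left (zero_add l) (0 : R) (0 : P [⋀^Fin 0]→ₗ[R] R) (wedgeAll p η)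
    rw [zero_smul, zero_smul] at this
    rw [this]
    simp
  · rw [sharpTotal_apply_of_lt hΩ (by omega), sharpTotal_apply_of_lt hΩ h]
    rfl

theorem exterior_sharpTotal (hΩ : IsVolume Ω) (X : P) (u : Forms R P) :
    exterior (p X) (sharpTotal p hΩ u) = -sharpTotal p hΩ (interior X (parity u)) := by
  refine eq_of_interior (fun u => exterior (p X) (sharpTotal p hΩ u))
    (fun u => -sharpTotal p hΩ (interior X (parity u))) (fun u => ?_)
    (fun ξ u => ⟨-exterior (p.flip ξ) (parity u), ?_⟩) u
  · ext η
    -- In degree zero the right side involves the component of degree `n + 1`, which vanishes above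
    -- the rank.
    have h0 : interior X (parity u) n = 0 := by
      change (parity u (n + 1)).curryLeft X = 0
      rw [hΩ.vanish (Nat.lt_succ_self n) (parity u (n + 1))]
      rfl
    rw [Pi.neg_apply, AlternatingMap.neg_apply, sharpTotal_apply_zero, h0,
      hΩ.coeff_eq (zero_smul R Ω).symm]
    simp
  · simp only [interior_exterior, interior_sharpTotal, map_neg, map_sub, map_smul,
      interior_parity, exterior_parity, parity_parity, LinearMap.flip_apply, neg_neg]
    module

theorem parity_sharpTotal (hΩ : IsVolume Ω) (u : Forms R P) :
    parity (sharpTotal p hΩ u) = (-1 : R) ^ n • sharpTotal p hΩ (parity u) := by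
  ext l η
  rcases lt_or_ge n l with h | h
  · simp [parity_apply, sharpTotal_apply_of_lt hΩ h]
  · obtain ⟨k, rfl⟩ := Nat.exists_eq_add_of_le' h
    apply hΩ.smul_injective
    simp only [parity_apply, Pi.smul_apply, AlternatingMap.smul_apply, smul_assoc]
    rw [sharpTotal_apply_smul hΩ rfl, sharpTotal_apply_smul hΩ rfl, parity_apply, wedge_smul_left,
      smul_smul, pow_add, mul_right_comm, ← mul_pow]
    simp

namespace DerivativeEndo

variable [p.IsPerfPair]

theorem pairing_dual_op (T : DerivativeEndo R P) (Y : P) (ξ : Q) :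
    p Y ((T.dual p).op ξ) = T.symbol (p Y ξ) - p (T.op Y) ξ := by
  have : p.flip ((T.dual p).op ξ) Y = T.symbol (p Y ξ) - p (T.op Y) ξ := by
    change p.flip (p.flip.toPerfPair.symm _) Y = _
    rw [LinearMap.apply_symm_toPerfPair_self]
    rfl
  exact this

@[simp] theorem dual_symbol (T : DerivativeEndo R P) : (T.dual p).symbol = T.symbol := rfl

theorem transpose_flip (T : DerivativeEndo R P) (ξ : Q) :
    T.transpose (p.flip ξ) = p.flip ((T.dual p).op ξ) := by
  ext Y
  rw [transpose_apply, LinearMap.flip_apply, LinearMap.flip_apply, LinearMap.flip_apply,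
    pairing_dual_op]

theorem dual_transpose (T : DerivativeEndo R P) (Y : P) :
    (T.dual p).transpose (p Y) = p (T.op Y) := by
  ext ξ
  rw [transpose_apply, pairing_dual_op, dual_symbol, sub_sub_cancel]

/-- The contraction is natural, so only the variation of `V` intervenes: `V` is dual to `Ω`, hence
scales by `-r` when `Ω` scales by `r`. -/
theorem lieTotal_sharpTotal (hΩ : IsVolume Ω) (T : DerivativeEndo R P) {r : R}
    (hr : T.lie Ω = r • Ω) (u : Forms R P) :
    (T.dual p).lieTotal (sharpTotal p hΩ u) =
      sharpTotal p hΩ (T.lieTotal u) - r • sharpTotal p hΩ u := by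
  refine eq_of_interior (fun u => (T.dual p).lieTotal (sharpTotal p hΩ u))
    (fun u => sharpTotal p hΩ (T.lieTotal u) - r • sharpTotal p hΩ u) (fun u => ?_)
    (fun ξ u => ⟨exterior (p.flip ξ) (parity u), ?_⟩) u
  · ext η
    rw [Pi.sub_apply, AlternatingMap.sub_apply, sharpTotal_apply_zero, Pi.smul_apply,
      AlternatingMap.smul_apply, sharpTotal_apply_zero, lieTotal_apply, lieTotal_apply, lie_apply,
      sharpTotal_apply_zero]
    have : hΩ.coeff (T.lie (u n)) = T.symbol (hΩ.coeff (u n)) + hΩ.coeff (u n) * r := by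
      apply hΩ.coeff_eq
      conv_lhs => rw [← hΩ.coeff_smul (u n)]
      have := congrArg (fun z => z n) (T.lieTotal_smul (hΩ.coeff (u n)) (single Ω))
      simp only [lieTotal_apply, Pi.smul_apply, Pi.add_apply, single_apply_self] at this
      rw [this, hr, add_smul, mul_smul]
    rw [this]
    simp
    ring
  · simp only [interior_lieTotal, interior_sharpTotal, map_sub, map_smul, lieTotal_exterior,
      lieTotal_parity, map_add, transpose_flip]
    module

end DerivativeEndo

/-- The sign operator `(-1)^{(n+1)k}` in degree `k`. -/
def twist {N : Type*} [AddCommGroup N] [Module R N] (n : ℕ) : Forms R N →ₗ[R] Forms R N where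
  toFun u k := ((-1 : R) ^ (n + 1)) ^ k • u k
  map_add' u v := by ext k w; simp
  map_smul' c u := by ext k w; simp; ring

theorem twist_twist {N : Type*} [AddCommGroup N] [Module R N] (n : ℕ) (u : Forms R N) :
    twist n (twist n u) = u := by
  ext k v
  change ((-1 : R) ^ (n + 1)) ^ k * (((-1 : R) ^ (n + 1)) ^ k * u k v) = _
  rw [← mul_assoc, ← mul_pow, ← mul_pow]
  simp

theorem interior_twist {N : Type*} [AddCommGroup N] [Module R N] (n : ℕ) (x : N) (u : Forms R N) :
    interior x (twist n u) = (-1 : R) ^ (n + 1) • twist n (interior x u) := by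
  ext k v
  change ((-1 : R) ^ (n + 1)) ^ (k + 1) * u (k + 1) (Fin.cons x v) =
    (-1) ^ (n + 1) * (((-1 : R) ^ (n + 1)) ^ k * u (k + 1) (Fin.cons x v))
  ring

theorem AreDual.flip (hd : AreDual p Ω V) : AreDual p.flip V Ω := by
  intro X ξ
  rw [mul_comm, hd, ← Matrix.det_transpose]
  rfl

/-- Up to parity of the exponent, `(n+1)k` is `k(n-k)`, the usual sign for exchanging complementary
degrees. Applied to both pairings, the formula makes `V^♯` bijective on all forms. -/
theorem sharpTotal_sharpTotal (hΩ : IsVolume Ω) (hV : IsVolume V) (hd : AreDual p Ω V)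
    (u : Forms R P) : sharpTotal p.flip hV (sharpTotal p hΩ u) = twist n u := by
  refine eq_of_interior (fun u => sharpTotal p.flip hV (sharpTotal p hΩ u)) (fun u => twist n u)
    (fun u => ?_) (fun X u => ⟨(-1 : R) ^ (n + 1) • interior X u, ?_⟩) u
  · ext η
    rw [sharpTotal_apply_zero, hV.coeff_eq (r := u 0 Fin.elim0), Subsingleton.elim η Fin.elim0]
    · simp [twist]
    · ext η
      rw [sharpTotal_apply_top hΩ hd]
      rfl
  · have h1 := exterior_sharpTotal (p := p) hΩ X (parity u)
    simp only [interior_sharpTotal, interior_twist, parity_sharpTotal, LinearMap.flip_flip,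
      map_smul, h1, parity_parity, map_neg, smul_neg, pow_succ]
    module

theorem sharpTotal_surjective (hΩ : IsVolume Ω) (hV : IsVolume V) (hd : AreDual p Ω V)
    (w : Forms R Q) : ∃ u, sharpTotal p hΩ u = w := by
  refine ⟨sharpTotal p.flip hV (twist n w), ?_⟩
  have := sharpTotal_sharpTotal (p := p.flip) hV hΩ hd.flip (twist n w)
  rwa [twist_twist] at this

theorem sharpTotal_injective (hΩ : IsVolume Ω) (hV : IsVolume V) (hd : AreDual p Ω V) :
    Function.Injective (sharpTotal p hΩ) := by
  intro u v h
  have h' := congrArg (sharpTotal p.flip hV) h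
  rw [sharpTotal_sharpTotal hΩ hV hd, sharpTotal_sharpTotal hΩ hV hd] at h'
  rw [← twist_twist n u, h', twist_twist]

end Sharp

/-! ### The operator `∂̆` as the transported differential. -/

section Boundary

variable {R P Q : Type*} [CommRing R] [Algebra ℝ R]
  [AddCommGroup P] [Module R P] [AddCommGroup Q] [Module R Q]
  {p : P →ₗ[R] Q →ₗ[R] R} {n : ℕ} {Ω : P [⋀^Fin n]→ₗ[R] R} {V : Q [⋀^Fin n]→ₗ[R] R}

open Forms

theorem Forms.neg_one_smul {N : Type*} [AddCommGroup N] [Module R N] (u : Forms R N) :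
    (-1 : R) • u = -u := by
  ext k v
  simp

theorem sharp_injective (hΩ : IsVolume Ω) (hV : IsVolume V) (hd : AreDual p Ω V) {k l : ℕ}
    (h : k + l = n) : Function.Injective (sharp (R := R) p h Ω) := by
  intro α β hαβ
  have : sharpTotal p hΩ (single α) = sharpTotal p hΩ (single β) := by
    funext j
    rcases lt_or_ge n j with hj | hj
    · rw [sharpTotal_apply_of_lt hΩ hj, sharpTotal_apply_of_lt hΩ hj]
    · by_cases hjl : j = l
      · subst hjl
        rw [sharpTotal_apply hΩ h, sharpTotal_apply hΩ h, single_apply_self, single_apply_self, hαβ]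
      · obtain ⟨i, hi⟩ := Nat.exists_eq_add_of_le' hj
        have hik : i ≠ k := by omega
        rw [sharpTotal_apply hΩ hi.symm, sharpTotal_apply hΩ hi.symm]
        simp only [single, Pi.single_eq_of_ne hik]
  have h2 := congrArg (fun z => z k) (sharpTotal_injective hΩ hV hd this)
  simpa only [single_apply_self] using h2

/-- Injectivity in the single degree `k` is what makes the functional inverse inside `bdel` return
`α`. -/
theorem bdel_sharp (hΩ : IsVolume Ω) (hV : IsVolume V) (hd : AreDual p Ω V)
    (L : LieAlgebroid R P) (θ : Module.Dual R P) {k l : ℕ} (h : k + (l + 1) = n)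
    (h' : k + 1 + l = n) (α : P [⋀^Fin k]→ₗ[R] R) :
    bdel p L θ Ω (sharp p h Ω α) = (-1 : R) ^ k • sharp p h' Ω (L.diff θ α) := by
  obtain rfl : k = n - (l + 1) := by omega
  have hl : l + 1 ≤ n := by omega
  rw [bdel, dif_pos hl]
  have := Function.leftInverse_invFun (sharp_injective hΩ hV hd h) α
  rw [this]

/-- The operator `∂̆` on the graded module of all forms, transported from the differential. -/
def boundary (hΩ : IsVolume Ω) (hV : IsVolume V) (hd : AreDual p Ω V)
    (L : LieAlgebroid R P) (θ : Module.Dual R P) : Forms R Q →+ Forms R Q :=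
  ((sharpTotal p hΩ).toAddMonoidHom.comp ((L.totalDiffHom θ).comp
    (parity (R := R) (N := P)).toAddMonoidHom)).comp
      (LinearEquiv.ofBijective (sharpTotal p hΩ) ⟨sharpTotal_injective hΩ hV hd,
        sharpTotal_surjective hΩ hV hd⟩).symm.toLinearMap.toAddMonoidHom

variable (hΩ : IsVolume Ω) (hV : IsVolume V) (hd : AreDual p Ω V)
    (L : LieAlgebroid R P) (θ : Module.Dual R P)

theorem boundary_sharpTotal (u : Forms R P) :
    boundary hΩ hV hd L θ (sharpTotal p hΩ u) =
      sharpTotal p hΩ (L.totalDiffHom θ (parity u)) := by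
  change sharpTotal p hΩ (L.totalDiffHom θ (parity ((LinearEquiv.ofBijective (sharpTotal p hΩ)
    ⟨sharpTotal_injective hΩ hV hd, sharpTotal_surjective hΩ hV hd⟩).symm _))) = _
  congr 3
  rw [LinearEquiv.symm_apply_eq]
  rfl

theorem boundary_apply (w : Forms R Q) (l : ℕ) :
    boundary hΩ hV hd L θ w l = bdel p L θ Ω (w (l + 1)) := by
  obtain ⟨u, rfl⟩ := sharpTotal_surjective hΩ hV hd w
  rw [boundary_sharpTotal]
  rcases lt_trichotomy l n with h | h | h
  · obtain ⟨k, hk⟩ := Nat.exists_eq_add_of_lt h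
    have h1 : k + (l + 1) = n := by omega
    have h2 : k + 1 + l = n := by omega
    rw [sharpTotal_apply hΩ h1, sharpTotal_apply hΩ h2, bdel_sharp hΩ hV hd L θ h1 h2,
      L.totalDiffHom_parity, Pi.neg_apply, parity_apply, L.totalDiffHom_apply_succ]
    ext η
    have h3 := congrArg (fun z => z l η) ((sharpTotal p hΩ).map_smul ((-1 : R) ^ k)
      (single (L.diff θ (u k))))
    simp only [sharpTotal_apply hΩ h2, Pi.smul_apply, single_apply_self] at h3
    have h4 : -((-1 : R) ^ (k + 1) • L.diff θ (u k)) = (-1 : R) ^ k • L.diff θ (u k) := by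
      ext v
      simp [pow_succ]
    rw [h4, h3]
  · subst h
    rw [sharpTotal_apply hΩ (zero_add l)]
    have h3 := congrArg (fun z => z l) ((sharpTotal p hΩ).map_zero)
    simp only [sharpTotal_apply hΩ (zero_add l), Pi.zero_apply] at h3
    rw [L.totalDiffHom_apply_zero, h3, bdel, dif_neg (by omega)]
  · rw [sharpTotal_apply_of_lt hΩ h, bdel, dif_neg (by omega)]

/-- Cartan's formula seen through `V^♯`, which turns contraction with `X` into multiplication by
`X`. The function `r` appears because `V^♯` is not invariant under `L_X`. -/
theorem exterior_boundary_add [p.IsPerfPair] {X : P} {r : R} (hr : (L.ad X).lie Ω = r • Ω)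
    (w : Forms R Q) :
    boundary hΩ hV hd L θ (exterior (p X) w) = ((L.ad X).dual p).lieTotal w + (r + θ X) • w -
      exterior (p X) (boundary hΩ hV hd L θ w) := by
  obtain ⟨u, rfl⟩ := sharpTotal_surjective hΩ hV hd w
  simp only [exterior_sharpTotal, boundary_sharpTotal, map_neg, interior_parity, parity_parity,
    L.interior_totalDiffHom, L.totalDiffHom_parity, map_sub, map_add, map_smul,
    DerivativeEndo.lieTotal_sharpTotal hΩ (L.ad X) hr]
  module

/-- The Leibniz rule of the differential, where multiplication by `df` has become contraction with
`df`. -/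
theorem boundary_smul {f : R} {ξ : Q} (hξ : p.flip ξ = L.differential f) (w : Forms R Q) :
    boundary hΩ hV hd L θ (f • w) = f • boundary hΩ hV hd L θ w + interior ξ w := by
  obtain ⟨u, rfl⟩ := sharpTotal_surjective hΩ hV hd w
  rw [← map_smul, boundary_sharpTotal, boundary_sharpTotal, map_smul, L.totalDiffHom_smul,
    interior_sharpTotal, hξ, map_add, map_smul]

theorem boundary_boundary (hθ : L.IsClosed θ) (w : Forms R Q) :
    boundary hΩ hV hd L θ (boundary hΩ hV hd L θ w) = 0 := by
  obtain ⟨u, rfl⟩ := sharpTotal_surjective hΩ hV hd w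
  rw [boundary_sharpTotal, boundary_sharpTotal, L.totalDiffHom_parity,
    L.totalDiffHom_totalDiffHom hθ, map_zero, neg_zero, map_zero]

theorem parity_boundary (w : Forms R Q) :
    boundary hΩ hV hd L θ (parity w) = -parity (boundary hΩ hV hd L θ w) := by
  obtain ⟨u, rfl⟩ := sharpTotal_surjective hΩ hV hd w
  rcases neg_one_pow_eq_or R n with h | h <;>
    simp only [parity_sharpTotal, h, one_smul, Forms.neg_one_smul, map_neg, boundary_sharpTotal,
      L.totalDiffHom_parity, parity_parity, neg_neg]

theorem boundary_ofFun (f : R) : boundary hΩ hV hd L θ (ofFun f) = 0 := by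
  funext l
  have h1 := boundary_apply hΩ hV hd L θ (ofFun f) l
  have h2 := boundary_apply hΩ hV hd L θ 0 l
  rw [h1, ofFun_apply_succ]
  rw [map_zero] at h2
  exact h2.symm

theorem twist_totalDiffHom (Ls : LieAlgebroid R Q) (θs : Module.Dual R Q) (w : Forms R Q) :
    twist n (Ls.totalDiffHom θs w) = (-1 : R) ^ (n + 1) • Ls.totalDiffHom θs (twist n w) := by
  rcases neg_one_pow_eq_or R (n + 1) with h | h
  · have : ∀ u : Forms R Q, twist n u = u := fun u => by
      ext k v
      change (((-1 : R) ^ (n + 1)) ^ k) * u k v = _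
      simp [h]
    rw [this, this, h, one_smul]
  · have : ∀ u : Forms R Q, twist n u = parity u := fun u => by
      ext k v
      change (((-1 : R) ^ (n + 1)) ^ k) * u k v = _
      simp [h, parity_apply]
    rw [this, this, h, Ls.totalDiffHom_parity]
    simp

/-- `V^♯` exchanges the boundary operator of the opposite pair and the differential. -/
theorem sharpTotal_boundary_flip (Ls : LieAlgebroid R Q) (θs : Module.Dual R Q)
    (u : Forms R P) :
    sharpTotal p hΩ (boundary (p := p.flip) hV hΩ hd.flip Ls θs u) =
      -Ls.totalDiffHom θs (sharpTotal p hΩ (parity u)) := by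
  obtain ⟨w, rfl⟩ := sharpTotal_surjective (p := p.flip) hV hΩ hd.flip u
  have h1 : ∀ w, sharpTotal p hΩ (sharpTotal p.flip hV w) = twist n w :=
    sharpTotal_sharpTotal (p := p.flip) hV hΩ hd.flip
  rw [boundary_sharpTotal, parity_sharpTotal, map_smul, h1, h1, twist_totalDiffHom, pow_succ]
  rcases neg_one_pow_eq_or R n with h | h <;> simp [h, Forms.neg_one_smul]

/-- The squares of the operators `d̆_* + ∂̆` and `d̆ + ∂̆_*` correspond to each other under
`V^♯`. -/
theorem sharpTotal_square (Ls : LieAlgebroid R Q) (θs : Module.Dual R Q) (hθ : L.IsClosed θ)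
    (hθs : Ls.IsClosed θs) (D : Forms R Q → Forms R Q) (D' : Forms R P → Forms R P)
    (hD : ∀ w, D w = Ls.totalDiffHom θs w + boundary hΩ hV hd L θ w)
    (hD' : ∀ w, D' w = L.totalDiffHom θ w + boundary (p := p.flip) hV hΩ hd.flip Ls θs w)
    (u : Forms R P) : sharpTotal p hΩ (D' (D' u)) = D (D (sharpTotal p hΩ u)) := by
  have h1 := sharpTotal_boundary_flip hΩ hV hd Ls θs
  have h3 : ∀ v, sharpTotal p hΩ (L.totalDiffHom θ v) =
      boundary hΩ hV hd L θ (sharpTotal p hΩ (parity v)) := fun v => by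
    rw [boundary_sharpTotal, parity_parity]
  have h4 := parity_boundary (p := p.flip) hV hΩ hd.flip Ls θs u
  have h5 : parity (L.totalDiffHom θ u) = -L.totalDiffHom θ (parity u) := by
    rw [L.totalDiffHom_parity, neg_neg]
  have h6 : parity (boundary (p := p.flip) hV hΩ hd.flip Ls θs u) =
      -boundary (p := p.flip) hV hΩ hd.flip Ls θs (parity u) := by
    rw [h4, neg_neg]
  -- Only the mixed terms survive. `V^♯` turns `d̆` into `∂̆` and `∂̆_*` into `-d̆_*`, each up to
  -- parity; in each mixed term the minus sign is undone by moving parity past the other operator.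
  simp only [hD, hD', map_add, L.totalDiffHom_totalDiffHom hθ,
    Ls.totalDiffHom_totalDiffHom hθs, boundary_boundary _ _ _ _ _ hθ,
    boundary_boundary _ _ _ _ _ hθs]
  rw [h3 (boundary (p := p.flip) hV hΩ hd.flip Ls θs u), h1 (L.totalDiffHom θ u), h6, h5]
  simp only [map_neg, h1, parity_parity, neg_neg, h3, map_zero]
  abel

end Boundary

/-! ### Local frames and the compatibility conditions in low degree. -/

section Bialgebroid

variable {R P Q : Type*} [CommRing R] [Algebra ℝ R]
  [AddCommGroup P] [Module R P] [AddCommGroup Q] [Module R Q]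

open Forms

/-- A frame and its dual frame, modulo an ideal of functions that is stable under derivations (the
functions that vanish near a point), cut off by a function `χ` which is one modulo the ideal. -/
structure LocalFrame (p : P →ₗ[R] Q →ₗ[R] R) (n : ℕ) where
  ideal : Ideal R
  derivation_mem : ∀ (D : Derivation ℝ R R) (f : R), f ∈ ideal → D f ∈ ideal
  e : Fin n → P
  e' : Fin n → Q
  χ : R
  one_sub_mem : 1 - χ ∈ ideal
  frame : ∀ τ, ∑ i, p τ (e' i) • e i = χ • τ
  dual : ∀ i j, p (e i) (e' j) - (if i = j then 1 else 0) ∈ ideal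

/-- Equations between functions may be checked modulo the ideals of local frames. -/
def IsLocallyFramed (p : P →ₗ[R] Q →ₗ[R] R) (n : ℕ) : Prop :=
  ∀ r : R, (∀ F : LocalFrame p n, r ∈ F.ideal) → r = 0

variable {p : P →ₗ[R] Q →ₗ[R] R} {n : ℕ}

namespace LocalFrame

variable (F : LocalFrame p n)

theorem mem_of_mul_mem {r : R} (h : F.χ * r ∈ F.ideal) : r ∈ F.ideal := by
  have : r = r * (1 - F.χ) + F.χ * r := by ring
  rw [this]
  exact F.ideal.add_mem (F.ideal.mul_mem_left _ F.one_sub_mem) h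

theorem mem_of_two_mul_mem {r : R} (h : 2 * r ∈ F.ideal) : r ∈ F.ideal := by
  have h2 : algebraMap ℝ R (1 / 2) * 2 = 1 := by
    rw [← map_ofNat (algebraMap ℝ R) 2, ← map_mul]; norm_num
  have : r = algebraMap ℝ R (1 / 2) * (2 * r) := by rw [← mul_assoc, h2, one_mul]
  rw [this]
  exact F.ideal.mul_mem_left _ h

theorem frame' [p.IsPerfPair] (ξ : Q) : ∑ i, p (F.e i) ξ • F.e' i = F.χ • ξ := by
  apply (LinearMap.IsPerfPair.bijective_right p).injective
  ext τ
  have h := congrArg (fun z => p z ξ) (F.frame τ)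
  simp only [map_sum, map_smul, LinearMap.sum_apply, LinearMap.smul_apply, smul_eq_mul] at h
  simp only [map_sum, map_smul, LinearMap.sum_apply, LinearMap.smul_apply, smul_eq_mul,
    LinearMap.flip_apply, ← h]
  exact Finset.sum_congr rfl fun i _ => mul_comm _ _

/-- A local frame of the opposite pairing. -/
def flip [p.IsPerfPair] : LocalFrame p.flip n where
  ideal := F.ideal
  derivation_mem := F.derivation_mem
  e := F.e'
  e' := F.e
  χ := F.χ
  one_sub_mem := F.one_sub_mem
  frame := F.frame'
  dual i j := by
    have := F.dual j i
    simpa only [LinearMap.flip_apply, eq_comm] using this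

/-- The number operator. -/
theorem sum_exterior_interior [p.IsPerfPair] (u : Forms R Q) :
    ∑ i, exterior (p (F.e i)) (interior (F.e' i) u) = F.χ • degree u := by
  refine eq_of_interior (fun u => ∑ i, exterior (p (F.e i)) (interior (F.e' i) u))
    (fun u => F.χ • degree u) (fun u => ?_) (fun ξ u => ⟨interior ξ u, ?_⟩) u
  · ext v
    simp [degree_apply]
  · have h1 : ∑ i, p (F.e i) ξ • interior (F.e' i) u = F.χ • interior ξ u := by
      rw [← LinearMap.smul_apply, ← map_smul, ← F.frame' ξ]
      simp
    have h2 : ∀ i, interior ξ (exterior (p (F.e i)) (interior (F.e' i) u)) =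
        p (F.e i) ξ • interior (F.e' i) u +
          exterior (p (F.e i)) (interior (F.e' i) (interior ξ u)) := by
      intro i
      rw [interior_exterior, interior_interior ξ, map_neg, sub_neg_eq_add]
    simp only [map_sum, h2, Finset.sum_add_distrib, h1, map_smul, interior_degree]
    module

end LocalFrame

theorem IsLocallyFramed.forms_eq {N : Type*} [AddCommGroup N] [Module R N]
    (hF : IsLocallyFramed p n) {u v : Forms R N}
    (h : ∀ F : LocalFrame p n, F.χ • u = F.χ • v) : u = v := by
  ext k Y
  rw [← sub_eq_zero]
  refine hF _ fun F => F.mem_of_mul_mem ?_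
  have := congrArg (fun z => z k Y) (h F)
  simp only [Pi.smul_apply, AlternatingMap.smul_apply, smul_eq_mul] at this
  rw [mul_sub, this, sub_self]
  exact F.ideal.zero_mem

theorem LieAlgebroid.totalDiffHom_single {N : Type*} [AddCommGroup N] [Module R N]
    (L : LieAlgebroid R N) (θ : Module.Dual R N) {k : ℕ} (α : N [⋀^Fin k]→ₗ[R] R) :
    L.totalDiffHom θ (single α) = single (L.diff θ α) := by
  have h0 : ∀ j, L.diff θ (0 : N [⋀^Fin j]→ₗ[R] R) = 0 := fun j =>
    congrArg (fun z => z (j + 1)) (map_zero (L.totalDiffHom θ))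
  funext j
  rcases j with _ | j
  · simp [single]
  · rw [L.totalDiffHom_apply_succ]
    by_cases hj : j = k
    · subst hj
      simp only [single_apply_self]
    · simp only [single, Pi.single_eq_of_ne hj, Pi.single_eq_of_ne (show j + 1 ≠ k + 1 by omega),
        h0]

theorem interior_single_two {N : Type*} [AddCommGroup N] [Module R N]
    (α : N [⋀^Fin 2]→ₗ[R] R) (x : N) : ∃ θ : Module.Dual R N,
      interior x (single α) = ofDual θ := by
  refine ⟨(AlternatingMap.ofSubsingleton R N R (0 : Fin 1)).symm (α.curryLeft x), ?_⟩
  funext j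
  by_cases hj : j = 1
  · subst hj
    simp only [ofDual, single_apply_self, Equiv.apply_symm_apply]
    ext v
    rw [interior_apply, single_apply_self]
    rfl
  · ext v
    rw [interior_apply]
    simp [ofDual, single, Pi.single_eq_of_ne hj, Pi.single_eq_of_ne (show j + 1 ≠ 2 by omega)]

variable [p.IsPerfPair]

theorem exists_pairing_eq (θ : Module.Dual R Q) : ∃ z : P, p z = θ :=
  (LinearMap.IsPerfPair.bijective_left p).surjective θ

/-- Two additive operators on bivectors that satisfy the same Leibniz rule and agree on decomposable
bivectors agree. -/
theorem IsLocallyFramed.eq_on_bivectors (hF : IsLocallyFramed p n)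
    (T T' : Forms R Q →+ Forms R Q) (D : R → R)
    (hT : ∀ (f : R) (α : Q [⋀^Fin 2]→ₗ[R] R),
      T (f • single α) = D f • single α + f • T (single α))
    (hT' : ∀ (f : R) (α : Q [⋀^Fin 2]→ₗ[R] R),
      T' (f • single α) = D f • single α + f • T' (single α))
    (h : ∀ Y Z : P, T (exterior (p Y) (ofDual (p Z))) = T' (exterior (p Y) (ofDual (p Z))))
    (α : Q [⋀^Fin 2]→ₗ[R] R) : T (single α) = T' (single α) := by
  refine hF.forms_eq fun F => ?_
  -- The number operator is `2` on bivectors, and contracting a bivector with a frame gives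
  -- sections, so `2χα` is a sum of decomposables. The derivative terms of `2χ` are the same for
  -- both operators and cancel.
  have h1 := F.sum_exterior_interior (single α)
  have h2 : degree (single α) = (2 : R) • single α := by
    funext j
    by_cases hj : j = 2
    · subst hj
      simp [degree_apply]
    · simp only [degree_apply, Pi.smul_apply, single, Pi.single_eq_of_ne hj, smul_zero]
  choose θ hθ using interior_single_two α
  choose z hz using fun i => exists_pairing_eq (p := p) (θ (F.e' i))
  simp only [hθ, ← hz] at h1
  rw [h2, smul_smul] at h1
  have h3 := congrArg T h1
  have h4 := congrArg T' h1
  rw [map_sum, hT] at h3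
  rw [map_sum, hT'] at h4
  simp only [h] at h3
  have h5 := add_left_cancel (h3.symm.trans h4)
  ext k Y
  apply LieAlgebroid.eq_of_two_mul_eq
  have h6 := congrArg (fun z => z k Y) h5
  simp only [Pi.smul_apply, AlternatingMap.smul_apply, smul_eq_mul] at h6 ⊢
  linear_combination h6

namespace LieAlgebroid

/-- The differential of a function, as a section of the dual. -/
def grad (p : P →ₗ[R] Q →ₗ[R] R) [p.IsPerfPair] (L : LieAlgebroid R P) (f : R) : Q :=
  p.flip.toPerfPair.symm (L.differential f)

theorem flip_grad (L : LieAlgebroid R P) (f : R) : p.flip (L.grad p f) = L.differential f := by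
  ext X
  rw [grad, LinearMap.apply_symm_toPerfPair_self]

theorem pairing_grad (L : LieAlgebroid R P) (X : P) (f : R) :
    p X (L.grad p f) = L.anchor X f := by
  rw [← LinearMap.flip_apply, flip_grad, differential_apply]

theorem pairing_grad_flip (Ls : LieAlgebroid R Q) (ξ : Q) (f : R) :
    p (Ls.grad p.flip f) ξ = Ls.anchor ξ f :=
  pairing_grad (p := p.flip) Ls ξ f

theorem pairing_grad_flip' (Ls : LieAlgebroid R Q) (f : R) :
    p (Ls.grad p.flip f) = Ls.differential f := by
  ext ξ
  rw [pairing_grad_flip, differential_apply]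

end LieAlgebroid

/-- The conditions for a Lie bialgebroid in degrees zero and one. -/
structure BialgebroidIdentities (p : P →ₗ[R] Q →ₗ[R] R) [p.IsPerfPair] (L : LieAlgebroid R P)
    (Ls : LieAlgebroid R Q) : Prop where
  anchor_grad : ∀ f g, L.anchor (Ls.grad p.flip f) g + L.anchor (Ls.grad p.flip g) f = 0
  bracket_grad : ∀ X f,
    L.bracket X (Ls.grad p.flip f) = ((Ls.ad (L.grad p f)).dual p.flip).op X
  diff_bracket : ∀ X Y, Ls.totalDiffHom 0 (ofDual (p (L.bracket X Y))) =
    ((L.ad X).dual p).lieTotal (Ls.totalDiffHom 0 (ofDual (p Y))) -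
      ((L.ad Y).dual p).lieTotal (Ls.totalDiffHom 0 (ofDual (p X)))

section Schouten

variable {L : LieAlgebroid R P} {B : Forms R Q →+ Forms R Q →+ Forms R Q}

namespace IsSchoutenBracket

variable (hB : IsSchoutenBracket p L B)

include hB

theorem section_smul (X : P) (f : R) {k : ℕ} (α : Q [⋀^Fin k]→ₗ[R] R) :
    B (ofDual (p X)) (f • single α) =
      L.anchor X f • single α + f • B (ofDual (p X)) (single α) := by
  have h : B (ofDual (p X)) (mulHom (ofFun f) (single α)) =
      mulHom (B (ofDual (p X)) (ofFun f)) (single α) +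
        (-1 : R) ^ ((1 + 1) * 0) • mulHom (ofFun f) (B (ofDual (p X)) (single α)) :=
    hB.leibniz _ _ _
  rw [hB.section_function, mulHom_ofFun, mulHom_ofFun, mulHom_ofFun] at h
  simpa using h

theorem section_exterior (X Y Z : P) : B (ofDual (p X)) (exterior (p Y) (ofDual (p Z))) =
    exterior (p (L.bracket X Y)) (ofDual (p Z)) + exterior (p Y) (ofDual (p (L.bracket X Z))) := by
  have h : B (ofDual (p X)) (mulHom (ofDual (p Y)) (ofDual (p Z))) =
      mulHom (B (ofDual (p X)) (ofDual (p Y))) (ofDual (p Z)) +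
        (-1 : R) ^ ((1 + 1) * 1) • mulHom (ofDual (p Y)) (B (ofDual (p X)) (ofDual (p Z))) :=
    hB.leibniz _ _ _
  rw [hB.section_section, hB.section_section, mulHom_ofDual, mulHom_ofDual, mulHom_ofDual] at h
  simpa using h

/-- Both sides are derivations over `ρ(X)` that extend the bracket of sections. Bivectors suffice,
because the compatibility condition only produces brackets with `d_*` of a section. -/
theorem section_bivector (hF : IsLocallyFramed p n) (X : P) (α : Q [⋀^Fin 2]→ₗ[R] R) :
    B (ofDual (p X)) (single α) = ((L.ad X).dual p).lieTotal (single α) := by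
  refine hF.eq_on_bivectors (B (ofDual (p X))) ((L.ad X).dual p).lieTotal (L.anchor X)
    (fun f α => hB.section_smul X f α)
    (fun f α => DerivativeEndo.lieTotal_smul _ _ _) (fun Y Z => ?_) α
  rw [hB.section_exterior, DerivativeEndo.lieTotal_exterior, DerivativeEndo.dual_transpose,
    DerivativeEndo.lieTotal_ofDual, DerivativeEndo.dual_transpose, add_comm]
  rfl

theorem function_function (f g : R) : B (ofFun f) (ofFun g) = 0 := by
  funext j
  exact hB.degree _ _ j (by omega)

theorem function_section (f : R) (X : P) :
    B (ofFun f) (ofDual (p X)) = -ofFun (L.anchor X f) := by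
  have h : B (ofFun f) (ofDual (p X)) =
      -((-1 : R) ^ ((0 + 1) * (1 + 1)) • B (ofDual (p X)) (ofFun f)) := hB.skew _ _
  rw [hB.section_function] at h
  simpa using h

theorem function_bivector (hF : IsLocallyFramed p n) (f : R) (α : Q [⋀^Fin 2]→ₗ[R] R) :
    B (ofFun f) (single α) = -interior (L.grad p f) (single α) := by
  refine hF.eq_on_bivectors (B (ofFun f)) (-(interior (L.grad p f)).toAddMonoidHom) (fun _ => 0)
    (fun g α => ?_) (fun g α => by simp) (fun Y Z => ?_) α
  · have h : B (ofFun f) (mulHom (ofFun g) (single α)) =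
        mulHom (B (ofFun f) (ofFun g)) (single α) +
          (-1 : R) ^ ((0 + 1) * 0) • mulHom (ofFun g) (B (ofFun f) (single α)) :=
      hB.leibniz _ _ _
    rw [hB.function_function, mulHom_ofFun, mulHom_ofFun] at h
    simpa using h
  · have h : B (ofFun f) (mulHom (ofDual (p Y)) (ofDual (p Z))) =
        mulHom (B (ofFun f) (ofDual (p Y))) (ofDual (p Z)) +
          (-1 : R) ^ ((0 + 1) * 1) • mulHom (ofDual (p Y)) (B (ofFun f) (ofDual (p Z))) :=
      hB.leibniz _ _ _
    rw [hB.function_section, hB.function_section, map_neg, LinearMap.neg_apply, mulHom_ofFun,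
      mulHom_ofDual, mulHom_ofDual] at h
    rw [h]
    simp [interior_exterior, interior_ofDual, L.pairing_grad]
    abel

end IsSchoutenBracket

/-- The derivation property is read off on two functions, on a section and a function, and on two
sections. The brackets with the bivectors `d_*X` that occur are contractions or Lie derivatives, so
the Schouten bracket disappears from everything that follows. -/
theorem IsLieBialgebroid.identities {Ls : LieAlgebroid R Q} (hF : IsLocallyFramed p n)
    (h : IsLieBialgebroid p L Ls) : BialgebroidIdentities p L Ls := by
  obtain ⟨B, hB, hd⟩ := h
  have hX : ∀ X : P, ∃ α : Q [⋀^Fin 2]→ₗ[R] R, Ls.totalDiffHom 0 (ofDual (p X)) = single α :=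
    fun X => ⟨_, Ls.totalDiffHom_single 0 _⟩
  have hf : ∀ f : R, Ls.totalDiffHom 0 (ofFun f) = ofDual (p (Ls.grad p.flip f)) := fun f => by
    rw [Ls.totalDiffHom_ofFun, Ls.pairing_grad_flip', smul_zero, add_zero]
  refine ⟨fun f g => ?_, fun X f => ?_, fun X Y => ?_⟩
  · have h1 : Ls.totalDiffHom 0 (B (ofFun f) (ofFun g)) =
        B (Ls.totalDiffHom 0 (ofFun f)) (ofFun g) +
          (-1 : R) ^ (0 + 1) • B (ofFun f) (Ls.totalDiffHom 0 (ofFun g)) := hd _ _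
    rw [hB.function_function, hf, hf, hB.section_function, hB.function_section, map_zero] at h1
    have h2 := congrArg (fun z => z 0 Fin.elim0) h1
    simpa using h2.symm
  · have h1 : Ls.totalDiffHom 0 (B (ofDual (p X)) (ofFun f)) =
        B (Ls.totalDiffHom 0 (ofDual (p X))) (ofFun f) +
          (-1 : R) ^ (1 + 1) • B (ofDual (p X)) (Ls.totalDiffHom 0 (ofFun f)) := hd _ _
    obtain ⟨α, hα⟩ := hX X
    have h2 : B (single α) (ofFun f) =
        -((-1 : R) ^ ((2 + 1) * (0 + 1)) • B (ofFun f) (single α)) := hB.skew _ _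
    -- By Cartan's formula `ι_{df} d_*X = L_{df} X - d_*(ρ(X) f)`. The last term also stands on the
    -- other side of the compatibility and cancels, leaving `[X, d_*f] = L_{df} X`.
    have h3 := Ls.interior_totalDiffHom 0 (L.grad p f) (ofDual (p X))
    rw [interior_ofDual, DerivativeEndo.lieTotal_ofDual, L.pairing_grad, LinearMap.zero_apply,
      zero_smul, add_zero] at h3
    rw [hα, h2, hB.function_bivector hF, ← hα, h3, hB.section_function, hf f,
      hB.section_section] at h1
    have h4 : ofDual (p (L.bracket X (Ls.grad p.flip f))) =
        ofDual ((Ls.ad (L.grad p f)).transpose (p X)) := by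
      have : (-1 : R) ^ ((2 + 1) * (0 + 1)) = -1 := by norm_num
      rw [this, Forms.neg_one_smul] at h1
      simp only [neg_sub, even_two, Even.neg_pow, one_pow, one_smul, Nat.reduceAdd] at h1
      rw [← sub_eq_zero] at h1 ⊢
      rw [← neg_eq_zero, ← h1]
      abel
    have h5 := ofDual_injective h4
    have h6 := DerivativeEndo.transpose_flip (p := p.flip) (Ls.ad (L.grad p f)) X
    rw [LinearMap.flip_flip] at h6
    exact (LinearMap.IsPerfPair.bijective_left p).injective (h5.trans h6)
  · have h1 : Ls.totalDiffHom 0 (B (ofDual (p X)) (ofDual (p Y))) =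
        B (Ls.totalDiffHom 0 (ofDual (p X))) (ofDual (p Y)) +
          (-1 : R) ^ (1 + 1) • B (ofDual (p X)) (Ls.totalDiffHom 0 (ofDual (p Y))) := hd _ _
    obtain ⟨α, hα⟩ := hX X
    obtain ⟨β, hβ⟩ := hX Y
    have h2 : B (single α) (ofDual (p Y)) =
        -((-1 : R) ^ ((2 + 1) * (1 + 1)) • B (ofDual (p Y)) (single α)) := hB.skew _ _
    rw [hB.section_section, hα, hβ, h2, hB.section_bivector hF, hB.section_bivector hF] at h1
    rw [h1, hα, hβ]
    have : (-1 : R) ^ ((2 + 1) * (1 + 1)) = 1 := by norm_num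
    rw [this]
    simp
    abel

end Schouten
end Bialgebroid

/-! ### Divergences, and exterior multiplication by `d_*X`. -/

section Laplacian

variable {R P Q : Type*} [CommRing R] [Algebra ℝ R]
  [AddCommGroup P] [Module R P] [AddCommGroup Q] [Module R Q]

open Forms

section Algebroid

variable {N : Type*} [AddCommGroup N] [Module R N] {n : ℕ} {Ω : N [⋀^Fin n]→ₗ[R] R}

/-- The divergence of an operator with respect to a volume form. -/
def DerivativeEndo.div (T : DerivativeEndo R N) (hΩ : IsVolume Ω) : R := hΩ.coeff (T.lie Ω)

theorem DerivativeEndo.lie_eq_div_smul (T : DerivativeEndo R N) (hΩ : IsVolume Ω) :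
    T.lie Ω = T.div hΩ • Ω := (hΩ.coeff_smul _).symm

theorem lieTotal_single (T : DerivativeEndo R N) {k : ℕ} (α : N [⋀^Fin k]→ₗ[R] R) :
    T.lieTotal (single α) = single (T.lie α) := by
  funext j
  rw [DerivativeEndo.lieTotal_apply]
  by_cases hj : j = k
  · subst hj
    simp only [single_apply_self]
  · simp only [single, Pi.single_eq_of_ne hj]
    ext v
    simp [DerivativeEndo.lie_apply]

theorem smul_single (f : R) {k : ℕ} (α : N [⋀^Fin k]→ₗ[R] R) :
    f • (single α : Forms R N) = single (f • α) := by
  funext j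
  by_cases hj : j = k
  · subst hj
    simp only [single_apply_self, Pi.smul_apply]
  · simp only [single, Pi.smul_apply, Pi.single_eq_of_ne hj, smul_zero]

theorem DerivativeEndo.lieTotal_volume (T : DerivativeEndo R N) (hΩ : IsVolume Ω) :
    T.lieTotal (single Ω) = T.div hΩ • single Ω := by
  rw [lieTotal_single, T.lie_eq_div_smul hΩ, smul_single]

theorem IsVolume.smul_single_injective (hΩ : IsVolume Ω) {r s : R}
    (h : r • (single Ω : Forms R N) = s • single Ω) : r = s := by
  have := congrArg (fun z => z n) h
  simp only [Pi.smul_apply, single_apply_self] at this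
  exact hΩ.smul_injective this

variable (L : LieAlgebroid R N)

theorem LieAlgebroid.lieTotal_ad (x : N) (u : Forms R N) :
    (L.ad x).lieTotal u = interior x (L.totalDiffHom 0 u) + L.totalDiffHom 0 (interior x u) := by
  rw [L.interior_totalDiffHom]
  simp

theorem LieAlgebroid.lieTotal_ad_smul (f : R) (x : N) (u : Forms R N) :
    (L.ad (f • x)).lieTotal u =
      f • (L.ad x).lieTotal u + exterior (L.differential f) (interior x u) := by
  simp only [L.lieTotal_ad, map_smul, LinearMap.smul_apply, L.totalDiffHom_smul]
  module

theorem LieAlgebroid.lieTotal_ad_add (x y : N) (u : Forms R N) :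
    (L.ad (x + y)).lieTotal u = (L.ad x).lieTotal u + (L.ad y).lieTotal u := by
  simp only [L.lieTotal_ad, map_add, LinearMap.add_apply]
  abel

theorem exterior_volume (hΩ : IsVolume Ω) (θ : Module.Dual R N) :
    exterior θ (single Ω) = 0 := by
  funext k
  rcases lt_or_ge n k with h | h
  · rw [hΩ.vanish h (exterior θ (single Ω) k)]
    rfl
  · rcases k with _ | k
    · simp
    · ext v
      rw [exterior_apply_succ]
      simp [single, Pi.single_eq_of_ne (show k ≠ n by omega)]

variable (hΩ : IsVolume Ω)

/-- `L_{fx}` exceeds `f L_x` by `df ∧ ι_x`. Contracting `df ∧ Ω = 0` with `x` shows that `df ∧ ι_x Ω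
= (ρ(x) f) Ω`. -/
theorem LieAlgebroid.div_smul (f : R) (x : N) :
    (L.ad (f • x)).div hΩ = f * (L.ad x).div hΩ + L.anchor x f := by
  apply hΩ.smul_single_injective
  have h1 := interior_exterior x (L.differential f) (single Ω)
  rw [exterior_volume hΩ, map_zero] at h1
  have h2 := sub_eq_zero.1 h1.symm
  rw [← DerivativeEndo.lieTotal_volume, L.lieTotal_ad_smul, DerivativeEndo.lieTotal_volume _ hΩ,
    ← h2, L.differential_apply]
  module

theorem LieAlgebroid.div_add (x y : N) :
    (L.ad (x + y)).div hΩ = (L.ad x).div hΩ + (L.ad y).div hΩ := by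
  apply hΩ.smul_single_injective
  rw [← DerivativeEndo.lieTotal_volume, L.lieTotal_ad_add, DerivativeEndo.lieTotal_volume _ hΩ,
    DerivativeEndo.lieTotal_volume _ hΩ]
  module

theorem LieAlgebroid.div_bracket (x y : N) : (L.ad (L.bracket x y)).div hΩ =
    L.anchor x ((L.ad y).div hΩ) - L.anchor y ((L.ad x).div hΩ) := by
  apply hΩ.smul_single_injective
  rw [← DerivativeEndo.lieTotal_volume, L.lieTotal_ad_bracket,
    DerivativeEndo.lieTotal_volume _ hΩ, DerivativeEndo.lieTotal_volume _ hΩ,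
    DerivativeEndo.lieTotal_smul, DerivativeEndo.lieTotal_smul,
    DerivativeEndo.lieTotal_volume _ hΩ, DerivativeEndo.lieTotal_volume _ hΩ]
  simp only [LieAlgebroid.ad]
  module

theorem LieAlgebroid.totalDiffHom_degree (θ : Module.Dual R N) (u : Forms R N) :
    L.totalDiffHom θ (degree u) = degree (L.totalDiffHom θ u) - L.totalDiffHom θ u := by
  funext k
  rcases k with _ | k
  · simp [degree_apply]
  · have h1 := congrArg (fun z => z (k + 1)) (L.totalDiffHom_smul θ (k : R) u)
    have h2 : L.differential (k : R) = 0 := by ext x; simp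
    rw [h2, map_zero, LinearMap.zero_apply, add_zero] at h1
    have h3 : L.totalDiffHom θ (degree u) (k + 1) = L.totalDiffHom θ ((k : R) • u) (k + 1) := rfl
    rw [h3, h1]
    ext v
    simp [degree_apply]
    ring

theorem exterior_degree (θ : Module.Dual R N) (u : Forms R N) :
    exterior θ (degree u) = degree (exterior θ u) - exterior θ u := by
  ext k v
  rcases k with _ | k
  · simp [degree_apply]
  · simp only [Pi.sub_apply, AlternatingMap.sub_apply, degree_apply,
      AlternatingMap.smul_apply, exterior_apply_succ, smul_eq_mul]
    rw [Finset.mul_sum, ← Finset.sum_sub_distrib]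
    refine Finset.sum_congr rfl fun i _ => ?_
    push_cast
    ring

end Algebroid

section Pair

variable {p : P →ₗ[R] Q →ₗ[R] R} {n : ℕ} {Ω : P [⋀^Fin n]→ₗ[R] R} {V : Q [⋀^Fin n]→ₗ[R] R}

theorem sharpTotal_one (hΩ : IsVolume Ω) (hd : AreDual p Ω V) :
    sharpTotal p hΩ (ofFun 1) = single V := by
  funext l
  by_cases h : l = n
  · subst h
    ext η
    rw [sharpTotal_apply_top hΩ hd, single_apply_self]
    simp
  · rcases lt_or_ge n l with h' | h'
    · rw [sharpTotal_apply_of_lt hΩ h']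
      simp [single, Pi.single_eq_of_ne h]
    · obtain ⟨k, hk⟩ := Nat.exists_eq_add_of_lt (lt_of_le_of_ne h' h)
      have h1 : (k + 1) + l = n := by omega
      have h3 := congrArg (fun z => z l) ((sharpTotal p hΩ).map_zero)
      simp only [sharpTotal_apply hΩ h1] at h3 ⊢
      rw [ofFun_apply_succ]
      simp only [single, Pi.single_eq_of_ne h]
      exact h3

variable [p.IsPerfPair]

/-- `V = V^♯ 1` and the symbol kills `1`, so only the variation of `V^♯` remains. -/
theorem DerivativeEndo.div_dual (T : DerivativeEndo R P) (hΩ : IsVolume Ω) (hV : IsVolume V)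
    (hd : AreDual p Ω V) : (T.dual p).div hV = -T.div hΩ := by
  apply hV.smul_single_injective
  rw [← DerivativeEndo.lieTotal_volume, ← sharpTotal_one hΩ hd,
    T.lieTotal_sharpTotal hΩ (T.lie_eq_div_smul hΩ), T.lieTotal_ofFun, T.symbol.map_one_eq_zero]
  have : (ofFun 0 : Forms R P) = 0 := by
    rw [← zero_mul (0 : R), ← ofFun_smul]
    ext k v
    simp
  rw [this, map_zero]
  module

theorem boundary_degree (hΩ : IsVolume Ω) (hV : IsVolume V)
    (hd : AreDual p Ω V) (L : LieAlgebroid R P) (θ : Module.Dual R P) (w : Forms R Q) :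
    boundary hΩ hV hd L θ (degree w) =
      degree (boundary hΩ hV hd L θ w) + boundary hΩ hV hd L θ w := by
  funext l
  have h2 : p.flip 0 = L.differential ((l + 1 : ℕ) : R) := by
    ext x; simp
  have h1 := congrArg (fun z => z l)
    (boundary_smul hΩ hV hd L θ (f := ((l + 1 : ℕ) : R)) (ξ := 0) h2 w)
  rw [map_zero, LinearMap.zero_apply, add_zero] at h1
  have h3 : boundary hΩ hV hd L θ (degree w) l =
      boundary hΩ hV hd L θ (((l + 1 : ℕ) : R) • w) l := by
    rw [boundary_apply, boundary_apply]
    rfl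
  rw [h3, h1]
  ext v
  simp [degree_apply]
  ring

variable (p) in
/-- The one-form `ι_ξ d_* X`. -/
def contractDiff (Ls : LieAlgebroid R Q) (X : P) (ξ : Q) : Module.Dual R Q :=
  (Ls.ad ξ).transpose (p X) - Ls.differential (p X ξ)

theorem contractDiff_apply (Ls : LieAlgebroid R Q) (X : P) (ξ η : Q) :
    contractDiff p Ls X ξ η =
      Ls.anchor ξ (p X η) - p X (Ls.bracket ξ η) - Ls.anchor η (p X ξ) := rfl

theorem contractDiff_swap (Ls : LieAlgebroid R Q) (X : P) (ξ η : Q) :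
    contractDiff p Ls X ξ η = -contractDiff p Ls X η ξ := by
  rw [contractDiff_apply, contractDiff_apply, Ls.bracket_skew ξ η, map_neg]
  ring

theorem ofDual_add {N : Type*} [AddCommGroup N] [Module R N] (θ η : Module.Dual R N) :
    (ofDual (θ + η) : Forms R N) = ofDual θ + ofDual η := by
  have h : ∀ θ : Module.Dual R N, (ofDual θ : Forms R N) = exterior θ (ofFun 1) := fun θ => by
    rw [exterior_ofFun, one_smul]
  rw [h, h, h, map_add, LinearMap.add_apply]

theorem ofDual_sub {N : Type*} [AddCommGroup N] [Module R N] (θ η : Module.Dual R N) :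
    (ofDual (θ - η) : Forms R N) = ofDual θ - ofDual η := by
  rw [eq_sub_iff_add_eq, ← ofDual_add, sub_add_cancel]

theorem interior_totalDiffHom_ofDual (Ls : LieAlgebroid R Q) (X : P) (ξ : Q) :
    interior ξ (Ls.totalDiffHom 0 (ofDual (p X))) = ofDual (contractDiff p Ls X ξ) := by
  rw [Ls.interior_totalDiffHom, interior_ofDual, DerivativeEndo.lieTotal_ofDual,
    Ls.totalDiffHom_ofFun, contractDiff, ofDual_sub, LinearMap.zero_apply, zero_smul, smul_zero,
    add_zero, add_zero]

variable (p) in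
/-- The exterior product with the bivector `d_* X`. -/
def exteriorDiff (Ls : LieAlgebroid R Q) (X : P) : Forms R Q →+ Forms R Q :=
  (Ls.totalDiffHom 0).comp (exterior (p X)).toAddMonoidHom +
    (exterior (p X)).toAddMonoidHom.comp (Ls.totalDiffHom 0)

theorem exteriorDiff_apply (Ls : LieAlgebroid R Q) (X : P) (u : Forms R Q) :
    exteriorDiff p Ls X u =
      Ls.totalDiffHom 0 (exterior (p X) u) + exterior (p X) (Ls.totalDiffHom 0 u) := rfl

/-- The anticommutator of `d_*` and `e(X)` has no derivative terms left and behaves under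
contraction as multiplication by a bivector. Its linearity over functions and its commutation with
exterior products follow from this viewpoint. -/
theorem interior_exteriorDiff (Ls : LieAlgebroid R Q) (X : P) (ξ : Q) (u : Forms R Q) :
    interior ξ (exteriorDiff p Ls X u) =
      exteriorDiff p Ls X (interior ξ u) + exterior (contractDiff p Ls X ξ) u := by
  have h : (Ls.ad ξ).symbol = Ls.anchor ξ := rfl
  simp only [exteriorDiff_apply, map_add, Ls.interior_totalDiffHom, interior_exterior,
    map_sub, DerivativeEndo.lieTotal_exterior, Ls.totalDiffHom_smul, contractDiff,
    LinearMap.sub_apply, LinearMap.zero_apply]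
  simp only [map_smul]
  module

theorem exteriorDiff_apply_zero (Ls : LieAlgebroid R Q) (X : P) (u : Forms R Q) :
    exteriorDiff p Ls X u 0 = 0 := by
  simp [exteriorDiff_apply]

theorem exteriorDiff_smul (Ls : LieAlgebroid R Q) (X : P) (f : R) (u : Forms R Q) :
    exteriorDiff p Ls X (f • u) = f • exteriorDiff p Ls X u := by
  simp only [exteriorDiff_apply, map_smul, Ls.totalDiffHom_smul, map_add,
    exterior_exterior (p X) (Ls.differential f)]
  module

theorem exteriorDiff_exterior (Ls : LieAlgebroid R Q) (X : P) (θ : Module.Dual R Q)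
    (u : Forms R Q) :
    exteriorDiff p Ls X (exterior θ u) = exterior θ (exteriorDiff p Ls X u) := by
  refine eq_of_interior (fun u => exteriorDiff p Ls X (exterior θ u))
    (fun u => exterior θ (exteriorDiff p Ls X u)) (fun u => ?_) (fun ξ u => ⟨-interior ξ u, ?_⟩) u
  · simp [exteriorDiff_apply_zero]
  · simp only [interior_exteriorDiff, interior_exterior, map_sub, map_neg, map_add,
      exteriorDiff_smul, exterior_exterior θ (contractDiff p Ls X ξ)]
    abel

theorem totalDiffHom_exterior (Ls : LieAlgebroid R Q) (θ : Module.Dual R Q) (X : P)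
    (u : Forms R Q) : Ls.totalDiffHom θ (exterior (p X) u) =
      exteriorDiff p Ls X u - exterior (p X) (Ls.totalDiffHom θ u) := by
  rw [Ls.totalDiffHom_eq θ, Ls.totalDiffHom_eq θ u, exteriorDiff_apply, map_add,
    exterior_exterior θ]
  abel

variable {L : LieAlgebroid R P} {Ls : LieAlgebroid R Q}

namespace BialgebroidIdentities

variable (hB : BialgebroidIdentities p L Ls)

include hB

theorem contractDiff_bracket (X Y : P) (ξ : Q) :
    contractDiff p Ls (L.bracket X Y) ξ =
      (((L.ad X).dual p).transpose (contractDiff p Ls Y ξ) -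
        contractDiff p Ls Y (((L.ad X).dual p).op ξ)) -
      (((L.ad Y).dual p).transpose (contractDiff p Ls X ξ) -
        contractDiff p Ls X (((L.ad Y).dual p).op ξ)) := by
  have h := congrArg (Forms.interior ξ) (hB.diff_bracket X Y)
  simp only [map_sub, DerivativeEndo.interior_lieTotal, interior_totalDiffHom_ofDual,
    DerivativeEndo.lieTotal_ofDual, ← ofDual_sub] at h
  exact ofDual_injective h

/-- The compatibility on two sections, transferred from bivectors to the operators of multiplication
by them: contraction reduces it to `contractDiff_bracket`. -/
theorem exteriorDiff_bracket (X Y : P) (u : Forms R Q) :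
    exteriorDiff p Ls (L.bracket X Y) u =
      (((L.ad X).dual p).lieTotal (exteriorDiff p Ls Y u) -
        exteriorDiff p Ls Y (((L.ad X).dual p).lieTotal u)) -
      (((L.ad Y).dual p).lieTotal (exteriorDiff p Ls X u) -
        exteriorDiff p Ls X (((L.ad Y).dual p).lieTotal u)) := by
  refine eq_of_interior (fun u => exteriorDiff p Ls (L.bracket X Y) u)
    (fun u => (((L.ad X).dual p).lieTotal (exteriorDiff p Ls Y u) -
        exteriorDiff p Ls Y (((L.ad X).dual p).lieTotal u)) -
      (((L.ad Y).dual p).lieTotal (exteriorDiff p Ls X u) -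
        exteriorDiff p Ls X (((L.ad Y).dual p).lieTotal u)))
    (fun u => ?_) (fun ξ u => ⟨interior ξ u, ?_⟩) u
  · ext v
    simp [exteriorDiff_apply_zero, DerivativeEndo.lieTotal_apply, DerivativeEndo.lie_apply]
  · simp only [interior_exteriorDiff, DerivativeEndo.interior_lieTotal, map_sub, map_add,
      hB.contractDiff_bracket, DerivativeEndo.lieTotal_exterior, LinearMap.sub_apply]
    abel

theorem anchor_grad_eq (f : R) : Ls.anchor (L.grad p f) = -L.anchor (Ls.grad p.flip f) := by
  ext g
  have h := hB.anchor_grad f g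
  rw [← Ls.pairing_grad_flip (p := p), L.pairing_grad]
  rw [Derivation.neg_apply]
  linear_combination h

theorem ad_grad_op (f : R) (X : P) :
    ((Ls.ad (L.grad p f)).dual p.flip).op X = -(L.ad (Ls.grad p.flip f)).op X := by
  rw [← hB.bracket_grad, L.bracket_skew]
  rfl

/-- In a bialgebroid `d_*f` and `df` act oppositely, on functions by `anchor_grad` and on sections
by `bracket_grad`. This removes the first order part of the commutator of the Laplacian with `f`. -/
theorem lieTotal_ad_grad (f : R) (u : Forms R Q) :
    ((L.ad (Ls.grad p.flip f)).dual p).lieTotal u = -(Ls.ad (L.grad p f)).lieTotal u := by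
  refine DerivativeEndo.lieTotal_eq_neg _ _ ?_ (fun ξ => ?_) u
  · change L.anchor _ = -Ls.anchor _
    rw [hB.anchor_grad_eq, neg_neg]
  · apply (LinearMap.IsPerfPair.bijective_right p).injective
    ext X
    have h1 := DerivativeEndo.pairing_dual_op (p := p) (L.ad (Ls.grad p.flip f)) X ξ
    have h2 := DerivativeEndo.pairing_dual_op (p := p.flip) (Ls.ad (L.grad p f)) ξ X
    rw [hB.ad_grad_op, map_neg] at h2
    simp only [LinearMap.flip_apply, LinearMap.neg_apply, map_neg] at h1 h2 ⊢
    have h3 : (Ls.ad (L.grad p f)).symbol (p X ξ) =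
        -(L.ad (Ls.grad p.flip f)).symbol (p X ξ) := by
      change Ls.anchor _ _ = -(L.anchor _ _)
      rw [hB.anchor_grad_eq]
      rfl
    rw [h3] at h2
    linear_combination h1 + h2

/-- Two signs cancel: one from the opposite actions of `d_*f` and `df`, the other from passing
between `Ω` and its dual `V`. -/
theorem div_ad_grad (hΩ : IsVolume Ω) (hV : IsVolume V) (hd : AreDual p Ω V) (f : R) :
    (L.ad (Ls.grad p.flip f)).div hΩ = (Ls.ad (L.grad p f)).div hV := by
  have h1 := DerivativeEndo.div_dual (p := p.flip) (Ls.ad (L.grad p f)) hV hΩ hd.flip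
  rw [← neg_eq_iff_eq_neg] at h1
  rw [← h1]
  apply hΩ.smul_single_injective
  have h2 := DerivativeEndo.lieTotal_eq_neg (L.ad (Ls.grad p.flip f))
    ((Ls.ad (L.grad p f)).dual p.flip) (hB.anchor_grad_eq f) (hB.ad_grad_op f) (single Ω)
  rw [DerivativeEndo.lieTotal_volume _ hΩ, DerivativeEndo.lieTotal_volume _ hΩ] at h2
  have h3 : ∀ r : R, -(r • (single Ω : Forms R P)) = (-r) • single Ω := fun r => by module
  rw [h3] at h2
  rw [hΩ.smul_single_injective h2, neg_neg]

end BialgebroidIdentities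

end Pair
end Laplacian

/-! ### The Laplacian and the reduction to its commutators on `1`. -/

section Laplacian

variable {R P Q : Type*} [CommRing R] [Algebra ℝ R]
  [AddCommGroup P] [Module R P] [AddCommGroup Q] [Module R Q]

open Forms

variable {p : P →ₗ[R] Q →ₗ[R] R} {n : ℕ} {Ω : P [⋀^Fin n]→ₗ[R] R} {V : Q [⋀^Fin n]→ₗ[R] R}
  [p.IsPerfPair]

/-- By `hm`, `T` raises degrees by `m`. Writing the number operator as `∑ eᵢ ∧ ι_{eⁱ}`, up to the
cut-off, and moving `T` past `eᵢ` expresses `(k + 1 - m) T u` in degree `k + 1` through values of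
`T` in degree `k`. The factor is invertible as soon as `k + 1 > m`. -/
theorem IsLocallyFramed.eq_zero_of_exterior (hF : IsLocallyFramed p n)
    (T : Forms R Q →+ Forms R Q) (hT : ∀ (f : R) u, T (f • u) = f • T u) (s : R)
    (hs : ∀ Y u, T (exterior (p Y) u) = s • exterior (p Y) (T u)) (m : ℕ)
    (hm : ∀ u, T (degree u) = degree (T u) - (m : R) • T u) (h0 : ∀ u, ∀ k ≤ m, T u k = 0)
    (u : Forms R Q) : T u = 0 := by
  have key : ∀ k u, T u k = 0 := by
    intro k
    induction k with
    | zero => exact fun u => h0 u 0 (Nat.zero_le m)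
    | succ k ih =>
      intro u
      rcases le_or_gt (k + 1) m with hk | hk
      · exact h0 u _ hk
      · obtain ⟨r, hr⟩ := Nat.exists_eq_add_of_lt hk
        ext v
        refine hF _ fun F => ?_
        have h1 : ∑ i, T (exterior (p (F.e i)) (interior (F.e' i) u)) = F.χ • T (degree u) := by
          rw [← hT, ← F.sum_exterior_interior, map_sum]
        have hc : ∀ i, exterior (p (F.e i)) (T (interior (F.e' i) u)) (k + 1) = 0 := fun i => by
          ext v
          rw [exterior_apply_succ]
          simp [ih]
        have h2 := congrArg (fun z : Forms R Q => z (k + 1)) h1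
        simp only [hs, hm, Finset.sum_apply, Pi.smul_apply, Pi.sub_apply, degree_apply, hc,
          smul_zero, Finset.sum_const_zero, hr] at h2
        have h2 := congrArg (fun z => z v) h2
        simp only [AlternatingMap.smul_apply, AlternatingMap.sub_apply, AlternatingMap.zero_apply,
          smul_eq_mul] at h2
        have h3 : ((r + 1 : ℕ) : R) * (F.χ * T u (k + 1) v) = ((r + 1 : ℕ) : R) * 0 := by
          rw [mul_zero, h2]
          push_cast
          ring
        have h4 := nat_mul_cancel (Nat.succ_ne_zero r) h3
        exact F.mem_of_mul_mem (h4 ▸ F.ideal.zero_mem)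
  funext k
  exact key k u

/-- A form is the sum of its component of degree zero and a form in the image of the degree. -/
theorem Forms.exists_eq_ofFun_add_degree {N : Type*} [AddCommGroup N] [Module R N]
    (u : Forms R N) : ∃ u' : Forms R N, u = ofFun (u 0 Fin.elim0) + degree u' := by
  refine ⟨fun k => algebraMap ℝ R (1 / k) • u k, ?_⟩
  ext k v
  rcases k with _ | k
  · have : v = Fin.elim0 := Subsingleton.elim _ _
    subst this
    simp [degree_apply]
  · have h : ((k + 1 : ℕ) : R) * algebraMap ℝ R (1 / ((k + 1 : ℕ) : ℝ)) = 1 := by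
      rw [← map_natCast (algebraMap ℝ R), ← map_mul, mul_one_div_cancel, map_one]
      positivity
    simp only [Pi.add_apply, ofFun_apply_succ, zero_add, degree_apply, AlternatingMap.smul_apply,
      smul_eq_mul]
    rw [← mul_assoc, h, one_mul]

variable (hΩ : IsVolume Ω) (hV : IsVolume V) (hd : AreDual p Ω V) (L : LieAlgebroid R P)
  (Ls : LieAlgebroid R Q) (θ : Module.Dual R P) (θs : Module.Dual R Q)

/-- The Laplacian `d̆_* ∂̆ + ∂̆ d̆_*`. -/
def laplacian : Forms R Q →+ Forms R Q :=
  (Ls.totalDiffHom θs).comp (boundary hΩ hV hd L θ) +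
    (boundary hΩ hV hd L θ).comp (Ls.totalDiffHom θs)

theorem laplacian_apply (u : Forms R Q) : laplacian hΩ hV hd L Ls θ θs u =
    Ls.totalDiffHom θs (boundary hΩ hV hd L θ u) +
      boundary hΩ hV hd L θ (Ls.totalDiffHom θs u) := rfl

/-- The divergence with coefficients in a line bundle with connection form `θ`. -/
def twistedDiv (X : P) : R := (L.ad X).div hΩ + θ X

variable {θ θs L Ls}

theorem boundary_exterior (X : P) (w : Forms R Q) :
    boundary hΩ hV hd L θ (exterior (p X) w) = ((L.ad X).dual p).lieTotal w +
      twistedDiv hΩ L θ X • w - exterior (p X) (boundary hΩ hV hd L θ w) :=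
  exterior_boundary_add hΩ hV hd L θ ((L.ad X).lie_eq_div_smul hΩ) w

theorem boundary_ofDual (X : P) : boundary hΩ hV hd L θ (ofDual (p X)) =
    ofFun (twistedDiv hΩ L θ X) := by
  have h : (ofDual (p X) : Forms R Q) = exterior (p X) (ofFun 1) := by
    rw [exterior_ofFun, one_smul]
  rw [h, boundary_exterior, boundary_ofFun, DerivativeEndo.lieTotal_ofFun,
    Derivation.map_one_eq_zero, ofFun_smul, map_zero, sub_zero, mul_one]
  ext k v
  rcases k with _ | k <;> simp

theorem twistedDiv_smul (f : R) (X : P) :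
    twistedDiv hΩ L θ (f • X) = f * twistedDiv hΩ L θ X + L.anchor X f := by
  rw [twistedDiv, twistedDiv, L.div_smul, map_smul, smul_eq_mul]
  ring

theorem twistedDiv_add (X Y : P) :
    twistedDiv hΩ L θ (X + Y) = twistedDiv hΩ L θ X + twistedDiv hΩ L θ Y := by
  rw [twistedDiv, twistedDiv, twistedDiv, L.div_add, map_add]
  ring

theorem laplacian_degree (u : Forms R Q) : laplacian hΩ hV hd L Ls θ θs (degree u) =
    degree (laplacian hΩ hV hd L Ls θ θs u) := by
  simp only [laplacian_apply, map_add, map_sub, boundary_degree, Ls.totalDiffHom_degree]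
  abel

theorem laplacian_one {z : P} (hz : p z = θs) : laplacian hΩ hV hd L Ls θ θs (ofFun 1) =
    ofFun (twistedDiv hΩ L θ z) := by
  have h : θs = Ls.differential 1 + (1 : R) • θs := by
    ext ξ
    simp
  rw [laplacian_apply, boundary_ofFun, map_zero, zero_add, Ls.totalDiffHom_ofFun, ← h, ← hz,
    boundary_ofDual]

/-- The extra terms are the anticommutator of `d̆_*` with contraction by `df`, namely `L_{df} +
θs(df)`, and that of `∂̆` with multiplication by `d_*f`, namely `L_{d_*f}` plus a twisted
divergence. The Lie derivatives cancel in a bialgebroid, and `hθ` cancels the scalars. -/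
theorem laplacian_smul (hB : BialgebroidIdentities p L Ls)
    (hθ : ∀ f, twistedDiv hΩ L θ (Ls.grad p.flip f) + θs (L.grad p f) = 0) (f : R)
    (u : Forms R Q) :
    laplacian hΩ hV hd L Ls θ θs (f • u) = f • laplacian hΩ hV hd L Ls θ θs u := by
  have h1 := Ls.interior_totalDiffHom θs (L.grad p f) u
  have h2 := boundary_exterior hΩ hV hd (L := L) (θ := θ) (Ls.grad p.flip f) u
  rw [hB.lieTotal_ad_grad, Ls.pairing_grad_flip'] at h2
  have h3 : twistedDiv hΩ L θ (Ls.grad p.flip f) = -θs (L.grad p f) :=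
    eq_neg_of_add_eq_zero_left (hθ f)
  simp only [laplacian_apply, boundary_smul hΩ hV hd L θ (L.flip_grad f), Ls.totalDiffHom_smul,
    map_add, h1, h2, h3]
  module

variable (hB : BialgebroidIdentities p L Ls)

variable (p) in
/-- The commutator of the Laplacian with the exterior product by a section. -/
def laplacianCommutator (hΩ : IsVolume Ω) (hV : IsVolume V) (hd : AreDual p Ω V)
    (L : LieAlgebroid R P) (Ls : LieAlgebroid R Q) (θ : Module.Dual R P) (θs : Module.Dual R Q)
    (X : P) : Forms R Q →+ Forms R Q :=
  (laplacian hΩ hV hd L Ls θ θs).comp (exterior (p X)).toAddMonoidHom -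
    (exterior (p X)).toAddMonoidHom.comp (laplacian hΩ hV hd L Ls θ θs)

theorem laplacianCommutator_apply (X : P) (u : Forms R Q) :
    laplacianCommutator p hΩ hV hd L Ls θ θs X u =
      laplacian hΩ hV hd L Ls θ θs (exterior (p X) u) -
        exterior (p X) (laplacian hΩ hV hd L Ls θ θs u) := rfl

theorem laplacianCommutator_eq (X : P) (u : Forms R Q) :
    laplacianCommutator p hΩ hV hd L Ls θ θs X u =
      (Ls.totalDiffHom θs (((L.ad X).dual p).lieTotal u + twistedDiv hΩ L θ X • u) -
        (((L.ad X).dual p).lieTotal (Ls.totalDiffHom θs u) +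
          twistedDiv hΩ L θ X • Ls.totalDiffHom θs u)) +
      (boundary hΩ hV hd L θ (exteriorDiff p Ls X u) -
        exteriorDiff p Ls X (boundary hΩ hV hd L θ u)) := by
  simp only [laplacianCommutator_apply, laplacian_apply, boundary_exterior,
    totalDiffHom_exterior, map_add, map_sub]
  abel

include hB in
-- By the graded Jacobi identity, the anticommutator with `e(Y)` is multiplication by `d_*[X,Y]`,
-- minus the commutator of `L_X` with multiplication by `d_*Y`, plus the one with `X` and `Y`
-- exchanged. This is zero by `exteriorDiff_bracket`.
theorem laplacianCommutator_exterior (X Y : P) (u : Forms R Q) :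
    laplacianCommutator p hΩ hV hd L Ls θ θs X (exterior (p Y) u) =
      -exterior (p Y) (laplacianCommutator p hΩ hV hd L Ls θ θs X u) := by
  have h := hB.exteriorDiff_bracket X Y u
  have h2 : ((L.ad X).dual p).transpose (p Y) = p (L.bracket X Y) :=
    DerivativeEndo.dual_transpose _ _
  simp only [laplacianCommutator_eq, exteriorDiff_exterior, boundary_exterior,
    totalDiffHom_exterior, map_add, map_sub, DerivativeEndo.lieTotal_exterior, h2, h,
    Ls.totalDiffHom_smul, exteriorDiff_smul, map_smul, smul_sub,
    exterior_exterior (p Y) (Ls.differential _)]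
  module

theorem laplacian_apply_zero (u : Forms R Q) (hu : u 0 = 0) :
    laplacian hΩ hV hd L Ls θ θs u 0 = 0 := by
  obtain ⟨u', hu'⟩ := u.exists_eq_ofFun_add_degree
  have h0 : (ofFun (u 0 Fin.elim0) : Forms R Q) = 0 := by
    rw [hu]
    ext k v
    rcases k with _ | k <;> simp
  rw [hu', h0, zero_add, laplacian_degree, degree_apply, Nat.cast_zero, zero_smul]

theorem laplacianCommutator_degree (X : P) (u : Forms R Q) :
    laplacianCommutator p hΩ hV hd L Ls θ θs X (degree u) =
      degree (laplacianCommutator p hΩ hV hd L Ls θ θs X u) -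
        laplacianCommutator p hΩ hV hd L Ls θ θs X u := by
  simp only [laplacianCommutator_apply, laplacian_degree, exterior_degree, map_sub]
  abel

/-- The Laplacian is multiplication by a function if its commutators with sections vanish on `1`. -/
theorem laplacian_eq_smul (hF : IsLocallyFramed p n) (hB : BialgebroidIdentities p L Ls)
    (hθ : ∀ f, twistedDiv hΩ L θ (Ls.grad p.flip f) + θs (L.grad p f) = 0)
    (h1 : ∀ X, laplacianCommutator p hΩ hV hd L Ls θ θs X (ofFun 1) 1 = 0)
    {z : P} (hz : p z = θs) (u : Forms R Q) :
    laplacian hΩ hV hd L Ls θ θs u = twistedDiv hΩ L θ z • u := by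
  have hsmul := laplacian_smul hΩ hV hd hB hθ
  have hofFun : ∀ f : R, (ofFun f : Forms R Q) = f • ofFun 1 := fun f => by
    rw [ofFun_smul, mul_one]
  have hW : ∀ X u, laplacianCommutator p hΩ hV hd L Ls θ θs X u = 0 := by
    intro X
    have hWs : ∀ (f : R) u, laplacianCommutator p hΩ hV hd L Ls θ θs X (f • u) =
        f • laplacianCommutator p hΩ hV hd L Ls θ θs X u := fun f u => by
      simp only [laplacianCommutator_apply, map_smul, hsmul, smul_sub]
    -- The commutator raises degrees by `m = 1` and anticommutes with sections, so `s = -1`. Degrees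
    -- zero and one have to be checked directly.
    refine hF.eq_zero_of_exterior _ hWs (-1) (fun Y u => ?_) 1 (fun u => ?_) fun u k hk => ?_
    · rw [laplacianCommutator_exterior hΩ hV hd hB, Forms.neg_one_smul]
    · rw [laplacianCommutator_degree, Nat.cast_one, one_smul]
    · rcases Nat.le_one_iff_eq_zero_or_eq_one.1 hk with rfl | rfl
      · rw [laplacianCommutator_apply, Pi.sub_apply, exterior_apply_zero,
          laplacian_apply_zero _ _ _ _ (exterior_apply_zero _ _), sub_zero]
      -- The commutator sends `degree u'` to a form on which `degree - 1` has acted, and this has no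
      -- component of degree one. What remains is a multiple of the value on `1`.
      · obtain ⟨u', hu'⟩ := u.exists_eq_ofFun_add_degree
        rw [hu', map_add, laplacianCommutator_degree, hofFun, hWs, Pi.add_apply, Pi.smul_apply, h1,
          Pi.sub_apply, degree_apply, Nat.cast_one, one_smul, sub_self, smul_zero, add_zero]
  let T : Forms R Q →+ Forms R Q := laplacian hΩ hV hd L Ls θ θs -
    (DistribSMul.toAddMonoidHom (Forms R Q) (twistedDiv hΩ L θ z))
  have hTa : ∀ u, T u = laplacian hΩ hV hd L Ls θ θs u - twistedDiv hΩ L θ z • u := fun _ => rfl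
  have hTs : ∀ (f : R) u, T (f • u) = f • T u := fun f u => by
    rw [hTa, hTa, hsmul, smul_sub, smul_comm]
  have hTd : ∀ u, T (degree u) = degree (T u) := fun u => by
    rw [hTa, hTa, laplacian_degree, map_sub, map_smul]
  have hT1 : T (ofFun 1) = 0 := by
    rw [hTa, laplacian_one hΩ hV hd hz, hofFun (twistedDiv hΩ L θ z), sub_self]
  have hT : T u = 0 := by
    -- The Laplacian minus its value on `1` preserves degrees and commutes with sections, so `m = 0`
    -- and `s = 1`; only degree zero needs a check.
    refine hF.eq_zero_of_exterior T hTs 1 (fun Y u => ?_) 0 (fun u => ?_) (fun u k hk => ?_) u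
    · have := hW Y u
      rw [laplacianCommutator_apply, sub_eq_zero] at this
      rw [hTa, hTa, this, one_smul, map_sub, map_smul]
    · rw [hTd, Nat.cast_zero]
      module
    · obtain rfl := Nat.le_zero.1 hk
      obtain ⟨u', hu'⟩ := u.exists_eq_ofFun_add_degree
      rw [hu', map_add, hofFun, hTs, hT1, smul_zero, zero_add, hTd, degree_apply, Nat.cast_zero,
        zero_smul]
  rwa [hTa, sub_eq_zero] at hT

end Laplacian

/-! ### Structure functions in a local frame. -/

section LocalComputation

variable {R P Q : Type*} [CommRing R] [Algebra ℝ R]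
  [AddCommGroup P] [Module R P] [AddCommGroup Q] [Module R Q]
  {p : P →ₗ[R] Q →ₗ[R] R} {n : ℕ}

open Forms

namespace LocalFrame

section Frame

variable (F : LocalFrame p n)

/-- Reduction of functions to germs. -/
abbrev germ : R →+* R ⧸ F.ideal := Ideal.Quotient.mk F.ideal

theorem germ_derivation (D : Derivation ℝ R R) {f g : R} (h : F.germ f = F.germ g) :
    F.germ (D f) = F.germ (D g) := by
  rw [Ideal.Quotient.eq] at h ⊢
  rw [← map_sub]
  exact F.derivation_mem D _ h

theorem germ_χ : F.germ F.χ = 1 := by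
  rw [← map_one F.germ, eq_comm, Ideal.Quotient.eq]
  exact F.one_sub_mem

theorem germ_derivation_χ (D : Derivation ℝ R R) : F.germ (D F.χ) = 0 := by
  rw [F.germ_derivation D (f := F.χ) (g := 1) (by rw [F.germ_χ, map_one]), D.map_one_eq_zero,
    map_zero]

theorem germ_pairing (i j : Fin n) :
    F.germ (p (F.e i) (F.e' j)) = F.germ (if i = j then 1 else 0) := by
  rw [Ideal.Quotient.eq]
  exact F.dual i j

theorem germ_derivation_pairing (D : Derivation ℝ R R) (i j : Fin n) :
    F.germ (D (p (F.e i) (F.e' j))) = 0 := by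
  rw [F.germ_derivation D (F.germ_pairing i j)]
  split_ifs
  · rw [D.map_one_eq_zero, map_zero]
  · rw [map_zero, map_zero]

/-- Expansion in a frame of a first order differential operator with scalar symbol. -/
theorem germ_expand (δ : P → R) (E : P → Derivation ℝ R R) (h0 : ∀ X Y, δ (X + Y) = δ X + δ Y)
    (h : ∀ (f : R) X, δ (f • X) = f * δ X + E X f) (Z : P) :
    F.germ (δ Z) = ∑ k, (F.germ (p Z (F.e' k)) * F.germ (δ (F.e k)) +
      F.germ (E (F.e k) (p Z (F.e' k)))) := by
  have h1 : δ (F.χ • Z) = ∑ k, δ (p Z (F.e' k) • F.e k) := by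
    rw [← F.frame Z]
    exact map_sum (AddMonoidHom.mk' δ h0) _ _
  have h2 := congrArg F.germ h1
  simp only [h, map_add, map_mul, map_sum, F.germ_χ, F.germ_derivation_χ, one_mul, add_zero] at h2
  exact h2

theorem germ_expand_pairing (Z : P) (ξ : Q) : F.germ (p Z ξ) =
    ∑ k, F.germ (p Z (F.e' k)) * F.germ (p (F.e k) ξ) := by
  have := F.germ_expand (fun Z => p Z ξ) (fun _ => 0) (fun X Y => by simp) (fun f X => by simp) Z
  simpa using this

theorem germ_expand_anchor (L : LieAlgebroid R P) (Z : P) (r : R) : F.germ (L.anchor Z r) =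
    ∑ k, F.germ (p Z (F.e' k)) * F.germ (L.anchor (F.e k) r) := by
  have := F.germ_expand (fun Z => L.anchor Z r) (fun _ => 0) (fun X Y => by simp)
    (fun f X => by simp) Z
  simpa using this

theorem germ_expand_bracket (L : LieAlgebroid R P) (X Z : P) (ξ : Q) :
    F.germ (p (L.bracket X Z) ξ) = ∑ k, (F.germ (p Z (F.e' k)) *
      F.germ (p (L.bracket X (F.e k)) ξ) +
        F.germ (L.anchor X (p Z (F.e' k))) * F.germ (p (F.e k) ξ)) := by
  have := F.germ_expand (fun Z => p (L.bracket X Z) ξ) (fun Y => p Y ξ • L.anchor X)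
    (fun X Y => by simp) (fun f X => by simp [L.leibniz]; ring) Z
  simpa [mul_comm] using this

theorem germ_sum_pairing (g : Fin n → R ⧸ F.ideal) (l : Fin n) :
    ∑ k, g k * F.germ (p (F.e k) (F.e' l)) = g l := by
  simp only [F.germ_pairing]
  simp

variable (L : LieAlgebroid R P) {Ω : P [⋀^Fin n]→ₗ[R] R}

/-- The divergence of a member of the frame. -/
theorem germ_div_mul (hΩ : IsVolume Ω) (j : Fin n) :
    F.germ ((L.ad (F.e j)).div hΩ) * F.germ (Ω F.e) =
      F.germ (L.anchor (F.e j) (Ω F.e)) -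
        (∑ i, F.germ (p (L.bracket (F.e j) (F.e i)) (F.e' i))) * F.germ (Ω F.e) := by
  have h1 := congrArg (fun z => z F.e) ((L.ad (F.e j)).lie_eq_div_smul hΩ)
  simp only [AlternatingMap.smul_apply, smul_eq_mul, DerivativeEndo.lie_apply] at h1
  -- Of the expansion of `χτ` in the frame, only the term of index `i` survives in slot `i`, since
  -- the other members are repeated elsewhere. The divergence is therefore a logarithmic derivative
  -- minus a trace.
  have h2 : ∀ (τ : P) (i : Fin n), F.germ (Ω (Function.update F.e i τ)) =
      F.germ (p τ (F.e' i)) * F.germ (Ω F.e) := by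
    intro τ i
    have h3 : F.χ * Ω (Function.update F.e i τ) = p τ (F.e' i) * Ω F.e := by
      rw [← smul_eq_mul, ← AlternatingMap.map_update_smul, ← F.frame τ,
        AlternatingMap.map_update_sum, Finset.sum_eq_single i]
      · rw [AlternatingMap.map_update_smul, Function.update_eq_self, smul_eq_mul]
      · intro k _ hk
        rw [AlternatingMap.map_update_smul, AlternatingMap.map_update_self _ _ hk.symm, smul_zero]
      · simp
    have h4 := congrArg F.germ h3
    rwa [map_mul, map_mul, F.germ_χ, one_mul] at h4
  rw [← map_mul, ← h1, map_sub, map_sum, Finset.sum_mul]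
  refine congrArg₂ _ rfl (Finset.sum_congr rfl fun i _ => h2 _ _)

end Frame

variable [p.IsPerfPair] (F : LocalFrame p n) {L : LieAlgebroid R P} {Ls : LieAlgebroid R Q}

theorem germ_contractDiff (Ls : LieAlgebroid R Q) (i k l : Fin n) :
    F.germ (contractDiff p Ls (F.e i) (F.e' k) (F.e' l)) =
      -F.germ (p (F.e i) (Ls.bracket (F.e' k) (F.e' l))) := by
  rw [contractDiff_apply, map_sub, map_sub, F.germ_derivation_pairing, F.germ_derivation_pairing]
  ring

theorem germ_dual_op (L : LieAlgebroid R P) (j m l : Fin n) :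
    F.germ (p (F.e m) (((L.ad (F.e j)).dual p).op (F.e' l))) =
      -F.germ (p (L.bracket (F.e j) (F.e m)) (F.e' l)) := by
  rw [DerivativeEndo.pairing_dual_op, map_sub]
  change F.germ (L.anchor _ _) - F.germ (p (L.bracket _ _) _) = _
  rw [F.germ_derivation_pairing, zero_sub]

theorem germ_contractDiff_dual_op (i j k l : Fin n) :
    F.germ (contractDiff p Ls (F.e i) (F.e' k) (((L.ad (F.e j)).dual p).op (F.e' l))) =
      ∑ m, F.germ (p (L.bracket (F.e j) (F.e m)) (F.e' l)) *
        F.germ (p (F.e i) (Ls.bracket (F.e' k) (F.e' m))) := by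
  obtain ⟨z, hz⟩ := exists_pairing_eq (p := p) (contractDiff p Ls (F.e i) (F.e' k))
  rw [← hz, F.germ_expand_pairing]
  refine Finset.sum_congr rfl fun m _ => ?_
  rw [hz, F.germ_contractDiff, F.germ_dual_op]
  ring

/-- The compatibility of the brackets in terms of structure functions. -/
theorem germ_compatibility (hB : BialgebroidIdentities p L Ls) (i j k l : Fin n) :
    F.germ (Ls.anchor (F.e' k) (p (L.bracket (F.e j) (F.e i)) (F.e' l))) -
      F.germ (Ls.anchor (F.e' l) (p (L.bracket (F.e j) (F.e i)) (F.e' k))) -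
      ∑ m, F.germ (p (L.bracket (F.e j) (F.e i)) (F.e' m)) *
        F.germ (p (F.e m) (Ls.bracket (F.e' k) (F.e' l))) =
    (-F.germ (L.anchor (F.e j) (p (F.e i) (Ls.bracket (F.e' k) (F.e' l)))) -
      (∑ m, F.germ (p (L.bracket (F.e j) (F.e m)) (F.e' l)) *
        F.germ (p (F.e i) (Ls.bracket (F.e' k) (F.e' m)))) +
      ∑ m, F.germ (p (L.bracket (F.e j) (F.e m)) (F.e' k)) *
        F.germ (p (F.e i) (Ls.bracket (F.e' l) (F.e' m)))) -
    (-F.germ (L.anchor (F.e i) (p (F.e j) (Ls.bracket (F.e' k) (F.e' l)))) -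
      (∑ m, F.germ (p (L.bracket (F.e i) (F.e m)) (F.e' l)) *
        F.germ (p (F.e j) (Ls.bracket (F.e' k) (F.e' m)))) +
      ∑ m, F.germ (p (L.bracket (F.e i) (F.e m)) (F.e' k)) *
        F.germ (p (F.e j) (Ls.bracket (F.e' l) (F.e' m)))) := by
  have h := congrArg (fun z => F.germ (z (F.e' l)))
    (hB.contractDiff_bracket (F.e j) (F.e i) (F.e' k))
  simp only [LinearMap.sub_apply, map_sub] at h
  have ht : ∀ x y : Fin n, F.germ (((L.ad (F.e x)).dual p).transpose
      (contractDiff p Ls (F.e y) (F.e' k)) (F.e' l)) =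
      -F.germ (L.anchor (F.e x) (p (F.e y) (Ls.bracket (F.e' k) (F.e' l)))) -
      ∑ m, F.germ (p (L.bracket (F.e x) (F.e m)) (F.e' l)) *
        F.germ (p (F.e y) (Ls.bracket (F.e' k) (F.e' m))) := fun x y => by
    rw [DerivativeEndo.transpose_apply, map_sub, F.germ_contractDiff_dual_op]
    congr 1
    rw [← map_neg, ← map_neg]
    refine F.germ_derivation _ ?_
    rw [F.germ_contractDiff, map_neg]
  rw [ht, ht, contractDiff_swap Ls (F.e i) _ (F.e' l), contractDiff_swap Ls (F.e j) _ (F.e' l),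
    map_neg,
    map_neg, F.germ_contractDiff_dual_op, F.germ_contractDiff_dual_op, contractDiff_apply,
    map_sub, map_sub, F.germ_expand_pairing _ (Ls.bracket _ _)] at h
  linear_combination h

/-- The trace of the compatibility of the brackets. -/
theorem germ_compatibility_trace (hB : BialgebroidIdentities p L Ls) (j l : Fin n) :
    ∑ i, (F.germ (Ls.anchor (F.e' i) (p (L.bracket (F.e j) (F.e i)) (F.e' l))) -
      F.germ (Ls.anchor (F.e' l) (p (L.bracket (F.e j) (F.e i)) (F.e' i)))) =
    ∑ i, (-F.germ (L.anchor (F.e j) (p (F.e i) (Ls.bracket (F.e' i) (F.e' l)))) +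
      F.germ (L.anchor (F.e i) (p (F.e j) (Ls.bracket (F.e' i) (F.e' l))))) -
    (∑ i, ∑ m, F.germ (p (L.bracket (F.e j) (F.e m)) (F.e' l)) *
        F.germ (p (F.e i) (Ls.bracket (F.e' i) (F.e' m)))) +
    (∑ i, ∑ m, F.germ (p (L.bracket (F.e i) (F.e m)) (F.e' l)) *
        F.germ (p (F.e j) (Ls.bracket (F.e' i) (F.e' m)))) -
    ∑ i, ∑ m, F.germ (p (L.bracket (F.e i) (F.e m)) (F.e' i)) *
        F.germ (p (F.e j) (Ls.bracket (F.e' l) (F.e' m))) := by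
  have h := Finset.sum_congr (rfl : (Finset.univ : Finset (Fin n)) = Finset.univ)
    fun i _ => F.germ_compatibility hB i j i l
  simp only [Finset.sum_sub_distrib, Finset.sum_add_distrib, Finset.sum_neg_distrib] at h ⊢
  -- Renaming the indices turns this double sum into the quadratic term on the left of the
  -- compatibility, so the two cancel from the trace.
  have hs : ∑ i, ∑ m, F.germ (p (L.bracket (F.e j) (F.e m)) (F.e' i)) *
        F.germ (p (F.e i) (Ls.bracket (F.e' l) (F.e' m))) =
      -∑ i, ∑ m, F.germ (p (L.bracket (F.e j) (F.e i)) (F.e' m)) *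
        F.germ (p (F.e m) (Ls.bracket (F.e' i) (F.e' l))) := by
    rw [Finset.sum_comm, ← Finset.sum_neg_distrib]
    refine Finset.sum_congr rfl fun i _ => ?_
    rw [← Finset.sum_neg_distrib]
    refine Finset.sum_congr rfl fun m _ => ?_
    rw [Ls.bracket_skew (F.e' l), map_neg, map_neg, mul_neg]
  rw [hs] at h
  linear_combination h

end LocalFrame

end LocalComputation

/-! ### The commutator of the Laplacian with a section, evaluated on `1`. -/

section Modular

variable {R P Q : Type*} [CommRing R] [Algebra ℝ R]
  [AddCommGroup P] [Module R P] [AddCommGroup Q] [Module R Q]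
  {p : P →ₗ[R] Q →ₗ[R] R} {n : ℕ} {Ω : P [⋀^Fin n]→ₗ[R] R} {V : Q [⋀^Fin n]→ₗ[R] R}

open Forms

/-- The value of the component of degree one of a form on a section. -/
def Forms.evalOne {N : Type*} [AddCommGroup N] [Module R N] (x : N) : Forms R N →ₗ[R] R where
  toFun u := u 1 fun _ => x
  map_add' _ _ := rfl
  map_smul' _ _ := rfl

theorem Forms.evalOne_eq {N : Type*} [AddCommGroup N] [Module R N] (x : N) (u : Forms R N) :
    evalOne x u = interior x u 0 Fin.elim0 := by
  rw [interior_apply]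
  change u 1 _ = u 1 _
  congr 1
  funext i
  rw [Subsingleton.elim i 0]
  rfl

@[simp] theorem Forms.evalOne_ofDual {N : Type*} [AddCommGroup N] [Module R N] (x : N)
    (θ : Module.Dual R N) : evalOne x (ofDual θ) = θ x := by
  rw [evalOne_eq, interior_ofDual, ofFun_apply_zero_apply]

variable [p.IsPerfPair]

theorem interior_exteriorDiff_one (Ls : LieAlgebroid R Q) (X : P) (ξ : Q) :
    Forms.interior ξ (exteriorDiff p Ls X (ofFun 1)) = ofDual (contractDiff p Ls X ξ) := by
  rw [interior_exteriorDiff, interior_ofFun, map_zero, zero_add, exterior_ofFun, one_smul]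

theorem degree_exteriorDiff_one (Ls : LieAlgebroid R Q) (X : P) :
    degree (exteriorDiff p Ls X (ofFun 1)) =
      exteriorDiff p Ls X (ofFun 1) + exteriorDiff p Ls X (ofFun 1) := by
  have h : degree (ofFun 1 : Forms R Q) = 0 := by
    ext k v
    rcases k with _ | k <;> simp [degree_apply]
  have h1 : exteriorDiff p Ls X (degree (ofFun 1)) = degree (exteriorDiff p Ls X (ofFun 1)) -
      exteriorDiff p Ls X (ofFun 1) - exteriorDiff p Ls X (ofFun 1) := by
    simp only [exteriorDiff_apply, exterior_degree, map_sub, Ls.totalDiffHom_degree, map_add]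
    abel
  rw [h, map_zero, sub_sub, eq_comm, sub_eq_zero] at h1
  exact h1

variable (hΩ : IsVolume Ω) (hV : IsVolume V) (hd : AreDual p Ω V) {L : LieAlgebroid R P}
  {Ls : LieAlgebroid R Q} {θ : Module.Dual R P} {θs : Module.Dual R Q}

theorem evalOne_laplacianCommutator (X : P) (ξ : Q) :
    evalOne ξ (laplacianCommutator p hΩ hV hd L Ls θ θs X (ofFun 1)) =
      Ls.anchor ξ (twistedDiv hΩ L θ X) - ((L.ad X).dual p).transpose θs ξ +
        evalOne ξ (boundary hΩ hV hd L θ (exteriorDiff p Ls X (ofFun 1))) := by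
  have h1 : (ofFun 0 : Forms R Q) = 0 := by
    ext k v
    rcases k with _ | k <;> simp
  have h2 : Ls.differential 1 + (1 : R) • θs = θs := by
    ext ξ
    simp
  rw [laplacianCommutator_eq, boundary_ofFun, map_zero, sub_zero, DerivativeEndo.lieTotal_ofFun,
    Derivation.map_one_eq_zero, h1, zero_add, ofFun_smul, mul_one, Ls.totalDiffHom_ofFun,
    Ls.totalDiffHom_ofFun, h2, DerivativeEndo.lieTotal_ofDual, map_add, map_sub, map_add, map_smul]
  simp

/-- The bivector is half of `∑ eᵢ ∧ zᵢ`, with `zᵢ` its contraction with `eⁱ`, and `∂̆(Y ∧ Z) = [Y,Z]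
+ div(Y) Z - div(Z) Y` for twisted divergences. The derivative of the cut-off has zero germ. -/
theorem LocalFrame.germ_boundary_exteriorDiff (F : LocalFrame p n) (X : P) (ξ : Q) (z : Fin n → P)
    (hz : ∀ i, p (z i) = contractDiff p Ls X (F.e' i)) :
    2 * F.germ (evalOne ξ (boundary hΩ hV hd L θ (exteriorDiff p Ls X (ofFun 1)))) =
      ∑ i, (F.germ (p (L.bracket (F.e i) (z i)) ξ) +
        F.germ (twistedDiv hΩ L θ (F.e i)) * F.germ (p (z i) ξ) -
        F.germ (twistedDiv hΩ L θ (z i)) * F.germ (p (F.e i) ξ)) := by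
  set w := exteriorDiff p Ls X (ofFun 1) with hw
  have h1 : F.χ • (w + w) = ∑ i, exterior (p (F.e i)) (ofDual (p (z i))) := by
    rw [hw, ← degree_exteriorDiff_one, ← F.sum_exterior_interior]
    refine Finset.sum_congr rfl fun i _ => ?_
    rw [interior_exteriorDiff_one, hz]
  have h2 := congrArg (fun u => evalOne ξ (boundary hΩ hV hd L θ u)) h1
  have h3 : evalOne ξ (Forms.interior (L.grad p F.χ) w) =
      contractDiff p Ls X (L.grad p F.χ) ξ := by
    rw [hw, interior_exteriorDiff_one, evalOne_ofDual]
  obtain ⟨y, hy⟩ := exists_pairing_eq (p := p) (contractDiff p Ls X ξ)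
  rw [contractDiff_swap, ← hy, L.pairing_grad] at h3
  have hT : ∀ Y Z : P, ((L.ad Y).dual p).transpose (p Z) = p (L.bracket Y Z) :=
    fun Y Z => DerivativeEndo.dual_transpose _ _
  simp only [boundary_smul hΩ hV hd L θ (L.flip_grad F.χ), map_add, map_sum, map_smul, h3,
    boundary_exterior, boundary_ofDual, DerivativeEndo.lieTotal_ofDual, hT, map_sub,
    exterior_ofFun, evalOne_ofDual, LinearMap.smul_apply, smul_eq_mul] at h2
  have h4 := congrArg F.germ h2
  simp only [map_add, map_mul, map_sum, map_sub, map_neg, F.germ_χ, F.germ_derivation_χ] at h4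
  rw [← h4]
  ring

namespace LocalFrame

variable (F : LocalFrame p n)

/-- The commutator of the Laplacian with a member of the frame, in terms of structure functions. -/
theorem germ_laplacianCommutator (j l : Fin n) :
    2 * F.germ (evalOne (F.e' l) (laplacianCommutator p hΩ hV hd L Ls θ θs (F.e j) (ofFun 1))) =
      2 * F.germ (Ls.anchor (F.e' l) (twistedDiv hΩ L θ (F.e j))) -
        2 * F.germ (L.anchor (F.e j) (θs (F.e' l))) -
        (∑ k, 2 * F.germ (p (L.bracket (F.e j) (F.e k)) (F.e' l)) * F.germ (θs (F.e' k))) -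
        (∑ i, 2 * F.germ (L.anchor (F.e i) (p (F.e j) (Ls.bracket (F.e' i) (F.e' l))))) -
        (∑ i, ∑ k, F.germ (p (L.bracket (F.e i) (F.e k)) (F.e' l)) *
          F.germ (p (F.e j) (Ls.bracket (F.e' i) (F.e' k)))) -
        ∑ i, 2 * F.germ (twistedDiv hΩ L θ (F.e i)) *
          F.germ (p (F.e j) (Ls.bracket (F.e' i) (F.e' l))) := by
  -- The components of `zᵢ`, the contraction of `d_* eⱼ` with `eⁱ`, are minus the structure
  -- functions of `A*`.
  choose z hz using fun i => exists_pairing_eq (p := p) (contractDiff p Ls (F.e j) (F.e' i))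
  have hzk : ∀ i k, F.germ (p (z i) (F.e' k)) =
      F.germ (-p (F.e j) (Ls.bracket (F.e' i) (F.e' k))) := fun i k => by
    rw [hz, F.germ_contractDiff, map_neg]
  have h1 : ∀ i, F.germ (p (L.bracket (F.e i) (z i)) (F.e' l)) =
      -F.germ (L.anchor (F.e i) (p (F.e j) (Ls.bracket (F.e' i) (F.e' l)))) -
      ∑ k, F.germ (p (L.bracket (F.e i) (F.e k)) (F.e' l)) *
          F.germ (p (F.e j) (Ls.bracket (F.e' i) (F.e' k))) := fun i => by
    rw [F.germ_expand_bracket, Finset.sum_add_distrib, F.germ_sum_pairing,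
      F.germ_derivation _ (hzk i l), map_neg, map_neg]
    simp only [hzk, map_neg, neg_mul, Finset.sum_neg_distrib]
    rw [add_comm, sub_eq_add_neg]
    congr 2
    exact Finset.sum_congr rfl fun k _ => mul_comm _ _
  have h2 : ∀ i, F.germ (twistedDiv hΩ L θ (z i)) =
      ∑ k, (-F.germ (p (F.e j) (Ls.bracket (F.e' i) (F.e' k))) *
        F.germ (twistedDiv hΩ L θ (F.e k)) -
        F.germ (L.anchor (F.e k) (p (F.e j) (Ls.bracket (F.e' i) (F.e' k))))) := fun i => by
    rw [F.germ_expand (twistedDiv hΩ L θ) L.anchor (twistedDiv_add hΩ) (twistedDiv_smul hΩ)]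
    refine Finset.sum_congr rfl fun k _ => ?_
    rw [F.germ_derivation _ (hzk i k), hzk, map_neg, map_neg, map_neg]
    ring
  have h3 : F.germ (((L.ad (F.e j)).dual p).transpose θs (F.e' l)) =
      F.germ (L.anchor (F.e j) (θs (F.e' l))) +
      ∑ k, F.germ (p (L.bracket (F.e j) (F.e k)) (F.e' l)) * F.germ (θs (F.e' k)) := by
    obtain ⟨y, hy⟩ := exists_pairing_eq (p := p) θs
    rw [DerivativeEndo.transpose_apply, map_sub, ← hy, F.germ_expand_pairing y (_ : Q)]
    simp only [F.germ_dual_op, mul_neg, Finset.sum_neg_distrib, sub_neg_eq_add]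
    congr 1
    exact Finset.sum_congr rfl fun k _ => mul_comm _ _
  have h4 := F.germ_boundary_exteriorDiff hΩ hV hd (L := L) (θ := θ) (F.e j) (F.e' l) z hz
  rw [Finset.sum_sub_distrib, F.germ_sum_pairing, h2, Finset.sum_add_distrib] at h4
  simp only [h1, hzk] at h4
  rw [evalOne_laplacianCommutator, map_add, map_sub, h3, mul_add, h4]
  have hsk : ∀ i, p (F.e j) (Ls.bracket (F.e' l) (F.e' i)) =
      -p (F.e j) (Ls.bracket (F.e' i) (F.e' l)) := fun i => by
    rw [Ls.bracket_skew, map_neg]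
  simp only [hsk, map_neg, Finset.sum_sub_distrib, Finset.sum_neg_distrib, mul_neg, neg_neg,
    mul_assoc, ← Finset.mul_sum]
  have h5 : ∑ i, F.germ (p (F.e j) (Ls.bracket (F.e' i) (F.e' l))) *
      F.germ (twistedDiv hΩ L θ (F.e i)) = ∑ i, F.germ (twistedDiv hΩ L θ (F.e i)) *
      F.germ (p (F.e j) (Ls.bracket (F.e' i) (F.e' l))) :=
    Finset.sum_congr rfl fun k _ => mul_comm _ _
  rw [h5]
  ring

end LocalFrame

/-- The properties of the modular cocycles `X₀` and `ξ₀`, relative to volume forms of a pair of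
Lie algebroids in duality, that are used here. -/
structure ModularIdentities (p : P →ₗ[R] Q →ₗ[R] R) [p.IsPerfPair]
    (hΩ : IsVolume Ω) (hV : IsVolume V) (L : LieAlgebroid R P) (Ls : LieAlgebroid R Q) (X₀ : P) (ξ₀ : Q) : Prop where
  closed : L.IsClosed (p.flip ξ₀)
  closed' : Ls.IsClosed (p X₀)
  add_eq_zero : ∀ X ξ, L.anchor X + Ls.anchor ξ = 0 →
    twistedDiv hΩ L (p.flip ξ₀) X + twistedDiv hV Ls (p X₀) ξ = 0
  commutator : ∀ X ξ Y η, ⁅L.anchor X, Ls.anchor ξ⁆ = L.anchor Y + Ls.anchor η →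
    twistedDiv hΩ L (p.flip ξ₀) Y + twistedDiv hV Ls (p X₀) η =
      L.anchor X (twistedDiv hV Ls (p X₀) ξ) - Ls.anchor ξ (twistedDiv hΩ L (p.flip ξ₀) X)

end Modular

/-! ### Divergences of the anchors and the vanishing of the commutator. -/

section Modular

variable {R P Q : Type*} [CommRing R] [Algebra ℝ R]
  [AddCommGroup P] [Module R P] [AddCommGroup Q] [Module R Q]
  {p : P →ₗ[R] Q →ₗ[R] R} {n : ℕ} {Ω : P [⋀^Fin n]→ₗ[R] R} {V : Q [⋀^Fin n]→ₗ[R] R}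

open Forms

variable [p.IsPerfPair]

/-- Pairing `[X, d_*f] = L_{df} X` with `ξ` and expanding the dual actions expresses `[ρ(X), ρ_*(ξ)]
f` through anchors. Taking divergences then links the modular cocycles of `A` and `A*`. -/
theorem BialgebroidIdentities.anchor_commutator {L : LieAlgebroid R P} {Ls : LieAlgebroid R Q}
    (hB : BialgebroidIdentities p L Ls) (X : P) (ξ : Q) :
    ⁅L.anchor X, Ls.anchor ξ⁆ =
      L.anchor (Ls.grad p.flip (p X ξ) - ((Ls.ad ξ).dual p.flip).op X) +
        Ls.anchor (((L.ad X).dual p).op ξ) := by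
  ext f
  have h1 : p (L.bracket X (Ls.grad p.flip f)) ξ =
      Ls.anchor (L.grad p f) (p X ξ) - p X (Ls.bracket (L.grad p f) ξ) := by
    rw [hB.bracket_grad]
    exact DerivativeEndo.pairing_dual_op (p := p.flip) (Ls.ad (L.grad p f)) ξ X
  have h2 := DerivativeEndo.pairing_dual_op (p := p) (L.ad X) (Ls.grad p.flip f) ξ
  have h3 := DerivativeEndo.pairing_dual_op (p := p.flip) (Ls.ad ξ) (L.grad p f) X
  have h4 := hB.anchor_grad_eq f
  have h5 := hB.anchor_grad (p X ξ) f
  simp only [LinearMap.flip_apply, L.pairing_grad] at h3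
  change p (Ls.grad p.flip f) _ = L.anchor X (p _ ξ) - p (L.bracket X _) ξ at h2
  change _ = Ls.anchor ξ _ - p X (Ls.bracket ξ _) at h3
  rw [Ls.pairing_grad_flip, Ls.pairing_grad_flip] at h2
  rw [h1, Ls.bracket_skew (L.grad p f) ξ, h4, map_neg] at h2
  simp only [Derivation.commutator_apply, Derivation.add_apply, map_sub, Derivation.sub_apply,
    Derivation.neg_apply] at h2 ⊢
  linear_combination h3 - h2 - h5

variable {hΩ : IsVolume Ω} {hV : IsVolume V} {L : LieAlgebroid R P} {Ls : LieAlgebroid R Q}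
  {X₀ : P} {ξ₀ : Q}

namespace LocalFrame

variable (F : LocalFrame p n)

theorem germ_volume_mul (hd : AreDual p Ω V) : F.germ (Ω F.e) * F.germ (V F.e') = 1 := by
  rw [← map_mul, hd, RingHom.map_det]
  have : F.germ.mapMatrix (Matrix.of fun i j => p (F.e i) (F.e' j)) = 1 := by
    ext i j
    rw [RingHom.mapMatrix_apply, Matrix.map_apply, Matrix.of_apply, F.germ_pairing,
      Matrix.one_apply]
    split_ifs <;> simp
  rw [this, Matrix.det_one]

theorem germ_volume_derivation (hd : AreDual p Ω V) (D : Derivation ℝ R R) :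
    F.germ (Ω F.e) * F.germ (D (V F.e')) = -(F.germ (V F.e') * F.germ (D (Ω F.e))) := by
  have h := F.germ_derivation D (f := Ω F.e * V F.e') (g := 1) (by
    rw [map_mul, F.germ_volume_mul hd, map_one])
  rw [D.map_one_eq_zero, map_zero, D.leibniz, smul_eq_mul, smul_eq_mul, map_add, map_mul,
    map_mul] at h
  exact eq_neg_of_add_eq_zero_left h

theorem germ_div (hΩ : IsVolume Ω) (hd : AreDual p Ω V) (j : Fin n) :
    F.germ ((L.ad (F.e j)).div hΩ) = F.germ (V F.e') * F.germ (L.anchor (F.e j) (Ω F.e)) -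
      ∑ i, F.germ (p (L.bracket (F.e j) (F.e i)) (F.e' i)) := by
  have h1 := F.germ_div_mul L hΩ j
  have h2 := F.germ_volume_mul hd
  linear_combination F.germ (V F.e') * h1 - (F.germ ((L.ad (F.e j)).div hΩ) +
    ∑ i, F.germ (p (L.bracket (F.e j) (F.e i)) (F.e' i))) * h2

theorem germ_div_flip (hV : IsVolume V) (hd : AreDual p Ω V) (l : Fin n) :
    F.germ ((Ls.ad (F.e' l)).div hV) = -(F.germ (V F.e') * F.germ (Ls.anchor (F.e' l) (Ω F.e))) -
      ∑ i, F.germ (p (F.e i) (Ls.bracket (F.e' l) (F.e' i))) := by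
  rw [← F.germ_volume_derivation hd]
  exact F.flip.germ_div (L := Ls) hV hd.flip l

/-- The commutator of the anchors in terms of the modular cocycles. -/
theorem germ_modular (hB : BialgebroidIdentities p L Ls) (hd : AreDual p Ω V)
    (hM : ModularIdentities p hΩ hV L Ls X₀ ξ₀) (j l : Fin n) :
    F.germ (L.anchor (F.e j) (twistedDiv hV Ls (p X₀) (F.e' l) +
        V F.e' * Ls.anchor (F.e' l) (Ω F.e))) -
      F.germ (Ls.anchor (F.e' l) (twistedDiv hΩ L (p.flip ξ₀) (F.e j) +
        V F.e' * L.anchor (F.e j) (Ω F.e))) =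
    -(∑ k, F.germ (p (F.e j) (Ls.bracket (F.e' k) (F.e' l))) *
        F.germ (twistedDiv hΩ L (p.flip ξ₀) (F.e k) + V F.e' * L.anchor (F.e k) (Ω F.e))) -
      (∑ k, F.germ (L.anchor (F.e k) (p (F.e j) (Ls.bracket (F.e' k) (F.e' l))))) -
      (∑ k, F.germ (p (L.bracket (F.e j) (F.e k)) (F.e' l)) *
        F.germ (twistedDiv hV Ls (p X₀) (F.e' k) + V F.e' * Ls.anchor (F.e' k) (Ω F.e))) -
      ∑ k, F.germ (Ls.anchor (F.e' k) (p (L.bracket (F.e j) (F.e k)) (F.e' l))) := by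
  have hc := hB.anchor_commutator (F.e j) (F.e' l)
  -- `V(e')` is inverse to `Ω(e)`, so `V(e') D(Ω(e))` is the logarithmic derivative of `Ω(e)` along
  -- `D`. It obeys the same commutator rule as the divergence; the sum of the two is the divergence
  -- for the density `Ω(e) s`.
  have h1 := hM.commutator _ _ _ _ hc
  have h2 := congrArg (fun D => D (Ω F.e)) hc
  simp only [Derivation.commutator_apply, Derivation.add_apply] at h2
  set Y := Ls.grad p.flip (p (F.e j) (F.e' l)) - ((Ls.ad (F.e' l)).dual p.flip).op (F.e j) with hY
  set η := ((L.ad (F.e j)).dual p).op (F.e' l) with hη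
  have hYk : ∀ k, F.germ (p Y (F.e' k)) =
      F.germ (-p (F.e j) (Ls.bracket (F.e' k) (F.e' l))) := fun k => by
    have h3 := F.flip.germ_dual_op Ls l k j
    change F.germ (p (((Ls.ad (F.e' l)).dual p.flip).op (F.e j)) (F.e' k)) =
      -F.germ (p (F.e j) (Ls.bracket (F.e' l) (F.e' k))) at h3
    rw [hY, map_sub, LinearMap.sub_apply, Ls.pairing_grad_flip, map_sub,
      F.germ_derivation_pairing, h3, Ls.bracket_skew (F.e' l), map_neg, map_neg]
    ring
  have hηk : ∀ k, F.germ (p (F.e k) η) =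
      F.germ (-p (L.bracket (F.e j) (F.e k)) (F.e' l)) := fun k => by
    rw [hη, F.germ_dual_op, map_neg]
  have e1 : F.germ (twistedDiv hΩ L (p.flip ξ₀) Y) = _ :=
    F.germ_expand (twistedDiv hΩ L (p.flip ξ₀)) L.anchor (twistedDiv_add hΩ) (twistedDiv_smul hΩ) Y
  have e2 : F.germ (twistedDiv hV Ls (p X₀) η) =
      ∑ k, (F.germ (p (F.e k) η) * F.germ (twistedDiv hV Ls (p X₀) (F.e' k)) +
        F.germ (Ls.anchor (F.e' k) (p (F.e k) η))) :=
    F.flip.germ_expand (twistedDiv hV Ls (p X₀)) Ls.anchor (twistedDiv_add hV)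
      (twistedDiv_smul hV) η
  have e3 : F.germ (L.anchor Y (Ω F.e)) = _ := F.germ_expand_anchor L Y (Ω F.e)
  have e4 : F.germ (Ls.anchor η (Ω F.e)) =
      ∑ k, F.germ (p (F.e k) η) * F.germ (Ls.anchor (F.e' k) (Ω F.e)) :=
    F.flip.germ_expand_anchor Ls η (Ω F.e)
  have hYk' : ∀ k, F.germ (L.anchor (F.e k) (p Y (F.e' k))) =
      -F.germ (L.anchor (F.e k) (p (F.e j) (Ls.bracket (F.e' k) (F.e' l)))) := fun k => by
    rw [F.germ_derivation _ (hYk k), map_neg, map_neg]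
  have hηk' : ∀ k, F.germ (Ls.anchor (F.e' k) (p (F.e k) η)) =
      -F.germ (Ls.anchor (F.e' k) (p (L.bracket (F.e j) (F.e k)) (F.e' l))) := fun k => by
    rw [F.germ_derivation _ (hηk k), map_neg, map_neg]
  simp only [hYk', hηk', hYk, hηk, map_neg, Finset.sum_add_distrib, Finset.sum_neg_distrib,
    neg_mul] at e1 e2 e3 e4
  have g1 := congrArg F.germ h1
  have g2 := congrArg F.germ h2
  rw [map_add, map_sub, e1, e2] at g1
  rw [map_add, map_sub, e3, e4] at g2
  have d1 := F.germ_volume_derivation hd (L.anchor (F.e j))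
  have d2 := F.germ_volume_derivation hd (Ls.anchor (F.e' l))
  have d0 := F.germ_volume_mul hd
  have s1 : ∀ c : Fin n → R ⧸ F.ideal, ∀ r : R ⧸ F.ideal, ∀ a b : Fin n → R ⧸ F.ideal,
      ∑ k, c k * (a k + r * b k) = ∑ k, c k * a k + r * ∑ k, c k * b k := fun c r a b => by
    rw [Finset.mul_sum, ← Finset.sum_add_distrib]
    exact Finset.sum_congr rfl fun k _ => by ring
  simp only [map_add, map_mul, Derivation.leibniz, smul_eq_mul, s1]
  have d3 : F.germ (L.anchor (F.e j) (V F.e')) =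
      -(F.germ (V F.e') * F.germ (V F.e') * F.germ (L.anchor (F.e j) (Ω F.e))) := by
    linear_combination F.germ (V F.e') * d1 - F.germ (L.anchor (F.e j) (V F.e')) * d0
  have d4 : F.germ (Ls.anchor (F.e' l) (V F.e')) =
      -(F.germ (V F.e') * F.germ (V F.e') * F.germ (Ls.anchor (F.e' l) (Ω F.e))) := by
    linear_combination F.germ (V F.e') * d2 - F.germ (Ls.anchor (F.e' l) (V F.e')) * d0
  rw [d3, d4]
  linear_combination F.germ (V F.e') * g2 - g1

theorem germ_laplacianCommutator_eq_zero (hB : BialgebroidIdentities p L Ls) (hd : AreDual p Ω V)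
    (hM : ModularIdentities p hΩ hV L Ls X₀ ξ₀) {θ : Module.Dual R P} {θs : Module.Dual R Q}
    (hθ : ∀ X, 2 * θ X = p X ξ₀) (hθs : ∀ ξ, 2 * θs ξ = p X₀ ξ) (j l : Fin n) :
    F.germ (2 *
      (evalOne (F.e' l) (laplacianCommutator p hΩ hV hd L Ls θ θs (F.e j) (ofFun 1)))) = 0 := by
  have h := F.germ_laplacianCommutator hΩ hV hd (L := L) (Ls := Ls) (θ := θ) (θs := θs) j l
  -- `α` and `β` are the divergences of `ρ(e_k)` and `ρ_*(e^k)` for the density `Ω(e) s`. Doubling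
  -- the half-twisted divergence absorbs the logarithmic derivative of `Ω(e)` into them, and only
  -- traces of structure functions are left over.
  set α : Fin n → R := fun k =>
    twistedDiv hΩ L (p.flip ξ₀) (F.e k) + V F.e' * L.anchor (F.e k) (Ω F.e) with hα
  set β : Fin n → R := fun k =>
    twistedDiv hV Ls (p X₀) (F.e' k) + V F.e' * Ls.anchor (F.e' k) (Ω F.e) with hβ
  have hc : ∀ k, F.germ (2 * twistedDiv hΩ L θ (F.e k)) =
      F.germ (α k - ∑ i, p (L.bracket (F.e k) (F.e i)) (F.e' i)) := fun k => by
    have h1 : 2 * twistedDiv hΩ L θ (F.e k) =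
        twistedDiv hΩ L (p.flip ξ₀) (F.e k) + (L.ad (F.e k)).div hΩ := by
      rw [twistedDiv, twistedDiv, mul_add, hθ, LinearMap.flip_apply]
      ring
    rw [h1, map_add, F.germ_div hΩ hd, hα, map_sub, map_add, map_mul, map_sum]
    ring
  have ht : ∀ k, F.germ (2 * θs (F.e' k)) =
      F.germ (β k + ∑ i, p (F.e i) (Ls.bracket (F.e' k) (F.e' i))) := fun k => by
    have h1 : 2 * θs (F.e' k) =
        twistedDiv hV Ls (p X₀) (F.e' k) - (Ls.ad (F.e' k)).div hV := by
      rw [hθs, twistedDiv]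
      ring
    rw [h1, map_sub, F.germ_div_flip hV hd, hβ, map_add, map_add, map_mul, map_sum]
    ring
  have h2 : ∀ (D : Derivation ℝ R R) (r : R), 2 * F.germ (D r) = F.germ (D (2 * r)) := fun D r => by
    rw [two_mul, two_mul, map_add, map_add]
  have h3 : ∀ r : R, 2 * F.germ r = F.germ (2 * r) := fun r => by
    rw [map_mul, map_ofNat]
  have h4 : ∀ k, 2 * F.germ (p (L.bracket (F.e j) (F.e k)) (F.e' l)) * F.germ (θs (F.e' k)) =
      F.germ (p (L.bracket (F.e j) (F.e k)) (F.e' l)) * F.germ (β k) +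
      ∑ i, F.germ (p (L.bracket (F.e j) (F.e k)) (F.e' l)) *
        F.germ (p (F.e i) (Ls.bracket (F.e' k) (F.e' i))) := fun k => by
    rw [mul_right_comm, mul_comm _ (F.germ (p _ _)), h3, ht, map_add, mul_add, map_sum,
      Finset.mul_sum]
  rw [h3, h2, h2, F.germ_derivation _ (hc j), F.germ_derivation _ (ht l)] at h
  simp only [h4] at h
  simp only [h3, hc, map_add, map_sub, map_sum, sub_mul, Finset.sum_mul,
    Finset.sum_sub_distrib, Finset.sum_add_distrib] at h
  have hm := F.germ_modular hB hd hM j l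
  have hT := F.germ_compatibility_trace hB j l
  have x1 : ∑ i, F.germ (L.anchor (F.e j) (p (F.e i) (Ls.bracket (F.e' l) (F.e' i)))) =
      -∑ i, F.germ (L.anchor (F.e j) (p (F.e i) (Ls.bracket (F.e' i) (F.e' l)))) := by
    rw [← Finset.sum_neg_distrib]
    refine Finset.sum_congr rfl fun i _ => ?_
    rw [Ls.bracket_skew, map_neg, map_neg, map_neg]
  have x2 : ∑ k, ∑ i, F.germ (p (L.bracket (F.e j) (F.e k)) (F.e' l)) *
        F.germ (p (F.e i) (Ls.bracket (F.e' k) (F.e' i))) =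
      -∑ i, ∑ m, F.germ (p (L.bracket (F.e j) (F.e m)) (F.e' l)) *
        F.germ (p (F.e i) (Ls.bracket (F.e' i) (F.e' m))) := by
    rw [Finset.sum_comm, ← Finset.sum_neg_distrib]
    refine Finset.sum_congr rfl fun i _ => ?_
    rw [← Finset.sum_neg_distrib]
    refine Finset.sum_congr rfl fun m _ => ?_
    rw [Ls.bracket_skew, map_neg, map_neg, mul_neg]
  have x3 : ∑ i, ∑ m, F.germ (p (L.bracket (F.e i) (F.e m)) (F.e' m)) *
        F.germ (p (F.e j) (Ls.bracket (F.e' i) (F.e' l))) =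
      ∑ i, ∑ m, F.germ (p (L.bracket (F.e i) (F.e m)) (F.e' i)) *
        F.germ (p (F.e j) (Ls.bracket (F.e' l) (F.e' m))) := by
    rw [Finset.sum_comm]
    refine Finset.sum_congr rfl fun i _ => Finset.sum_congr rfl fun m _ => ?_
    rw [Ls.bracket_skew, L.bracket_skew, map_neg, map_neg, LinearMap.neg_apply, map_neg, map_neg]
    ring
  have x4 : ∑ k, F.germ (p (F.e j) (Ls.bracket (F.e' k) (F.e' l))) * F.germ (α k) =
      ∑ k, F.germ (α k) * F.germ (p (F.e j) (Ls.bracket (F.e' k) (F.e' l))) :=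
    Finset.sum_congr rfl fun k _ => mul_comm _ _
  have x5 : ∑ i, 2 * F.germ (L.anchor (F.e i) (p (F.e j) (Ls.bracket (F.e' i) (F.e' l)))) =
      2 * ∑ i, F.germ (L.anchor (F.e i) (p (F.e j) (Ls.bracket (F.e' i) (F.e' l)))) := by
    rw [Finset.mul_sum]
  simp only [Finset.sum_sub_distrib, Finset.sum_add_distrib, Finset.sum_neg_distrib] at hT
  simp only [← h3, x5, x1, x2, x3] at h
  change F.germ (L.anchor (F.e j) (β l)) - F.germ (Ls.anchor (F.e' l) (α j)) =
    -(∑ k, F.germ (p (F.e j) (Ls.bracket (F.e' k) (F.e' l))) * F.germ (α k)) - _ -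
    (∑ k, F.germ (p (L.bracket (F.e j) (F.e k)) (F.e' l)) * F.germ (β k)) - _ at hm
  rw [x4] at hm
  rw [← h3]
  -- The terms in `α` and `β` cancel by the commutator of the anchors, and the remaining derivatives
  -- and quadratic terms cancel by the traced compatibility.
  linear_combination h - hm + hT

end LocalFrame

end Modular

/-! ### The squares of both operators, and the formulas for `φ`. -/

section Square

variable {R P Q : Type*} [CommRing R] [Algebra ℝ R]
  [AddCommGroup P] [Module R P] [AddCommGroup Q] [Module R Q]
  {p : P →ₗ[R] Q →ₗ[R] R} {n : ℕ} {Ω : P [⋀^Fin n]→ₗ[R] R} {V : Q [⋀^Fin n]→ₗ[R] R}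

open Forms

section Pair

variable [p.IsPerfPair]
  {hΩ : IsVolume Ω} {hV : IsVolume V} {L : LieAlgebroid R P} {Ls : LieAlgebroid R Q}
  {X₀ : P} {ξ₀ : Q} {θ : Module.Dual R P} {θs : Module.Dual R Q}

/-- Since `ρ(d_*f) + ρ_*(df) = 0`, its fully twisted divergences sum to zero. Both untwisted
divergences are the same function, so halving this sum leaves one of them and one half of each
cocycle. -/
theorem ModularIdentities.twistedDiv_grad (hM : ModularIdentities p hΩ hV L Ls X₀ ξ₀)
    (hB : BialgebroidIdentities p L Ls) (hd : AreDual p Ω V)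
    (hθ : ∀ X, 2 * θ X = p X ξ₀) (hθs : ∀ ξ, 2 * θs ξ = p X₀ ξ) (f : R) :
    twistedDiv hΩ L θ (Ls.grad p.flip f) + θs (L.grad p f) = 0 := by
  have h1 := hM.add_eq_zero (Ls.grad p.flip f) (L.grad p f) (by
    rw [hB.anchor_grad_eq, add_neg_cancel])
  have h2 := hB.div_ad_grad hΩ hV hd f
  rw [twistedDiv, twistedDiv, LinearMap.flip_apply, ← hθ, ← hθs, ← h2] at h1
  refine nat_mul_cancel two_ne_zero ?_
  rw [twistedDiv]
  push_cast
  linear_combination h1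

/-- The value is linear over functions in the section `X`, because the Laplacian is, and in the
argument `ξ`. It is therefore enough to check members of a frame and dual frame modulo germs. -/
theorem laplacianCommutator_one (hF : IsLocallyFramed p n) (hd : AreDual p Ω V)
    (hM : ModularIdentities p hΩ hV L Ls X₀ ξ₀) (hB : BialgebroidIdentities p L Ls)
    (hθ : ∀ X, 2 * θ X = p X ξ₀) (hθs : ∀ ξ, 2 * θs ξ = p X₀ ξ) (X : P) :
    laplacianCommutator p hΩ hV hd L Ls θ θs X (ofFun 1) 1 = 0 := by
  have hsmul := laplacian_smul hΩ hV hd hB (hM.twistedDiv_grad hB hd hθ hθs)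
  ext v
  have hv : v = fun _ => v 0 := funext fun i => by rw [Subsingleton.elim i 0]
  rw [hv]
  change evalOne (v 0) (laplacianCommutator p hΩ hV hd L Ls θ θs X (ofFun 1)) = 0
  refine hF _ fun F => ?_
  have h1 : ∀ j l, F.germ (evalOne (F.e' l)
      (laplacianCommutator p hΩ hV hd L Ls θ θs (F.e j) (ofFun 1))) = 0 := fun j l => by
    rw [Ideal.Quotient.eq_zero_iff_mem]
    refine F.mem_of_two_mul_mem ?_
    rw [← Ideal.Quotient.eq_zero_iff_mem]
    exact F.germ_laplacianCommutator_eq_zero hB hd hM hθ hθs j l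
  have h2 : ∀ j ξ, F.germ (evalOne ξ
      (laplacianCommutator p hΩ hV hd L Ls θ θs (F.e j) (ofFun 1))) = 0 := fun j ξ => by
    have hl : ∀ ξ, evalOne ξ (laplacianCommutator p hΩ hV hd L Ls θ θs (F.e j) (ofFun 1)) =
        (AlternatingMap.ofSubsingleton R Q R (0 : Fin 1)).symm
          (laplacianCommutator p hΩ hV hd L Ls θ θs (F.e j) (ofFun 1) 1) ξ := fun ξ => rfl
    have h3 := F.flip.germ_expand (fun ξ => evalOne ξ
      (laplacianCommutator p hΩ hV hd L Ls θ θs (F.e j) (ofFun 1))) (fun _ => 0)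
      (fun ξ η => by simp only [hl, map_add]) (fun f ξ => by
        simp only [hl, map_smul, smul_eq_mul, Derivation.zero_apply, add_zero]) ξ
    refine h3.trans (Finset.sum_eq_zero fun l _ => ?_)
    have h4 : F.flip.germ (evalOne (F.flip.e l)
      (laplacianCommutator p hΩ hV hd L Ls θ θs (F.e j) (ofFun 1))) = 0 := h1 j l
    simp only [h4, mul_zero, Derivation.zero_apply, map_zero, add_zero]
  have h5 := F.germ_expand (fun X => evalOne (v 0)
      (laplacianCommutator p hΩ hV hd L Ls θ θs X (ofFun 1))) (fun _ => 0)
      (fun X Y => by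
        simp only [laplacianCommutator_apply, map_add, LinearMap.add_apply, map_sub]
        ring) (fun f X => by
        simp only [laplacianCommutator_apply, map_smul, LinearMap.smul_apply, hsmul, map_sub,
          smul_eq_mul, Derivation.zero_apply, add_zero]
        ring) X
  rw [← Ideal.Quotient.eq_zero_iff_mem]
  refine h5.trans (Finset.sum_eq_zero fun l _ => ?_)
  simp only [h2, mul_zero, Derivation.zero_apply, map_zero, add_zero]

theorem dirac_eq (hΩ : IsVolume Ω) (hV : IsVolume V) (hd : AreDual p Ω V) (w : Forms R Q) :
    dirac p L Ls Ω X₀ ξ₀ w = Ls.totalDiffHom ((1 / 2 : ℝ) • p X₀) w +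
      boundary hΩ hV hd L ((1 / 2 : ℝ) • p.flip ξ₀) w := by
  funext k
  rw [Pi.add_apply, boundary_apply]
  rfl

theorem two_mul_half_smul {N : Type*} [AddCommGroup N] [Module R N] (θ : Module.Dual R N) (x : N) :
    2 * ((1 / 2 : ℝ) • θ) x = θ x := by
  have h2 : 2 * algebraMap ℝ R (1 / 2) = 1 := by
    rw [← map_ofNat (algebraMap ℝ R) 2, ← map_mul]
    norm_num
  rw [LinearMap.smul_apply, Algebra.smul_def, ← mul_assoc, h2, one_mul]

theorem LieAlgebroid.IsClosed.half_smul {N : Type*} [AddCommGroup N] [Module R N]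
    {L : LieAlgebroid R N}
    {θ : Module.Dual R N} (h : L.IsClosed θ) : L.IsClosed ((1 / 2 : ℝ) • θ) := by
  intro x y
  rw [LinearMap.smul_apply, LinearMap.smul_apply, LinearMap.smul_apply, h, Derivation.map_smul,
    Derivation.map_smul, smul_sub]

/-- The squares of both operators are multiplication by the same function. -/
theorem exists_dirac_square (hF : IsLocallyFramed p n) (hd : AreDual p Ω V)
    (hM : ModularIdentities p hΩ hV L Ls X₀ ξ₀) (hB : BialgebroidIdentities p L Ls) :
    ∃ φ : R, (∀ w, dirac p L Ls Ω X₀ ξ₀ (dirac p L Ls Ω X₀ ξ₀ w) = φ • w) ∧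
      (∀ u, dirac p.flip Ls L V ξ₀ X₀ (dirac p.flip Ls L V ξ₀ X₀ u) = φ • u) ∧
      4 * φ = (L.ad X₀).div hΩ + twistedDiv hΩ L (p.flip ξ₀) X₀ ∧
      4 * φ = (Ls.ad ξ₀).div hV + twistedDiv hV Ls (p X₀) ξ₀ := by
  set θ : Module.Dual R P := (1 / 2 : ℝ) • p.flip ξ₀ with hθ
  set θs : Module.Dual R Q := (1 / 2 : ℝ) • p X₀ with hθs
  have hθ2 : ∀ X, 2 * θ X = p X ξ₀ := fun X => two_mul_half_smul (p.flip ξ₀) X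
  have hθs2 : ∀ ξ, 2 * θs ξ = p X₀ ξ := fun ξ => two_mul_half_smul (p X₀) ξ
  have hc : L.IsClosed θ := hM.closed.half_smul
  have hcs : Ls.IsClosed θs := hM.closed'.half_smul
  have hhalf : ∀ r : R, 2 * (algebraMap ℝ R (1 / 2) * r) = r := fun r => by
    rw [← mul_assoc, ← map_ofNat (algebraMap ℝ R) 2, ← map_mul]
    norm_num
  have hD : ∀ w, dirac p L Ls Ω X₀ ξ₀ w = Ls.totalDiffHom θs w + boundary hΩ hV hd L θ w :=
    dirac_eq hΩ hV hd
  have hDs : ∀ u, dirac p.flip Ls L V ξ₀ X₀ u =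
      L.totalDiffHom θ u + boundary (p := p.flip) hV hΩ hd.flip Ls θs u :=
    dirac_eq (p := p.flip) hV hΩ hd.flip
  have hz : p (algebraMap ℝ R (1 / 2) • X₀) = θs := by
    rw [map_smul, algebraMap_smul]
  have hzs : p.flip (algebraMap ℝ R (1 / 2) • ξ₀) = θ := by
    rw [map_smul, algebraMap_smul]
  set φ := twistedDiv hΩ L θ (algebraMap ℝ R (1 / 2) • X₀) with hφ
  have h1 : ∀ w, dirac p L Ls Ω X₀ ξ₀ (dirac p L Ls Ω X₀ ξ₀ w) = φ • w := fun w => by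
    rw [← laplacian_eq_smul hΩ hV hd hF hB (hM.twistedDiv_grad hB hd hθ2 hθs2)
      (laplacianCommutator_one hF hd hM hB hθ2 hθs2) hz w, laplacian_apply]
    simp only [hD, map_add, Ls.totalDiffHom_totalDiffHom hcs, boundary_boundary _ _ _ _ _ hc]
    abel
  have h2 : ∀ u, dirac p.flip Ls L V ξ₀ X₀ (dirac p.flip Ls L V ξ₀ X₀ u) = φ • u := fun u => by
    apply sharpTotal_injective hΩ hV hd
    rw [sharpTotal_square hΩ hV hd L θ Ls θs hc hcs _ _ hD hDs, h1, map_smul]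
  -- On the constant `1` the square of the dual operator is `∂̆_*` of the section `ξ₀/2`, which is a
  -- twisted divergence for `A*`.
  have h3 : φ = twistedDiv hV Ls θs (algebraMap ℝ R (1 / 2) • ξ₀) := by
    have h4 := h2 (ofFun 1)
    simp only [hDs, map_add, L.totalDiffHom_totalDiffHom hc,
      boundary_boundary (p := p.flip) _ _ _ _ _ hcs] at h4
    have h5 := laplacian_one (p := p.flip) hV hΩ hd.flip (L := Ls) (Ls := L) (θ := θs) hzs
    rw [laplacian_apply] at h5
    apply ofFun_injective (N := P)
    rw [← h5]
    rw [ofFun_smul, mul_one] at h4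
    rw [← h4]
    abel
  refine ⟨φ, h1, h2, ?_, ?_⟩
  -- `φ = ½(div_Ω X₀ + ½⟨ξ₀, X₀⟩)`, as the anchor kills the constant one half. Hence `4φ = 2 div_Ω
  -- X₀ + ⟨ξ₀, X₀⟩`, to be split into an untwisted and a fully twisted divergence.
  · have h6 := hhalf (twistedDiv hΩ L θ X₀)
    have h7 := hθ2 X₀
    rw [hφ, twistedDiv_smul, Derivation.map_algebraMap]
    rw [twistedDiv] at h6 ⊢
    rw [twistedDiv, LinearMap.flip_apply]
    linear_combination 2 * h6 + h7
  · have h6 := hhalf (twistedDiv hV Ls θs ξ₀)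
    have h7 := hθs2 ξ₀
    rw [h3, twistedDiv_smul, Derivation.map_algebraMap]
    rw [twistedDiv] at h6 ⊢
    rw [twistedDiv]
    linear_combination 2 * h6 + h7

end Pair

/-! ### Divergences with respect to the density `s`. -/

section Density

variable {m : ℕ} {s : Derivation ℝ R R [⋀^Fin m]→ₗ[R] R}

theorem lie_ofVectorField_add (D D' : Derivation ℝ R R) :
    (DerivativeEndo.ofVectorField (D + D')).lie s =
      (DerivativeEndo.ofVectorField D).lie s + (DerivativeEndo.ofVectorField D').lie s := by
  ext v
  have h : ∀ i, (DerivativeEndo.ofVectorField (D + D')).op (v i) =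
      (DerivativeEndo.ofVectorField D).op (v i) + (DerivativeEndo.ofVectorField D').op (v i) :=
    fun i => add_lie D D' (v i)
  simp only [AlternatingMap.add_apply, DerivativeEndo.lie_apply, h, AlternatingMap.map_update_add,
    Finset.sum_add_distrib]
  change (D + D') _ - _ = D _ - _ + (D' _ - _)
  rw [Derivation.add_apply]
  ring

theorem lie_ofVectorField_zero :
    (DerivativeEndo.ofVectorField (0 : Derivation ℝ R R)).lie s = 0 := by
  have h := lie_ofVectorField_add (s := s) 0 0
  rw [add_zero] at h
  exact left_eq_add.1 h

theorem lie_smul {N : Type*} [AddCommGroup N] [Module R N] {k : ℕ} (T : DerivativeEndo R N) (f : R)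
    (α : N [⋀^Fin k]→ₗ[R] R) : T.lie (f • α) = T.symbol f • α + f • T.lie α := by
  have h := congrArg (fun z => z k) (T.lieTotal_smul f (single α))
  simpa only [smul_single, lieTotal_single, Pi.add_apply, Pi.smul_apply, single_apply_self] using h

theorem lie_ofVectorField_commutator (D D' : Derivation ℝ R R) :
    (DerivativeEndo.ofVectorField ⁅D, D'⁆).lie s =
      (DerivativeEndo.ofVectorField D).lie ((DerivativeEndo.ofVectorField D').lie s) -
        (DerivativeEndo.ofVectorField D').lie ((DerivativeEndo.ofVectorField D).lie s) := by
  have h := congrArg (fun z => z m) (DerivativeEndo.lieTotal_lieTotal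
    (DerivativeEndo.ofVectorField D) (DerivativeEndo.ofVectorField D')
    (DerivativeEndo.ofVectorField ⁅D, D'⁆) (fun f => Derivation.commutator_apply _)
      (fun E => lie_lie D D' E) (single s))
  simpa only [lieTotal_single, Pi.sub_apply, single_apply_self] using h

variable [p.IsPerfPair]
  (hΩ : IsVolume Ω) (hV : IsVolume V) {L : LieAlgebroid R P} {Ls : LieAlgebroid R Q}
  {X₀ : P} {ξ₀ : Q}

/-- The divergence of `ρ(X)` with respect to `s` and that of `X` with respect to `Ω` satisfy the
same cocycle rule on brackets, so their difference `θ` satisfies it too. -/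
theorem isClosed_of_lie (hs : ∀ r : R, r • s = 0 → r = 0) {θ : Module.Dual R P}
    (hA : ∀ X, (DerivativeEndo.ofVectorField (L.anchor X)).lie s = twistedDiv hΩ L θ X • s) :
    L.IsClosed θ := by
  intro X Y
  have h := lie_ofVectorField_commutator (s := s) (L.anchor X) (L.anchor Y)
  rw [← L.anchor_bracket, hA, hA, hA, lie_smul, lie_smul, hA, hA] at h
  have h1 := hs (twistedDiv hΩ L θ (L.bracket X Y) - (L.anchor X (twistedDiv hΩ L θ Y) -
    L.anchor Y (twistedDiv hΩ L θ X))) (by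
      ext v
      have h2 := congrArg (fun z => z v) h
      simp only [AlternatingMap.add_apply, AlternatingMap.sub_apply, AlternatingMap.smul_apply,
        smul_eq_mul, AlternatingMap.zero_apply, DerivativeEndo.ofVectorField] at h2 ⊢
      linear_combination h2)
  rw [twistedDiv, twistedDiv, twistedDiv, L.div_bracket, map_add, map_add] at h1
  linear_combination h1

/-- The modular identities hold if the divergences twisted by the cocycles are the divergences of a
density. -/
theorem ModularIdentities.of_density (hs : ∀ r : R, r • s = 0 → r = 0)
    (hA : ∀ X, (DerivativeEndo.ofVectorField (L.anchor X)).lie s =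
      twistedDiv hΩ L (p.flip ξ₀) X • s)
    (hAs : ∀ ξ, (DerivativeEndo.ofVectorField (Ls.anchor ξ)).lie s =
      twistedDiv hV Ls (p X₀) ξ • s) : ModularIdentities p hΩ hV L Ls X₀ ξ₀ where
  closed := isClosed_of_lie hΩ hs hA
  closed' := isClosed_of_lie hV hs hAs
  add_eq_zero X ξ h := by
    refine hs _ ?_
    rw [add_smul, ← hA, ← hAs, ← lie_ofVectorField_add, h, lie_ofVectorField_zero]
  commutator X ξ Y η h := by
    have h1 := lie_ofVectorField_commutator (s := s) (L.anchor X) (Ls.anchor ξ)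
    rw [h, lie_ofVectorField_add, hA, hAs, hA, hAs, lie_smul, lie_smul, hA, hAs] at h1
    rw [← sub_eq_zero]
    refine hs _ ?_
    ext v
    have h2 := congrArg (fun z => z v) h1
    simp only [AlternatingMap.add_apply, AlternatingMap.sub_apply, AlternatingMap.smul_apply,
      smul_eq_mul, AlternatingMap.zero_apply, DerivativeEndo.ofVectorField] at h2 ⊢
    linear_combination h2

end Density

/-! ### Cancelling factors in tensor products of forms. -/

section Tensor

variable {N N' : Type*} [AddCommGroup N] [Module R N] [AddCommGroup N'] [Module R N'] {k l : ℕ}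

/-- The value of a tensor product of forms. -/
def tensorEval (x : Fin k → N) (y : Fin l → N') :
    (N [⋀^Fin k]→ₗ[R] R) ⊗[R] (N' [⋀^Fin l]→ₗ[R] R) →ₗ[R] R :=
  TensorProduct.lift (LinearMap.mk₂ R (fun a b => a x * b y)
    (fun a a' b => by simp [add_mul]) (fun c a b => by simp [mul_assoc])
    (fun a b b' => by simp [mul_add]) (fun c a b => by simp [mul_left_comm]))

@[simp] theorem tensorEval_tmul (x : Fin k → N) (y : Fin l → N') (a : N [⋀^Fin k]→ₗ[R] R)
    (b : N' [⋀^Fin l]→ₗ[R] R) : tensorEval x y (a ⊗ₜ[R] b) = a x * b y := by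
  simp [tensorEval]

/-- Evaluating both factors on sections turns the equality into one of functions, and the
annihilators of `a` and `b` are then removed one after the other. -/
theorem tmul_smul_injective {a : N [⋀^Fin k]→ₗ[R] R} {b : N' [⋀^Fin l]→ₗ[R] R}
    (ha : ∀ r : R, r • a = 0 → r = 0) (hb : ∀ r : R, r • b = 0 → r = 0) {r r' : R}
    (h : r • (a ⊗ₜ[R] b) = r' • (a ⊗ₜ[R] b)) : r = r' := by
  rw [← sub_eq_zero]
  refine ha _ ?_
  ext x
  refine hb _ ?_
  ext y
  have := congrArg (tensorEval x y) h
  simp only [map_smul, tensorEval_tmul, smul_eq_mul, AlternatingMap.smul_apply,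
    AlternatingMap.zero_apply] at this ⊢
  linear_combination this

theorem lie_eq_smul_of_lieTensor {T : DerivativeEndo R N} {T' : DerivativeEndo R N'}
    {a : N [⋀^Fin k]→ₗ[R] R} {b : N' [⋀^Fin l]→ₗ[R] R} (hb : ∀ r : R, r • b = 0 → r = 0) {r c : R}
    (hT : T'.lie b = r • b) (h : lieTensor T T' a b = c • (a ⊗ₜ[R] b)) :
    T.lie a = (c - r) • a := by
  ext x
  rw [← sub_eq_zero]
  refine hb _ ?_
  ext y
  have := congrArg (tensorEval x y) h
  rw [lieTensor, hT] at this
  simp only [map_add, map_smul, tensorEval_tmul, smul_eq_mul, AlternatingMap.smul_apply,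
    AlternatingMap.zero_apply] at this ⊢
  linear_combination this

theorem lie_eq_smul_of_lieTensor' {T : DerivativeEndo R N} {T' : DerivativeEndo R N'}
    {a : N [⋀^Fin k]→ₗ[R] R} {b : N' [⋀^Fin l]→ₗ[R] R} (ha : ∀ r : R, r • a = 0 → r = 0) {r c : R}
    (hT : T.lie a = r • a) (h : lieTensor T T' a b = c • (a ⊗ₜ[R] b)) :
    T'.lie b = (c - r) • b := by
  ext y
  rw [← sub_eq_zero]
  refine ha _ ?_
  ext x
  have := congrArg (tensorEval x y) h
  rw [lieTensor, hT] at this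
  simp only [map_add, map_smul, tensorEval_tmul, smul_eq_mul, AlternatingMap.smul_apply,
    AlternatingMap.zero_apply] at this ⊢
  linear_combination this

theorem lieTensor_eq_smul {T : DerivativeEndo R N} {T' : DerivativeEndo R N'}
    {a : N [⋀^Fin k]→ₗ[R] R} {b : N' [⋀^Fin l]→ₗ[R] R} {r r' : R} (hT : T.lie a = r • a)
    (hT' : T'.lie b = r' • b) : lieTensor T T' a b = (r + r') • (a ⊗ₜ[R] b) := by
  rw [lieTensor, hT, hT', TensorProduct.tmul_smul, ← TensorProduct.smul_tmul', add_smul]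

end Tensor

/-- The proposition for modules of sections with local frames. -/
theorem exists_dirac_square_of_modular [p.IsPerfPair] {m : ℕ}
    {s : Derivation ℝ R R [⋀^Fin m]→ₗ[R] R} {L : LieAlgebroid R P} {Ls : LieAlgebroid R Q}
    {X₀ : P} {ξ₀ : Q} (hF : IsLocallyFramed p n) (hL : IsLieBialgebroid p L Ls)
    (hs : ∀ r : R, r • s = 0 → r = 0) (hΩ : IsVolume Ω) (hV : IsVolume V) (hd : AreDual p Ω V)
    (hX₀ : ∀ θ, lieTensor ((Ls.ad θ).dual p.flip) (.ofVectorField (Ls.anchor θ)) Ω s =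
        p X₀ θ • (Ω ⊗ₜ[R] s))
    (hξ₀ : ∀ u, lieTensor (.ofVectorField (L.anchor u)) ((L.ad u).dual p) s V =
        p u ξ₀ • (s ⊗ₜ[R] V)) :
    ∃ φ : R, (∀ w, dirac p L Ls Ω X₀ ξ₀ (dirac p L Ls Ω X₀ ξ₀ w) = φ • w) ∧
      (∀ w, dirac p.flip Ls L V ξ₀ X₀ (dirac p.flip Ls L V ξ₀ X₀ w) = φ • w) ∧
      (∀ f : R, lieTensor (L.ad X₀) (.ofVectorField (L.anchor X₀)) Ω s =
          (4 * f) • (Ω ⊗ₜ[R] s) ↔ f = φ) ∧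
      (∀ f : R, lieTensor (.ofVectorField (Ls.anchor ξ₀)) (Ls.ad ξ₀) s V =
          (4 * f) • (s ⊗ₜ[R] V) ↔ f = φ) := by
  -- The modular equation for `ξ₀` gives `div_s ρ(X) = ⟨ξ₀, X⟩ - div_V X`, and `div_V X = -div_Ω X`.
  -- So `s` scales by the fully twisted divergence.
  have hA : ∀ X, (DerivativeEndo.ofVectorField (L.anchor X)).lie s =
      twistedDiv hΩ L (p.flip ξ₀) X • s := fun X => by
    rw [lie_eq_smul_of_lieTensor hV.eq_zero (DerivativeEndo.lie_eq_div_smul _ hV) (hξ₀ X),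
      DerivativeEndo.div_dual _ hΩ hV hd, twistedDiv, LinearMap.flip_apply,
      sub_neg_eq_add, add_comm]
  have hAs : ∀ ξ, (DerivativeEndo.ofVectorField (Ls.anchor ξ)).lie s =
      twistedDiv hV Ls (p X₀) ξ • s := fun ξ => by
    rw [lie_eq_smul_of_lieTensor' hΩ.eq_zero (DerivativeEndo.lie_eq_div_smul _ hΩ) (hX₀ ξ),
      DerivativeEndo.div_dual (p := p.flip) _ hV hΩ hd.flip, twistedDiv, sub_neg_eq_add, add_comm]
  obtain ⟨φ, h1, h2, h3, h4⟩ := exists_dirac_square hF hd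
    (ModularIdentities.of_density hΩ hV hs hA hAs) (hL.identities hF)
  have h5 : ∀ f : R, 4 * f = 4 * φ ↔ f = φ := fun f =>
    ⟨fun h => nat_mul_cancel four_ne_zero (by exact_mod_cast h), fun h => by rw [h]⟩
  refine ⟨φ, h1, h2, fun f => ?_, fun f => ?_⟩
  · rw [lieTensor_eq_smul (DerivativeEndo.lie_eq_div_smul _ hΩ) (hA X₀), ← h3, ← h5, eq_comm]
    exact ⟨tmul_smul_injective hΩ.eq_zero hs, fun h => by rw [h]⟩
  · rw [lieTensor_eq_smul (hAs ξ₀) (DerivativeEndo.lie_eq_div_smul _ hV), add_comm, ← h4, ← h5,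
      eq_comm]
    exact ⟨tmul_smul_injective hs hV.eq_zero, fun h => by rw [h]⟩

end Square

/-! ### Multilinear expansions in a cut-off frame. -/

section Expansion

variable {R N : Type*} [CommRing R] [AddCommGroup N] [Module R N] {n : ℕ} {e : Fin n → N}
  {lam : Fin n → Module.Dual R N} {χ : R}

/-- The expansion of a form in a frame. -/
theorem pow_mul_eq_sum (h : ∀ τ, ∑ i, lam i τ • e i = χ • τ) {k : ℕ} (α : N [⋀^Fin k]→ₗ[R] R)
    (X : Fin k → N) :
    χ ^ k * α X = ∑ f : Fin k → Fin n, (∏ i, lam (f i) (X i)) * α fun i => e (f i) := by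
  have h1 : (α fun i => χ • X i) = χ ^ k * α X := by
    have := α.toMultilinearMap.map_smul_univ (fun _ => χ) X
    simpa using this
  have h2 : (fun i => χ • X i) = fun i => ∑ j, lam j (X i) • e j := funext fun i => (h _).symm
  rw [← h1, h2]
  refine (α.toMultilinearMap.map_sum fun i j => lam j (X i) • e j).trans
    (Finset.sum_congr rfl fun f _ => ?_)
  exact α.toMultilinearMap.map_smul_univ (fun i => lam (f i) (X i)) fun i => e (f i)

theorem pow_mul_eq_zero_of_lt (h : ∀ τ, ∑ i, lam i τ • e i = χ • τ) {k : ℕ} (hk : n < k)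
    (α : N [⋀^Fin k]→ₗ[R] R) (X : Fin k → N) : χ ^ k * α X = 0 := by
  rw [pow_mul_eq_sum h]
  refine Finset.sum_eq_zero fun f _ => ?_
  obtain ⟨i, j, hij, hf⟩ := Fintype.exists_ne_map_eq_of_card_lt f (by simpa using hk)
  rw [α.map_eq_zero_of_eq _ (by simp only [hf]) hij, mul_zero]

theorem pow_mul_eq_zero_of_frame (h : ∀ τ, ∑ i, lam i τ • e i = χ • τ)
    (α : N [⋀^Fin n]→ₗ[R] R) (hα : α e = 0) (X : Fin n → N) : χ ^ n * α X = 0 := by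
  rw [pow_mul_eq_sum h]
  refine Finset.sum_eq_zero fun f _ => ?_
  by_cases hf : Function.Injective f
  · have h1 := α.map_perm e (Equiv.ofBijective f (Finite.injective_iff_bijective.1 hf))
    rw [hα, smul_zero] at h1
    exact mul_eq_zero_of_right _ h1
  · simp only [Function.Injective, not_forall] at hf
    obtain ⟨i, j, hf, hij⟩ := hf
    rw [α.map_eq_zero_of_eq _ (by simp only [hf]) hij, mul_zero]

/-- `χ eᵢ` in slot `j` of `α(e)` is evaluated in two ways, by its expansion in the frame and
directly. Where `χ = 1` and `α(e) ≠ 0`, this forces `lam` to be the dual frame. -/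
theorem dual_mul_eq (h : ∀ τ, ∑ i, lam i τ • e i = χ • τ) (α : N [⋀^Fin n]→ₗ[R] R)
    (i j : Fin n) : lam j (e i) * α e = χ * if i = j then α e else 0 := by
  have h1 : α (Function.update e j (χ • e i)) = lam j (e i) * α e := by
    rw [← h, AlternatingMap.map_update_sum, Finset.sum_eq_single j]
    · rw [AlternatingMap.map_update_smul, Function.update_eq_self, smul_eq_mul]
    · intro k _ hk
      rw [AlternatingMap.map_update_smul, AlternatingMap.map_update_self _ _ hk.symm, smul_zero]
    · simp
  rw [← h1, AlternatingMap.map_update_smul, smul_eq_mul]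
  split_ifs with hij
  · rw [hij, Function.update_eq_self]
  · rw [AlternatingMap.map_update_self _ _ (Ne.symm hij)]

theorem dual_frame (h : ∀ τ, ∑ i, lam i τ • e i = χ • τ)
    (μ : Module.Dual R N) : ∑ i, Module.Dual.eval R N (e i) μ • lam i = χ • μ := by
  ext τ
  have h1 := congrArg μ (h τ)
  simp only [map_sum, map_smul, smul_eq_mul] at h1
  simp only [LinearMap.sum_apply, LinearMap.smul_apply, smul_eq_mul, Module.Dual.eval_apply, ← h1]
  exact Finset.sum_congr rfl fun i _ => mul_comm _ _

end Expansion

/-! ### Germs of smooth functions and nowhere vanishing forms. -/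

section Functions

variable {𝕜 : Type*} [RCLike 𝕜] {m n : ℕ} {M : Type*} [TopologicalSpace M]
  [ChartedSpace (EuclideanSpace ℝ (Fin m)) M]

/-- The ideal of the functions that vanish near a point. -/
def vanishingIdeal (x : M) : Ideal (SmoothFn 𝕜 m M) where
  carrier := {f | ∀ᶠ y in nhds x, f y = 0}
  add_mem' := by
    intro f g hf hg
    filter_upwards [hf, hg] with y h1 h2
    rw [add_fn_apply, h1, h2, add_zero]
  zero_mem' := Filter.Eventually.of_forall fun y => rfl
  smul_mem' := by
    intro c f hf
    filter_upwards [hf] with y h1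
    rw [smul_eq_mul, mul_fn_apply, h1, mul_zero]

theorem mem_vanishingIdeal {x : M} {f : SmoothFn 𝕜 m M} :
    f ∈ vanishingIdeal x ↔ ∀ᶠ y in nhds x, f y = 0 := Iff.rfl

theorem derivation_mem_vanishingIdeal [IsManifold (𝓡 m) ∞ M] [T2Space M] (x : M)
    (D : Derivation ℝ (SmoothFn 𝕜 m M) (SmoothFn 𝕜 m M)) (f : SmoothFn 𝕜 m M)
    (hf : f ∈ vanishingIdeal x) : D f ∈ vanishingIdeal x := by
  rw [mem_vanishingIdeal] at hf ⊢
  obtain ⟨ψ, -, hψ⟩ := (SmoothBumpFunction.nhds_basis_tsupport (I := 𝓡 m) x).mem_iff.1 hf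
  let g : SmoothFn 𝕜 m M := ⟨fun y => ((ψ y : ℝ) : 𝕜),
    (RCLike.ofRealCLM (K := 𝕜)).contDiff.contMDiff.comp ψ.contMDiff⟩
  have hg : ∀ y, g y = ((ψ y : ℝ) : 𝕜) := fun _ => rfl
  -- The bump function lives where `f` vanishes. Applying `D` to `f g = 0` near `x`, where `f = 0`
  -- and `g = 1`, leaves `D f = 0`.
  have hfg : f * g = 0 := by
    ext y
    rw [mul_fn_apply, hg]
    by_cases hy : y ∈ tsupport ψ
    · have : f y = 0 := hψ hy
      rw [this, zero_mul]
      rfl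
    · rw [image_eq_zero_of_notMem_tsupport hy, RCLike.ofReal_zero, mul_zero]
      rfl
  have h1 := congrArg D hfg
  rw [D.leibniz, map_zero, smul_eq_mul, smul_eq_mul] at h1
  filter_upwards [hf, ψ.eventuallyEq_one] with y hy hψy
  have h2 := congrArg (fun r : SmoothFn 𝕜 m M => r y) h1
  simp only [add_fn_apply, mul_fn_apply, hg, hψy, hy, zero_mul, zero_add, Pi.one_apply,
    RCLike.ofReal_one, one_mul] at h2
  exact h2

variable {N : Type*} [AddCommGroup N] [Module (SmoothFn 𝕜 m M) N]

theorem NowhereVanishing.eq_zero {k : ℕ} {α : N [⋀^Fin k]→ₗ[SmoothFn 𝕜 m M] SmoothFn 𝕜 m M}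
    (hα : NowhereVanishing α) (r : SmoothFn 𝕜 m M) (h : r • α = 0) : r = 0 := by
  ext x
  obtain ⟨X, hX⟩ := hα x
  have h1 := congrArg (fun β => β X x) h
  exact (mul_eq_zero.1 h1).resolve_right hX

variable (𝕜 m n M N) in
/-- A module over the smooth functions that has local frames of rank `n`, cut off by functions. -/
def HasLocalFrames : Prop :=
  ∀ x : M, ∃ (e : Fin n → N) (lam : Fin n → Module.Dual (SmoothFn 𝕜 m M) N) (χ : SmoothFn 𝕜 m M),
    (∀ᶠ y in nhds x, χ y = 1) ∧ ∀ τ, ∑ i, lam i τ • e i = χ • τ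

theorem pow_fn_apply (f : SmoothFn 𝕜 m M) (k : ℕ) (x : M) : (f ^ k) x = f x ^ k :=
  map_pow (evalAt x) f k

variable {e : Fin n → N} {lam : Fin n → Module.Dual (SmoothFn 𝕜 m M) N} {χ : SmoothFn 𝕜 m M}

/-- Every value of `Ω` at `y` is a combination of its values on rearranged or repeated frames, which
are `± Ω(e)` or zero. If `Ω(e)` vanished at `y`, so would all values. -/
theorem NowhereVanishing.frame_ne_zero {Ω : N [⋀^Fin n]→ₗ[SmoothFn 𝕜 m M] SmoothFn 𝕜 m M}
    (hΩ : NowhereVanishing Ω) (h : ∀ τ, ∑ i, lam i τ • e i = χ • τ) {y : M} (hy : χ y = 1) :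
    Ω e y ≠ 0 := by
  intro h0
  obtain ⟨X, hX⟩ := hΩ y
  have h1 := pow_mul_eq_sum h Ω X
  have h2 : ∀ f : Fin n → Fin n, Ω (fun i => e (f i)) y = 0 := by
    intro f
    by_cases hf : Function.Injective f
    · have h1 : (Ω fun i => e (f i)) = _ :=
        Ω.map_perm e (Equiv.ofBijective f (Finite.injective_iff_bijective.1 hf))
      rw [h1]
      rcases Int.units_eq_one_or (Equiv.Perm.sign
        (Equiv.ofBijective f (Finite.injective_iff_bijective.1 hf))) with h | h
      · rw [h, one_smul, h0]
      · rw [h, Units.neg_smul, one_smul]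
        change -(Ω e y) = 0
        rw [h0, neg_zero]
    · simp only [Function.Injective, not_forall] at hf
      obtain ⟨i, j, hf, hij⟩ := hf
      rw [Ω.map_eq_zero_of_eq _ (by simp only [hf]) hij]
      rfl
  have h3 := congrArg (fun r : SmoothFn 𝕜 m M => r y) h1
  simp only [mul_fn_apply, sum_fn_apply, h2, mul_zero, Finset.sum_const_zero, pow_fn_apply, hy,
    one_pow, one_mul] at h3
  exact hX h3

/-- The form `Ω(e) α - α(e) Ω` vanishes on the frame, hence at `y`. So the ratio of two forms of top
degree does not depend on the frame. -/
theorem frame_mul_eq (Ω α : N [⋀^Fin n]→ₗ[SmoothFn 𝕜 m M] SmoothFn 𝕜 m M)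
    (h : ∀ τ, ∑ i, lam i τ • e i = χ • τ) {y : M} (hy : χ y = 1) (X : Fin n → N) :
    α X y * Ω e y = α e y * Ω X y := by
  have h1 := pow_mul_eq_zero_of_frame h (Ω e • α - α e • Ω) (by
    simp only [AlternatingMap.sub_apply, AlternatingMap.smul_apply, smul_eq_mul]
    ring) X
  have h2 := congrArg (evalAt y) h1
  simp only [AlternatingMap.sub_apply, AlternatingMap.smul_apply, smul_eq_mul, map_mul, map_sub,
    map_pow, map_zero] at h2
  change χ y ^ n * (Ω e y * α X y - α e y * Ω X y) = 0 at h2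
  rw [hy, one_pow, one_mul] at h2
  linear_combination h2

theorem NowhereVanishing.dual_apply
    {Ω : N [⋀^Fin n]→ₗ[SmoothFn 𝕜 m M] SmoothFn 𝕜 m M} (hΩ : NowhereVanishing Ω)
    (h : ∀ τ, ∑ i, lam i τ • e i = χ • τ) {y : M} (hy : χ y = 1) (i j : Fin n) :
    lam j (e i) y = if i = j then 1 else 0 := by
  have h1 := congrArg (evalAt y) (dual_mul_eq h Ω i j)
  rw [map_mul, map_mul] at h1
  change lam j (e i) y * Ω e y = χ y * _ at h1
  rw [hy, one_mul] at h1
  have h2 := hΩ.frame_ne_zero h hy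
  split_ifs at h1 ⊢ with hij
  · exact mul_right_cancel₀ h2 (h1.trans (one_mul _).symm)
  · rw [map_zero] at h1
    exact (mul_eq_zero.1 h1).resolve_right h2

/-- A nowhere vanishing form of top degree is a volume form. -/
theorem NowhereVanishing.isVolume (hN : HasLocalFrames 𝕜 m n M N)
    {Ω : N [⋀^Fin n]→ₗ[SmoothFn 𝕜 m M] SmoothFn 𝕜 m M} (hΩ : NowhereVanishing Ω) :
    IsVolume Ω where
  eq_zero := hΩ.eq_zero
  vanish {k} hk α := by
    ext X y
    obtain ⟨e, lam, χ, hχ, h⟩ := hN y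
    have h1 := congrArg (evalAt y) (pow_mul_eq_zero_of_lt h hk α X)
    rw [map_mul, map_pow, map_zero] at h1
    change χ y ^ k * α X y = 0 at h1
    rw [hχ.self_of_nhds, one_pow, one_mul] at h1
    exact h1
  exists_smul α := by
    choose e lam χ hχ h using hN
    have hne : ∀ x y, χ x y = 1 → Ω (e x) y ≠ 0 := fun x y hy => hΩ.frame_ne_zero (h x) hy
    have hχ1 : ∀ x, χ x x = 1 := fun x => (hχ x).self_of_nhds
    -- The ratio is taken at each point with the frame chosen there. Near `x` it agrees with the
    -- ratio in the one frame chosen at `x`, which is smooth.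
    have hsm : ContMDiff (𝓡 m) 𝓘(ℝ, 𝕜) ∞ fun x => α (e x) x * (Ω (e x) x)⁻¹ := by
      intro x
      have h1 : ContMDiffAt (𝓡 m) 𝓘(ℝ, 𝕜) ∞ (fun y => α (e x) y * (Ω (e x) y)⁻¹) x := by
        refine ContMDiffAt.mul ((α (e x)).contMDiff x) ?_
        have h2 : ContMDiffAt 𝓘(ℝ, 𝕜) 𝓘(ℝ, 𝕜) ∞ (fun z : 𝕜 => z⁻¹) (Ω (e x) x) :=
          (contDiffAt_inv ℝ (hne x x (hχ1 x))).contMDiffAt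
        exact h2.comp x ((Ω (e x)).contMDiff x)
      refine h1.congr_of_eventuallyEq ?_
      filter_upwards [hχ x] with y hy
      have h3 := frame_mul_eq Ω α (h x) hy (e y)
      have h4 := hne x y hy
      have h5 := hne y y (hχ1 y)
      rw [← div_eq_mul_inv, ← div_eq_mul_inv, div_eq_div_iff h5 h4, h3]
    refine ⟨⟨_, hsm⟩, ?_⟩
    ext X y
    have h3 := frame_mul_eq Ω α (h y) (hχ1 y) X
    have h4 := hne y y (hχ1 y)
    change α X y = α (e y) y * (Ω (e y) y)⁻¹ * Ω X y
    field_simp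
    exact h3

end Functions

/-! ### Sections of vector bundles and their duals. -/

section Bundle

open Bundle

variable {𝕜 : Type*} [RCLike 𝕜] {m n : ℕ} {M : Type*} [TopologicalSpace M]
  [ChartedSpace (EuclideanSpace ℝ (Fin m)) M] [IsManifold (𝓡 m) ∞ M] [T2Space M]
  {A : M → Type*}
  [TopologicalSpace (TotalSpace (Fin n → 𝕜) A)] [∀ x, AddCommGroup (A x)]
  [∀ x, Module 𝕜 (A x)] [∀ x, TopologicalSpace (A x)] [FiberBundle (Fin n → 𝕜) A]
  [VectorBundle 𝕜 (Fin n → 𝕜) A]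
  [∀ x, Module ℝ (A x)] [∀ x, IsScalarTower ℝ 𝕜 (A x)] [VectorBundle ℝ (Fin n → 𝕜) A]
  [ContMDiffVectorBundle ∞ (Fin n → 𝕜) A (𝓡 m)]

theorem hasLocalFrames_sections : HasLocalFrames 𝕜 m n M (Sections 𝕜 m n A) := by
  intro x
  obtain ⟨σ, lam, χ, hχ, h, -⟩ := exists_local_frame (𝕜 := 𝕜) (m := m) (n := n) (A := A) x
  exact ⟨σ, lam, χ, hχ, h⟩

theorem hasLocalFrames_dualSections :
    HasLocalFrames 𝕜 m n M (DualSections 𝕜 m n A) := by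
  intro x
  obtain ⟨σ, lam, χ, hχ, h⟩ := hasLocalFrames_sections (𝕜 := 𝕜) (m := m) (n := n) (A := A) x
  exact ⟨lam, fun i => Module.Dual.eval _ _ (σ i), χ, hχ, dual_frame h⟩

variable {Ω : Sections 𝕜 m n A [⋀^Fin n]→ₗ[SmoothFn 𝕜 m M] SmoothFn 𝕜 m M}

/-- The ideals are those of functions vanishing near a point, and they detect zero. The volume form
`Ω` supplies the duality of the cut-off frame and coframe. -/
theorem NowhereVanishing.isLocallyFramed (hΩ : NowhereVanishing Ω) :
    IsLocallyFramed (pairing 𝕜 m n A) n := by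
  intro r hr
  ext x
  obtain ⟨σ, lam, χ, hχ, h⟩ := hasLocalFrames_sections (𝕜 := 𝕜) (m := m) (n := n) (A := A) x
  have h1 := hr
    { ideal := vanishingIdeal x
      derivation_mem := derivation_mem_vanishingIdeal x
      e := σ
      e' := lam
      χ := χ
      one_sub_mem := by
        rw [mem_vanishingIdeal]
        filter_upwards [hχ] with y hy
        change 1 - χ y = 0
        rw [hy, sub_self]
      frame := h
      dual := fun i j => by
        rw [mem_vanishingIdeal]
        filter_upwards [hχ] with y hy
        have h2 := hΩ.dual_apply h hy i j
        change lam j (σ i) y - (if i = j then (1 : SmoothFn 𝕜 m M) else 0) y = 0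
        rw [h2]
        split_ifs
        · exact sub_self _
        · exact sub_self _ }
  have h2 : ∀ᶠ y in nhds x, r y = 0 := h1
  exact h2.self_of_nhds

theorem NowhereVanishing.of_areDual (hΩ : NowhereVanishing Ω)
    {V : DualSections 𝕜 m n A [⋀^Fin n]→ₗ[SmoothFn 𝕜 m M] SmoothFn 𝕜 m M}
    (hV : AreDual (pairing 𝕜 m n A) Ω V) : NowhereVanishing V := by
  intro x
  obtain ⟨σ, lam, χ, hχ, h⟩ := hasLocalFrames_sections (𝕜 := 𝕜) (m := m) (n := n) (A := A) x
  refine ⟨lam, fun h0 => ?_⟩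
  have h1 := congrArg (evalAt x) (hV σ lam)
  rw [map_mul, RingHom.map_det] at h1
  have h2 : (evalAt x).mapMatrix (Matrix.of fun i j => pairing 𝕜 m n A (σ i) (lam j)) = 1 := by
    ext i j
    rw [RingHom.mapMatrix_apply, Matrix.map_apply, Matrix.of_apply, Matrix.one_apply]
    exact hΩ.dual_apply h hχ.self_of_nhds i j
  rw [h2, Matrix.det_one] at h1
  change Ω σ x * V lam x = 1 at h1
  rw [h0, mul_zero] at h1
  exact zero_ne_one h1

end Bundle

end LieBialgebroids

end

theorem proposition2p3 {𝕜 : Type*} [RCLike 𝕜] (m n : ℕ)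
    {M : Type*} [TopologicalSpace M] [ChartedSpace (EuclideanSpace ℝ (Fin m)) M]
    [IsManifold (𝓡 m) ∞ M] [T2Space M] [SecondCountableTopology M]
    (A : M → Type*) [TopologicalSpace (Bundle.TotalSpace (Fin n → 𝕜) A)]
    [∀ x, AddCommGroup (A x)] [∀ x, Module 𝕜 (A x)] [∀ x, Module ℝ (A x)]
    [∀ x, IsScalarTower ℝ 𝕜 (A x)] [∀ x, TopologicalSpace (A x)]
    [FiberBundle (Fin n → 𝕜) A] [VectorBundle 𝕜 (Fin n → 𝕜) A] [VectorBundle ℝ (Fin n → 𝕜) A]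
    [ContMDiffVectorBundle ∞ (Fin n → 𝕜) A (𝓡 m)]
    (L : LieAlgebroid (SmoothFn 𝕜 m M) (Sections 𝕜 m n A))
    (Ls : LieAlgebroid (SmoothFn 𝕜 m M) (DualSections 𝕜 m n A))
    (hL : IsLieBialgebroid (pairing 𝕜 m n A) L Ls)
    (s : VectorFields 𝕜 m M [⋀^Fin m]→ₗ[SmoothFn 𝕜 m M] SmoothFn 𝕜 m M)
    (hs : NowhereVanishing s)
    (Ω : Sections 𝕜 m n A [⋀^Fin n]→ₗ[SmoothFn 𝕜 m M] SmoothFn 𝕜 m M)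
    (hΩ : NowhereVanishing Ω)
    (V : DualSections 𝕜 m n A [⋀^Fin n]→ₗ[SmoothFn 𝕜 m M] SmoothFn 𝕜 m M)
    (hV : AreDual (pairing 𝕜 m n A) Ω V)
    (X₀ : Sections 𝕜 m n A)
    (hX₀ : ∀ θ : DualSections 𝕜 m n A,
      lieTensor ((Ls.ad θ).dual (pairing 𝕜 m n A).flip) (.ofVectorField (Ls.anchor θ)) Ω s =
        pairing 𝕜 m n A X₀ θ • (Ω ⊗ₜ[SmoothFn 𝕜 m M] s))
    (ξ₀ : DualSections 𝕜 m n A)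
    (hξ₀ : ∀ u : Sections 𝕜 m n A,
      lieTensor (.ofVectorField (L.anchor u)) ((L.ad u).dual (pairing 𝕜 m n A)) s V =
        pairing 𝕜 m n A u ξ₀ • (s ⊗ₜ[SmoothFn 𝕜 m M] V)) :
    ∃ φ : SmoothFn 𝕜 m M,
      (∀ w : Forms (SmoothFn 𝕜 m M) (DualSections 𝕜 m n A),
        dirac (pairing 𝕜 m n A) L Ls Ω X₀ ξ₀ (dirac (pairing 𝕜 m n A) L Ls Ω X₀ ξ₀ w) = φ • w) ∧
      (∀ w : Forms (SmoothFn 𝕜 m M) (Sections 𝕜 m n A),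
        dirac (pairing 𝕜 m n A).flip Ls L V ξ₀ X₀ (dirac (pairing 𝕜 m n A).flip Ls L V ξ₀ X₀ w) =
          φ • w) ∧
      (∀ f : SmoothFn 𝕜 m M,
        lieTensor (L.ad X₀) (.ofVectorField (L.anchor X₀)) Ω s =
          (4 * f) • (Ω ⊗ₜ[SmoothFn 𝕜 m M] s) ↔ f = φ) ∧
      (∀ f : SmoothFn 𝕜 m M,
        lieTensor (.ofVectorField (Ls.anchor ξ₀)) (Ls.ad ξ₀) s V =
          (4 * f) • (s ⊗ₜ[SmoothFn 𝕜 m M] V) ↔ f = φ) := by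
  -- Geometry enters through local frames, reflexivity of the module of sections, which makes the
  -- pairing perfect, and nonvanishing: `Ω` and `V` are bases in top degree and `s` has no
  -- annihilator.
  exact exists_dirac_square_of_modular hΩ.isLocallyFramed hL hs.eq_zero
    (hΩ.isVolume hasLocalFrames_sections)
    ((hΩ.of_areDual hV).isVolume hasLocalFrames_dualSections) hV hX₀ hξ₀
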